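/- Let $V$ be a Euclidean space of dimension $n$ and let $\Phi$ be a (finite, reduced, not necessarily irreducible or crystallographic) root system spanning $V$, with finite Coxeter group $W$ and simple roots $\Delta=\{\alpha_1,\dots,\alpha_n\}$. Let $\delta$ be half the sum of the positive roots, and let $\mathcal C_\Phi$ be the set of all subspaces spanned by a non-empty set of roots. A *building set* is a subset $\mathcal G\subseteq\mathcal C_\Phi$ that contains all lines spanned by roots and such that every $C\in\mathcal C_\Phi$ is the direct sum of the maximal elements of $\mathcal G$ contained in $C$. Let $\mathcal G$ be a $W$-invariant building set with $V\in\mathcal G$. For a family $\mathcal H$ of subspaces, $\mathcal H_{fund}$ denotes the set of those members of $\mathcal H$ that are spanned by simple roots. A subset $\mathcal S\subseteq\mathcal G_{fund}$ is *nested* if the sum of two or more pairwise non-comparable elements of $\mathcal S$ is never in $\mathcal G_{fund}$. For $A\in\mathcal G_{fund}$ let $\pi_A$ be the orthogonal projection of $\delta$ to $A$; put $\delta_A=\delta-\pi_A$ if $A\neq V$ and $\delta_V=\delta$. For $B\subsetneq A$ in $\mathcal G_{fund}$ let $R^A_B$ be the largest coefficient of $\pi_A$ divided by the smallest coefficient of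 $\pi_B$, where $\pi_A$ and $\pi_B$ are written as linear combinations of the simple roots contained in $A$ and in $B$ respectively. Let $R^i_j$ be the maximum of the $R^A_B$ with $\dim A=i$, $\dim B=j$, and $R^i_j=1$ if there is no such pair. Let $0<\epsilon_1<\dots<\epsilon_n=a$ be a *suitable list*, i.e. $\epsilon_i>2R^i_{i-1}\epsilon_{i-1}$ for $i=2,\dots,n$. Put $H_V=\{x\in V:(x,\delta)=a\}$ and $HS_V=\{x\in V:(x,\delta)\le a\}$; for $A\in\mathcal G_{fund}\setminus\{V\}$ put $H_A=\{(x,\delta_A)=a-\epsilon_{\dim A}\}$ and $HS_A=\{(x,\delta_A)\le a-\epsilon_{\dim A}\}$; for $B\in(\mathcal C_\Phi)_{fund}\setminus\mathcal G_{fund}$, with maximal elements $A_1,\dots,A_k$ of $\mathcal G_{fund}$ contained in $B$, put $\overline{HS}_B=\{(x,\delta-\sum_i\pi_{A_i})\le a-\sum_i\epsilon_{\dim A_i}\}$. The *nestohedron* $P_{\mathcal G_{fund}}$ is the intersection of $H_V$ with all $HS_A$, $A\in\mathcal G_{fund}\setminus\{V\}$, and the *permutonestohedron* $P_{\mathcal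 G}(\Phi)$ is the intersection of all $\sigma HS_A$ and $\sigma\overline{HS}_B$ with $\sigma\in W$, $A\in\mathcal G_{fund}$, $B\in(\mathcal C_\Phi)_{fund}\setminus\mathcal G_{fund}$. Then: 1. For every maximal nested set $\mathcal S$ of $\mathcal G_{fund}$ the hyperplanes $H_A$, $A\in\mathcal S$, meet in exactly one point $v_{\mathcal S}$, which is a vertex of $P_{\mathcal G_{fund}}$ and of $P_{\mathcal G}(\Phi)$; it belongs to exactly $n$ facets of $P_{\mathcal G}(\Phi)$ if and only if $\mathcal S$ has exactly one minimal element (with respect to inclusion). 2. $P_{\mathcal G}(\Phi)$ is a polytope of dimension $n$, and it is simple (each of its vertices lies on exactly $n$ facets) if and only if $\mathcal G=\mathcal C_\Phi$. -/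

import Mathlib

open scoped InnerProductSpace

noncomputable section

namespace Permutonestohedron

variable {V : Type*} [NormedAddCommGroup V] [InnerProductSpace ℝ V] [FiniteDimensional ℝ V]

/-! ### Root systems -/

/-- The orthogonal reflection `s_α` in the hyperplane orthogonal to `α`. -/
def refl (α : V) : V ≃ₗᵢ[ℝ] V := (Submodule.span ℝ {α})ᗮ.reflection

/-- A (reduced, not necessarily irreducible or crystallographic) root system spanning the
Euclidean space `V`. -/
structure IsRootSystem (Φ : Finset V) : Prop where
  ne_zero : ∀ α ∈ Φ, α ≠ 0
  span_eq_top : Submodule.span ℝ (Φ : Set V) = ⊤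
  refl_mem : ∀ α ∈ Φ, ∀ β ∈ Φ, refl α β ∈ Φ
  reduced : ∀ α ∈ Φ, ∀ c : ℝ, c • α ∈ Φ ↔ c = 1 ∨ c = -1

/-- The finite Coxeter group `W` generated by the reflections in the roots. -/
def weylGroup (Φ : Finset V) : Subgroup (V ≃ₗᵢ[ℝ] V) :=
  Subgroup.closure (refl '' (Φ : Set V))

/-- A basis of `V` consists of simple roots for `Φ`: its elements are roots, and each root is
a linear combination of them with coefficients all `≥ 0` or all `≤ 0`. -/
structure IsSimpleSystem {n : ℕ} (Φ : Finset V) (Δ : Module.Basis (Fin n) ℝ V) : Prop where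
  mem : ∀ i, Δ i ∈ Φ
  nonneg_or_nonpos : ∀ α ∈ Φ, (∀ i, 0 ≤ Δ.repr α i) ∨ (∀ i, Δ.repr α i ≤ 0)

open Classical in
/-- The positive roots. -/
def posRoots {n : ℕ} (Φ : Finset V) (Δ : Module.Basis (Fin n) ℝ V) : Finset V :=
  {α ∈ Φ | ∀ i, 0 ≤ Δ.repr α i}

/-- The vector `δ`: half the sum of the positive roots. -/
def delta {n : ℕ} (Φ : Finset V) (Δ : Module.Basis (Fin n) ℝ V) : V :=
  (1 / 2 : ℝ) • ∑ α ∈ posRoots Φ Δ, α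

/-! ### Building sets and nested sets -/

/-- `C_Φ`: all the subspaces spanned by some (at least one) of the roots. -/
def rootSubspaces (Φ : Finset V) : Set (Submodule ℝ V) :=
  {C | ∃ s : Set V, s ⊆ Φ ∧ s.Nonempty ∧ C = Submodule.span ℝ s}

/-- The maximal elements of the family `G` that are contained in `C`. -/
def decomposition (G : Set (Submodule ℝ V)) (C : Submodule ℝ V) : Set (Submodule ℝ V) :=
  {A | Maximal (fun X => X ∈ G ∧ X ≤ C) A}

/-- Building sets associated to the arrangement of the lines spanned by the roots: each element
of `C_Φ` is the direct sum of the maximal elements of `G` contained in it. -/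
structure IsBuildingSet (Φ : Finset V) (G : Set (Submodule ℝ V)) : Prop where
  subset : G ⊆ rootSubspaces Φ
  line_mem : ∀ α ∈ Φ, Submodule.span ℝ {α} ∈ G
  sSupIndep_decomposition : ∀ C ∈ rootSubspaces Φ, sSupIndep (decomposition G C)
  sSup_decomposition : ∀ C ∈ rootSubspaces Φ, sSup (decomposition G C) = C

/-- The members of the family `G` that are spanned by a set of simple roots. -/
def fund {n : ℕ} (Δ : Module.Basis (Fin n) ℝ V) (G : Set (Submodule ℝ V)) :
    Set (Submodule ℝ V) :=
  {A | A ∈ G ∧ ∃ s : Set V, s ⊆ Set.range Δ ∧ A = Submodule.span ℝ s}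

/-- `S ⊆ G` is `G`-nested: the sum of two or more pairwise non-comparable elements of `S` is
never in `G`. -/
def IsNested (G S : Set (Submodule ℝ V)) : Prop :=
  S ⊆ G ∧ ∀ T ⊆ S, T.Nontrivial → IsAntichain (· ≤ ·) T → sSup T ∉ G

/-- Maximal nested sets of `G`. -/
def IsMaximalNested (G S : Set (Submodule ℝ V)) : Prop :=
  Maximal (IsNested G) S

/-! ### Suitable lists -/

section

variable {n : ℕ} (Φ : Finset V) (Δ : Module.Basis (Fin n) ℝ V) (G : Set (Submodule ℝ V))
  (ε : ℕ → ℝ)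

/-- `π_A`: the component in `A` of `δ`. -/
def piVec (A : Submodule ℝ V) : V := A.starProjection (delta Φ Δ)

/-- The largest coefficient of `π_A` on the simple roots in `A`. -/
def maxCoeff (A : Submodule ℝ V) : ℝ :=
  ⨆ i : {i // Δ i ∈ A}, Δ.repr (piVec Φ Δ A) i

/-- The smallest coefficient of `π_B` on the simple roots in `B`. -/
def minCoeff (B : Submodule ℝ V) : ℝ :=
  ⨅ i : {i // Δ i ∈ B}, Δ.repr (piVec Φ Δ B) i

/-- The ratios `R^A_B`, for `B ⊂ A` in `G_fund` with `dim A = i`, `dim B = j`. -/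
def ratios (i j : ℕ) : Set ℝ :=
  {r | ∃ A ∈ fund Δ G, ∃ B ∈ fund Δ G, B < A ∧ Module.finrank ℝ A = i ∧
    Module.finrank ℝ B = j ∧ r = maxCoeff Φ Δ A / minCoeff Φ Δ B}

open Classical in
/-- `R^i_j`: the largest of the ratios `R^A_B` with `dim A = i`, `dim B = j`, and `1` if there is
no such pair `B ⊂ A`. -/
def R (i j : ℕ) : ℝ :=
  if (ratios Φ Δ G i j).Nonempty then sSup (ratios Φ Δ G i j) else 1

/-- Suitable lists `0 < ε 1 < ε 2 < ⋯ < ε n`; the other values of `ε` are irrelevant. -/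
structure IsSuitable : Prop where
  pos : ∀ i, 1 ≤ i → i ≤ n → 0 < ε i
  lt : ∀ i, 1 ≤ i → i + 1 ≤ n → ε i < ε (i + 1)
  suitable : ∀ i, 1 ≤ i → i + 1 ≤ n → 2 * R Φ Δ G (i + 1) i * ε i < ε (i + 1)

/-! ### The permutonestohedron -/

/-- `δ_A`: the component of `δ` orthogonal to `A` when `A ≠ V`, and `δ_V = δ`. -/
def deltaVec (A : Submodule ℝ V) : V :=
  open Classical in
  if A = ⊤ then delta Φ Δ else Aᗮ.starProjection (delta Φ Δ)

/-- The constant in the equation of `H_A`: it is `a - ε_{dim A}` when `A ≠ V`, and `a` when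
`A = V`, where `a = ε_n`. -/
def level (A : Submodule ℝ V) : ℝ :=
  open Classical in
  if A = ⊤ then ε n else ε n - ε (Module.finrank ℝ A)

/-- The hyperplane `H_A`, for `A` in `G_fund`. -/
def hyperplane (A : Submodule ℝ V) : Set V :=
  {x | ⟪x, deltaVec Φ Δ A⟫_ℝ = level (n := n) ε A}

/-- The closed half-space `HS_A` bounded by `H_A` and containing the origin. -/
def halfSpace (A : Submodule ℝ V) : Set V :=
  {x | ⟪x, deltaVec Φ Δ A⟫_ℝ ≤ level (n := n) ε A}

/-- The closed half-space attached to `B` in `C_{Φ_fund} - G_fund`: it contains the origin and is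
bounded by the hyperplane
`(x, δ - π_{A_1} - ⋯ - π_{A_k}) = a - ε_{dim A_1} - ⋯ - ε_{dim A_k}`, where `A_1, …, A_k` is
the `G_fund`-decomposition of `B`. -/
def halfSpaceBar (B : Submodule ℝ V) : Set V :=
  {x | ⟪x, delta Φ Δ - ∑ᶠ A ∈ decomposition (fund Δ G) B, piVec Φ Δ A⟫_ℝ ≤
    ε n - ∑ᶠ A ∈ decomposition (fund Δ G) B, ε (Module.finrank ℝ A)}

/-- The nestohedron in the fundamental chamber. -/
def nestohedron : Set V :=
  hyperplane Φ Δ ε ⊤ ∩ ⋂ A ∈ fund Δ G \ {⊤}, halfSpace Φ Δ ε A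

/-- The permutonestohedron. -/
def permutonestohedron : Set V :=
  ⋂ σ ∈ weylGroup Φ,
    (⋂ A ∈ fund Δ G, σ '' halfSpace Φ Δ ε A) ∩
    (⋂ B ∈ fund Δ (rootSubspaces Φ) \ fund Δ G, σ '' halfSpaceBar Φ Δ G ε B)

end

/-! ### Polytopes -/

/-- The dimension of (the affine span of) a set. -/
def dimension (P : Set V) : ℕ := Module.finrank ℝ (vectorSpan ℝ P)

/-- Convex polytopes: convex hulls of finite sets. -/
def IsPolytope (P : Set V) : Prop := ∃ s : Set V, s.Finite ∧ P = convexHull ℝ s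

/-- Facets: non-empty faces of codimension one in `P`. -/
def IsFacet (P F : Set V) : Prop :=
  IsExposed ℝ P F ∧ F.Nonempty ∧ dimension F + 1 = dimension P

/-- Simple polytopes: each vertex is in exactly `dim P` facets. -/
def IsSimplePolytope (P : Set V) : Prop :=
  IsPolytope P ∧ ∀ v ∈ P.extremePoints ℝ,
    {F | IsFacet P F ∧ v ∈ F}.encard = dimension P

end Permutonestohedron

end

open scoped InnerProductSpace

noncomputable section

namespace Permutonestohedron

set_option linter.unusedSectionVars false

/-! ### Polyhedra given by finitely many inequalities -/

section Polyhedron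

variable {V : Type*} [NormedAddCommGroup V] [InnerProductSpace ℝ V]

/-! Work in the coordinates y_i = (x, α_i). For a set I of simple roots, let ρ_I be half the sum of
the positive roots in its span (`halfSum`). The reflections s_i with i ∈ I permute the remaining
positive roots, so δ - ρ_I is orthogonal to the span and ρ_I is the projection of δ
(`piVec_simpleSpan`). On H_V, membership in H_A therefore reads (x, ρ_A) = ε_|A|: an equation in the
y_i, i ∈ A, with positive coefficients.

G_fund becomes a family of subsets of `Fin n`, closed under unions of intersecting members. In a
maximal nested set S each A has exactly one own element, lying in no smaller member, and the
components of the rest of A belong to S. The equations of S are thus triangular and determine v_S.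
Suitability, stated for consecutive dimensions, extends to all pairs C ⊂ A
(`IsSuitable.isDominated`). It makes the own term of A at least ε_|A| / 2; hence all y_i are
positive at v_S, and (v_S, ρ_C) > ε_|C| for C outside S (`IsDominated.pos_and_half_le`,
`IsDominated.lt_sum`).

All half-spaces are indexed uniformly by proper subsets I, with normal N_I = δ - ∑ ρ_A over the
components A of I; I = ∅ gives HS_V. Each N_I is dominant, so (v, σ N_I) ≤ (v, N_I) for dominant v:
inside the chamber the translates add nothing, and at a strictly dominant point of the polyhedron an
active translate satisfies σ N_I = N_I (`active_eq_image_of_pos`). The facets at v_S then correspond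
to the I whose components all lie in S. The empty set and the members of S other than V give n of
these; the union of two incomparable members gives another. So there are n facets iff S is a chain,
iff S has one minimal element.

If G ≠ C_Φ, a missing subspace is conjugate to the span of some set I of simple roots, and the
components of I extend to a maximal nested set that is not a chain. If G = C_Φ, move an arbitrary
vertex into the closed chamber. The growth of ε keeps it off the walls and makes its active sets a
chain, hence at most n of them; extremality requires at least n, so the normals are independent and
the vertex is simple (`active_of_dominant`). -/

/-- The polyhedron of the inequalities `⟪x, p.1⟫ ≤ p.2`, for `p` in `K`. -/
def polyhedron (K : Set (V × ℝ)) : Set V := {x | ∀ p ∈ K, ⟪x, p.1⟫_ℝ ≤ p.2}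

/-- The inequalities of `K` that are equalities at `v`. -/
def active (K : Set (V × ℝ)) (v : V) : Set (V × ℝ) := {p | p ∈ K ∧ ⟪v, p.1⟫_ℝ = p.2}

/-- The face of the polyhedron of `K` on which the inequality `p` is an equality. -/
def face (K : Set (V × ℝ)) (p : V × ℝ) : Set V := {x | x ∈ polyhedron K ∧ ⟪x, p.1⟫_ℝ = p.2}

variable {K : Set (V × ℝ)} {v : V}

/-- Finitely many strict inequalities survive a small displacement. The bound is on |s| because
extremality needs both signs. -/
theorem exists_pos_forall_inner_add_smul_lt (hK : K.Finite) (v u : V) :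
    ∃ t : ℝ, 0 < t ∧ ∀ s : ℝ, |s| ≤ t → ∀ p ∈ K, ⟪v, p.1⟫_ℝ < p.2 → ⟪v + s • u, p.1⟫_ℝ < p.2 := by
  have h : ∀ᶠ s : ℝ in nhds 0, ∀ p ∈ K, ⟪v, p.1⟫_ℝ < p.2 → ⟪v + s • u, p.1⟫_ℝ < p.2 := by
    rw [Filter.eventually_all_finite hK]
    intro p _
    by_cases hp : ⟪v, p.1⟫_ℝ < p.2
    · have hc : Continuous fun s : ℝ => ⟪v + s • u, p.1⟫_ℝ := by fun_prop
      have := hc.continuousAt.eventually_lt (x₀ := (0 : ℝ)) continuousAt_const (by simpa using hp)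
      exact this.mono fun s hs _ => hs
    · exact Filter.Eventually.of_forall fun s hs => absurd hs hp
  obtain ⟨r, hr, hb⟩ := Metric.eventually_nhds_iff.1 h
  refine ⟨r / 2, by positivity, fun s hs => hb ?_⟩
  rw [Real.dist_eq, sub_zero]
  linarith

theorem convex_polyhedron (K : Set (V × ℝ)) : Convex ℝ (polyhedron K) := by
  intro x hx y hy a b ha hb hab p hp
  rw [inner_add_left, inner_smul_left, inner_smul_left]
  have h1 := mul_le_mul_of_nonneg_left (hx p hp) ha
  have h2 := mul_le_mul_of_nonneg_left (hy p hp) hb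
  simp only [conj_trivial]
  have : a * p.2 + b * p.2 = p.2 := by rw [← add_mul, hab, one_mul]
  linarith

theorem isClosed_polyhedron (K : Set (V × ℝ)) : IsClosed (polyhedron K) := by
  have : polyhedron K = ⋂ p ∈ K, {x | ⟪x, p.1⟫_ℝ ≤ p.2} := by
    ext x; simp [polyhedron]
  rw [this]
  exact isClosed_biInter fun p _ => isClosed_le (by fun_prop) (by fun_prop)

/-! ### Extreme points, boundedness and dimension of polyhedra -/

theorem mem_extremePoints_polyhedron (hv : v ∈ polyhedron K)
    (h : ∀ u, (∀ p ∈ active K v, ⟪u, p.1⟫_ℝ = 0) → u = 0) :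
    v ∈ (polyhedron K).extremePoints ℝ := by
  rw [mem_extremePoints_iff_left]
  refine ⟨hv, fun x hx y hy hxy => ?_⟩
  obtain ⟨a, b, ha, hb, hab, rfl⟩ := hxy
  have key : x - y = 0 := by
    refine h _ fun p hp => ?_
    have hp2 := hp.2
    have h1 := hx p hp.1
    have h2 := hy p hp.1
    rw [inner_add_left, inner_smul_left, inner_smul_left] at hp2
    simp only [conj_trivial] at hp2
    rw [inner_sub_left]
    have h3 : a * (p.2 - ⟪x, p.1⟫_ℝ) + b * (p.2 - ⟪y, p.1⟫_ℝ) = 0 := by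
      have : a * p.2 + b * p.2 = p.2 := by rw [← add_mul, hab, one_mul]
      linarith
    have h4 : 0 ≤ a * (p.2 - ⟪x, p.1⟫_ℝ) := mul_nonneg ha.le (by linarith)
    have h5 : 0 ≤ b * (p.2 - ⟪y, p.1⟫_ℝ) := mul_nonneg hb.le (by linarith)
    have h6 : a * (p.2 - ⟪x, p.1⟫_ℝ) = 0 := by linarith
    have h7 : b * (p.2 - ⟪y, p.1⟫_ℝ) = 0 := by linarith
    have h8 := (mul_eq_zero.1 h6).resolve_left ha.ne'
    have h9 := (mul_eq_zero.1 h7).resolve_left hb.ne'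
    linarith
  rw [sub_eq_zero.1 key, ← add_smul, hab, one_smul]

/-- Such a `u` allows a small move in both directions: active inequalities stay equalities and the
others stay strict, so a nonzero `u` would make `v` a midpoint. -/
theorem eq_zero_of_mem_extremePoints (hK : K.Finite) (hv : v ∈ (polyhedron K).extremePoints ℝ)
    (u : V) (h : ∀ p ∈ active K v, ⟪u, p.1⟫_ℝ = 0) : u = 0 := by
  obtain ⟨t, ht, hlt⟩ := exists_pos_forall_inner_add_smul_lt hK v u
  have hmem : ∀ s : ℝ, |s| ≤ t → v + s • u ∈ polyhedron K := by
    intro s hs p hp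
    rcases (hv.1 p hp).lt_or_eq with hp' | hp'
    · exact (hlt s hs p hp hp').le
    · rw [inner_add_left, inner_smul_left, h p ⟨hp, hp'⟩]
      simp [hp']
  have h1 := hmem t (by rw [abs_of_pos ht])
  have h2 := hmem (-t) (by rw [abs_neg, abs_of_pos ht])
  have h3 : v ∈ openSegment ℝ (v + t • u) (v + (-t) • u) := by
    refine ⟨1 / 2, 1 / 2, by norm_num, by norm_num, by norm_num, ?_⟩
    module
  have h4 := (mem_extremePoints_iff_left.1 hv).2 _ h1 _ h2 h3
  have h5 : t • u = 0 := by simpa using h4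
  exact (smul_eq_zero.1 h5).resolve_left ht.ne'

theorem finite_extremePoints_polyhedron (hK : K.Finite) :
    ((polyhedron K).extremePoints ℝ).Finite := by
  have hmaps : Set.MapsTo (active K) ((polyhedron K).extremePoints ℝ) (𝒫 K) :=
    fun v _ p hp => hp.1
  refine Set.Finite.of_finite_image (f := active K)
    (hK.finite_subsets.subset (Set.image_subset_iff.2 hmaps)) ?_
  intro v hv w hw hvw
  have := eq_zero_of_mem_extremePoints hK hv (w - v) fun p hp => by
    have hp' : p ∈ active K w := hvw ▸ hp
    rw [inner_sub_left, hp.2, hp'.2, sub_self]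
  exact (sub_eq_zero.1 this).symm

theorem isPolytope_polyhedron [FiniteDimensional ℝ V] (hK : K.Finite)
    (hb : Bornology.IsBounded (polyhedron K)) :
    IsPolytope (polyhedron K) := by
  refine ⟨_, finite_extremePoints_polyhedron hK, ?_⟩
  have hc : IsCompact (polyhedron K) := Metric.isCompact_of_isClosed_isBounded
    (isClosed_polyhedron K) hb
  rw [← (finite_extremePoints_polyhedron hK).isCompact_convexHull ℝ |>.isClosed.closure_eq,
    closure_convexHull_extremePoints hc (convex_polyhedron K)]

theorem vectorSpan_polyhedron_eq_top (hK : K.Finite) {o : V}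
    (ho : ∀ p ∈ K, ⟪o, p.1⟫_ℝ < p.2) : vectorSpan ℝ (polyhedron K) = ⊤ := by
  rw [eq_top_iff]
  rintro u -
  obtain ⟨t, ht, hlt⟩ := exists_pos_forall_inner_add_smul_lt hK o u
  have h1 : o + t • u ∈ polyhedron K := fun p hp =>
    (hlt t (abs_of_pos ht).le p hp (ho p hp)).le
  have h2 := vsub_mem_vectorSpan ℝ h1 (fun p hp => (ho p hp).le : o ∈ polyhedron K)
  rw [vsub_eq_sub, add_sub_cancel_left] at h2
  exact (Submodule.smul_mem_iff _ ht.ne').1 h2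

theorem dimension_polyhedron (hK : K.Finite) {o : V}
    (ho : ∀ p ∈ K, ⟪o, p.1⟫_ℝ < p.2) : dimension (polyhedron K) = Module.finrank ℝ V := by
  rw [dimension, vectorSpan_polyhedron_eq_top hK ho, finrank_top]

/-! ### Facets of polyhedra -/

theorem finrank_orthogonal_span_singleton_add_one [FiniteDimensional ℝ V] {x : V} (hx : x ≠ 0) :
    Module.finrank ℝ (ℝ ∙ x)ᗮ + 1 = Module.finrank ℝ V := by
  rw [← (ℝ ∙ x).finrank_add_finrank_orthogonal, finrank_span_singleton hx, add_comm]

theorem vectorSpan_le_orthogonal {F : Set V} {x : V} {c : ℝ} (h : ∀ y ∈ F, ⟪y, x⟫_ℝ = c) :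
    vectorSpan ℝ F ≤ (ℝ ∙ x)ᗮ := by
  rw [vectorSpan_def, Submodule.span_le]
  rintro _ ⟨y, hy, z, hz, rfl⟩
  rw [SetLike.mem_coe, Submodule.mem_orthogonal_singleton_iff_inner_left]
  simp only [vsub_eq_sub]
  rw [inner_sub_left, h y hy, h z hz, sub_self]

/-- The point `w` is in the relative interior of the face: it can move a little in every direction
orthogonal to `p.1`, which gives codimension one. -/
theorem isFacet_face [FiniteDimensional ℝ V] (hK : K.Finite) {o : V}
    (ho : ∀ p ∈ K, ⟪o, p.1⟫_ℝ < p.2)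
    {p : V × ℝ} (hp : p ∈ K) {w : V} (hw : ⟪w, p.1⟫_ℝ = p.2)
    (hlt : ∀ q ∈ K, q ≠ p → ⟪w, q.1⟫_ℝ < q.2) : IsFacet (polyhedron K) (face K p) := by
  have hwP : w ∈ polyhedron K := fun q hq => by
    by_cases h : q = p
    · rw [h, hw]
    · exact (hlt q hq h).le
  have hp0 : p.1 ≠ 0 := by
    intro h
    have := ho p hp
    rw [← hw, h, inner_zero_right, inner_zero_right] at this
    exact lt_irrefl _ this
  refine ⟨fun _ => ⟨innerSL ℝ p.1, ?_⟩, ⟨w, hwP, hw⟩, ?_⟩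
  · ext x
    simp only [face, Set.mem_ofPred_eq, innerSL_apply_apply]
    refine and_congr_right fun hx => ⟨fun h y hy => ?_, fun h => ?_⟩
    · rw [real_inner_comm, real_inner_comm x, h]
      exact hy p hp
    · refine le_antisymm (hx p hp) ?_
      rw [← hw, real_inner_comm, real_inner_comm p.1 x]
      exact h w hwP
  · rw [dimension_polyhedron hK ho, ← finrank_orthogonal_span_singleton_add_one hp0, dimension]
    refine congrArg (· + 1) ?_
    refine congrArg (fun U : Submodule ℝ V => Module.finrank ℝ U)
      (le_antisymm (vectorSpan_le_orthogonal fun y hy => hy.2) fun u hu => ?_)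
    rw [Submodule.mem_orthogonal_singleton_iff_inner_left] at hu
    obtain ⟨t, ht, hlt'⟩ := exists_pos_forall_inner_add_smul_lt hK w u
    have h0 : ⟪w + t • u, p.1⟫_ℝ = p.2 := by
      rw [inner_add_left, inner_smul_left, hu, mul_zero, add_zero, hw]
    have h1 : w + t • u ∈ face K p := by
      refine ⟨fun q hq => ?_, h0⟩
      by_cases h : q = p
      · rw [h, h0]
      · exact (hlt' t (abs_of_pos ht).le q hq (hlt q hq h)).le
    have h2 := vsub_mem_vectorSpan ℝ h1 (⟨hwP, hw⟩ : w ∈ face K p)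
    rw [vsub_eq_sub, add_sub_cancel_left] at h2
    exact (Submodule.smul_mem_iff _ ht.ne').1 h2

/-- Supplies a relatively interior point of a face: taking midpoints with successive witnesses keeps
every strict inequality already obtained. -/
theorem exists_mem_forall_inner_lt (hK : K.Finite) {F : Set V} (hF : Convex ℝ F)
    (hFK : F ⊆ polyhedron K) (hne : F.Nonempty) :
    ∃ x ∈ F, ∀ p ∈ K, (∃ z ∈ F, ⟪z, p.1⟫_ℝ < p.2) → ⟪x, p.1⟫_ℝ < p.2 := by
  suffices h : ∀ L : Set (V × ℝ), L.Finite → L ⊆ K →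
      ∃ x ∈ F, ∀ p ∈ L, (∃ z ∈ F, ⟪z, p.1⟫_ℝ < p.2) → ⟪x, p.1⟫_ℝ < p.2 from h K hK subset_rfl
  intro L hL
  induction L, hL using Set.Finite.induction_on with
  | empty =>
    intro _
    exact ⟨hne.some, hne.some_mem, by simp⟩
  | @insert a L _ _ ih =>
    intro hsub
    obtain ⟨x, hx, hxp⟩ := ih fun p hp => hsub (Set.mem_insert_of_mem _ hp)
    by_cases ha : ∃ z ∈ F, ⟪z, a.1⟫_ℝ < a.2
    · obtain ⟨z, hz, hza⟩ := ha
      have hin : ∀ p : V × ℝ, ⟪(1 / 2 : ℝ) • x + (1 / 2 : ℝ) • z, p.1⟫_ℝ =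
          1 / 2 * ⟪x, p.1⟫_ℝ + 1 / 2 * ⟪z, p.1⟫_ℝ := fun p => by
        rw [inner_add_left, inner_smul_left, inner_smul_left]; simp
      refine ⟨(1 / 2 : ℝ) • x + (1 / 2 : ℝ) • z,
        hF hx hz (by norm_num) (by norm_num) (by norm_num), ?_⟩
      intro p hp hex
      rw [hin]
      rcases Set.mem_insert_iff.1 hp with rfl | hp'
      · have := hFK hx p (hsub hp)
        linarith
      · have h1 := hxp p hp' hex
        have := hFK hz p (hsub hp)
        linarith
    · refine ⟨x, hx, fun p hp hex => ?_⟩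
      rcases Set.mem_insert_iff.1 hp with rfl | hp'
      · exact absurd hex ha
      · exact hxp p hp' hex

theorem exists_face_eq_of_isFacet [FiniteDimensional ℝ V] (hK : K.Finite) {o : V}
    (ho : ∀ p ∈ K, ⟪o, p.1⟫_ℝ < p.2)
    {F : Set V} (hF : IsFacet (polyhedron K) F) : ∃ p ∈ K, F = face K p := by
  obtain ⟨hexp, hne, hdim⟩ := hF
  obtain ⟨l, hl⟩ := hexp hne
  have hFK : F ⊆ polyhedron K := by rw [hl]; exact fun x hx => hx.1
  obtain ⟨x, hx, hxp⟩ := exists_mem_forall_inner_lt hK (hexp.convex (convex_polyhedron K)) hFK hne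
  have hlx : ∀ y ∈ polyhedron K, l y ≤ l x := by rw [hl] at hx; exact hx.2
  -- With no tight inequality at `x`, the functional `l` is maximal at an interior point, hence
  -- constant; then `F` is the whole polyhedron, which has the wrong dimension.
  by_cases hs : ∀ p ∈ K, ⟪x, p.1⟫_ℝ < p.2
  · exfalso
    have hFP : F = polyhedron K := by
      refine hFK.antisymm fun y hy => ?_
      rw [hl]
      refine ⟨hy, fun z hz => (hlx z hz).trans ?_⟩
      obtain ⟨t, ht, hlt⟩ := exists_pos_forall_inner_add_smul_lt hK x (x - y)
      have h1 := hlx _ (fun p hp => (hlt t (abs_of_pos ht).le p hp (hs p hp)).le :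
        x + t • (x - y) ∈ polyhedron K)
      rw [map_add, map_smul, map_sub, smul_eq_mul] at h1
      have h2 : t * (l x - l y) ≤ 0 := by linarith
      have h3 : l x - l y ≤ 0 := by
        by_contra h
        push Not at h
        have := mul_pos ht h
        linarith
      linarith
    rw [hFP] at hdim
    omega
  · push Not at hs
    obtain ⟨p, hp, hpx⟩ := hs
    have htight : ∀ y ∈ F, ⟪y, p.1⟫_ℝ = p.2 := by
      intro y hy
      by_contra h
      exact absurd (hxp p hp ⟨y, hy, lt_of_le_of_ne (hFK hy p hp) h⟩) (not_lt.2 hpx)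
    have hp0 : p.1 ≠ 0 := by
      intro h
      have h1 := ho p hp
      have h2 := htight x hx
      rw [h, inner_zero_right] at h1 h2
      exact h1.ne h2
    refine ⟨p, hp, Set.Subset.antisymm (fun y hy => ⟨hFK hy, htight y hy⟩) fun y hy => ?_⟩
    -- The dimension forces the directions of `F` to fill the hyperplane orthogonal to `p.1`, so `l`
    -- is constant on the entire face of `p`.
    have hspan : vectorSpan ℝ F = (ℝ ∙ p.1)ᗮ := by
      refine Submodule.eq_of_le_of_finrank_eq (vectorSpan_le_orthogonal htight) ?_
      have h1 := finrank_orthogonal_span_singleton_add_one hp0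
      rw [dimension_polyhedron hK ho, dimension] at hdim
      omega
    have h0 : vectorSpan ℝ F ≤ LinearMap.ker (l : V →ₗ[ℝ] ℝ) := by
      rw [vectorSpan_def, Submodule.span_le]
      rintro _ ⟨a, ha, b, hb, rfl⟩
      rw [hl] at ha hb
      simp only [vsub_eq_sub, SetLike.mem_coe, LinearMap.mem_ker, map_sub]
      exact sub_eq_zero.2 (le_antisymm (hb.2 a ha.1) (ha.2 b hb.1))
    have h1 : y - x ∈ (ℝ ∙ p.1)ᗮ := by
      rw [Submodule.mem_orthogonal_singleton_iff_inner_left, inner_sub_left, hy.2, htight x hx,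
        sub_self]
    rw [← hspan] at h1
    have h2 : l y = l x := by
      have := h0 h1
      rw [LinearMap.mem_ker, map_sub] at this
      exact sub_eq_zero.1 this
    rw [hl]
    exact ⟨hy.1, fun z hz => h2 ▸ hlx z hz⟩

/-- A small step along `u` reaches a point where `p` is the only equality; hence the active
inequalities cut out distinct facets. Independence of the normals is not required, so non-simple
vertices are covered. -/
theorem encard_facets [FiniteDimensional ℝ V] (hK : K.Finite) {o : V}
    (ho : ∀ p ∈ K, ⟪o, p.1⟫_ℝ < p.2)
    (hv : v ∈ polyhedron K) (hdir : ∀ p ∈ active K v, ∃ u : V, ⟪u, p.1⟫_ℝ = 0 ∧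
      ∀ q ∈ active K v, q ≠ p → ⟪u, q.1⟫_ℝ < 0) :
    {F | IsFacet (polyhedron K) F ∧ v ∈ F}.encard = (active K v).encard := by
  have hpt : ∀ p ∈ active K v, ∃ w : V, ⟪w, p.1⟫_ℝ = p.2 ∧
      ∀ q ∈ K, q ≠ p → ⟪w, q.1⟫_ℝ < q.2 := by
    intro p hp
    obtain ⟨u, hu0, hu⟩ := hdir p hp
    obtain ⟨t, ht, hlt⟩ := exists_pos_forall_inner_add_smul_lt hK v u
    refine ⟨v + t • u, ?_, fun q hq hqp => ?_⟩
    · rw [inner_add_left, inner_smul_left, hu0, mul_zero, add_zero, hp.2]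
    · rcases (hv q hq).lt_or_eq with h | h
      · exact hlt t (abs_of_pos ht).le q hq h
      · rw [inner_add_left, inner_smul_left, h]
        have := mul_neg_of_pos_of_neg ht (hu q ⟨hq, h⟩ hqp)
        simp only [conj_trivial]
        linarith
  have himg : {F | IsFacet (polyhedron K) F ∧ v ∈ F} = face K '' active K v := by
    ext F
    constructor
    · rintro ⟨hF, hvF⟩
      obtain ⟨p, hp, rfl⟩ := exists_face_eq_of_isFacet hK ho hF
      exact ⟨p, ⟨hp, hvF.2⟩, rfl⟩
    · rintro ⟨p, hp, rfl⟩
      obtain ⟨w, hw, hlt⟩ := hpt p hp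
      exact ⟨isFacet_face hK ho hp.1 hw hlt, hv, hp.2⟩
  rw [himg]
  refine Set.InjOn.encard_image fun p hp q hq hpq => ?_
  by_contra hne
  obtain ⟨w, hw, hlt⟩ := hpt p hp
  have hwP : w ∈ polyhedron K := fun r hr => by
    by_cases h : r = p
    · rw [h, hw]
    · exact (hlt r hr h).le
  have hwq : w ∈ face K q := hpq ▸ (⟨hwP, hw⟩ : w ∈ face K p)
  exact (hlt q hq.1 (Ne.symm hne)).ne hwq.2

/-- Linear systems with as many equations as unknowns. -/
theorem exists_forall_inner_eq [FiniteDimensional ℝ V] {ι : Type*} [Fintype ι] (b : ι → V)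
    (hcard : Fintype.card ι = Module.finrank ℝ V)
    (hinj : ∀ u : V, (∀ i, ⟪u, b i⟫_ℝ = 0) → u = 0) (z : ι → ℝ) :
    ∃ x : V, ∀ i, ⟪x, b i⟫_ℝ = z i := by
  let f : V →ₗ[ℝ] ι → ℝ := LinearMap.pi fun i => (innerSL ℝ (b i) : V →ₗ[ℝ] ℝ)
  have hf : ∀ x i, f x i = ⟪x, b i⟫_ℝ := fun x i => real_inner_comm _ _
  have hi : Function.Injective f := by
    rw [injective_iff_map_eq_zero]
    intro u hu
    exact hinj u fun i => by rw [← hf, hu]; rfl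
  have hs : Function.Surjective f :=
    (LinearMap.injective_iff_surjective_of_finrank_eq_finrank (by simp [hcard])).1 hi
  obtain ⟨x, hx⟩ := hs z
  exact ⟨x, fun i => by rw [← hf, hx]⟩

end Polyhedron

/-! ### Reflections, positive roots and dominant vectors -/

section Roots

variable {V : Type*} [NormedAddCommGroup V] [InnerProductSpace ℝ V] [FiniteDimensional ℝ V]
variable {n : ℕ} {Φ : Finset V} {Δ : Module.Basis (Fin n) ℝ V}

theorem isometry_mul_apply (σ τ : V ≃ₗᵢ[ℝ] V) (x : V) : (σ * τ) x = σ (τ x) := rfl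

theorem refl_apply (α x : V) : refl α x = x - (2 * ⟪x, α⟫_ℝ / ‖α‖ ^ 2) • α := by
  rw [refl, Submodule.reflection_orthogonal_apply, Submodule.reflection_singleton_apply,
    real_inner_comm]
  simp only [RCLike.ofReal_real_eq_id, id]
  rw [neg_sub, ← Nat.cast_smul_eq_nsmul ℝ, smul_smul, mul_div_assoc]
  norm_num

theorem refl_refl_apply (α x : V) : refl α (refl α x) = x := Submodule.reflection_reflection _ x

theorem refl_mul_self (α : V) : refl α * refl α = 1 := Submodule.reflection_mul_reflection _

theorem refl_inv (α : V) : (refl α)⁻¹ = refl α := inv_eq_of_mul_eq_one_left (refl_mul_self α)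

theorem refl_self (α : V) : refl α α = -α :=
  Submodule.reflection_orthogonalComplement_singleton_eq_neg α

theorem inner_refl (α x y : V) : ⟪refl α x, y⟫_ℝ = ⟪x, refl α y⟫_ℝ := by
  rw [← (refl α).inner_map_map x, refl_refl_apply]

theorem refl_neg (α : V) : refl (-α) = refl α := by
  ext x
  rw [refl_apply, refl_apply, norm_neg, inner_neg_right, smul_neg, ← neg_smul]
  congr 2
  ring

theorem refl_map (σ : V ≃ₗᵢ[ℝ] V) (α : V) : refl (σ α) = σ * refl α * σ⁻¹ := by
  ext x
  have h : ⟪x, σ α⟫_ℝ = ⟪σ⁻¹ x, α⟫_ℝ := by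
    rw [← σ.inner_map_map (σ⁻¹ x)]
    congr 1
    exact (σ.apply_symm_apply x).symm
  have h2 : σ (σ⁻¹ x) = x := σ.apply_symm_apply x
  rw [isometry_mul_apply, isometry_mul_apply, refl_apply, refl_apply, σ.norm_map, h,
    map_sub, map_smul, h2]

theorem inner_map_inv (σ : V ≃ₗᵢ[ℝ] V) (x y : V) : ⟪σ x, y⟫_ℝ = ⟪x, σ⁻¹ y⟫_ℝ := by
  rw [← σ.inner_map_map x]
  congr 1
  exact (σ.apply_symm_apply y).symm

theorem apply_inv_apply (σ : V ≃ₗᵢ[ℝ] V) (x : V) : σ (σ⁻¹ x) = x := σ.apply_symm_apply x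

theorem inv_apply_apply (σ : V ≃ₗᵢ[ℝ] V) (x : V) : σ⁻¹ (σ x) = x := σ.symm_apply_apply x

theorem mem_posRoots {α : V} : α ∈ posRoots Φ Δ ↔ α ∈ Φ ∧ ∀ i, 0 ≤ Δ.repr α i := by
  simp [posRoots]

theorem IsRootSystem.neg_mem (hΦ : IsRootSystem Φ) {α : V} (hα : α ∈ Φ) : -α ∈ Φ :=
  refl_self α ▸ hΦ.refl_mem α hα α hα

theorem mem_posRoots_or_neg (hΦ : IsRootSystem Φ) (hΔ : IsSimpleSystem Φ Δ) {α : V} (hα : α ∈ Φ) :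
    α ∈ posRoots Φ Δ ∨ -α ∈ posRoots Φ Δ := by
  rcases hΔ.nonneg_or_nonpos α hα with h | h
  · exact Or.inl (mem_posRoots.2 ⟨hα, h⟩)
  · exact Or.inr (mem_posRoots.2 ⟨hΦ.neg_mem hα, fun i => by simpa using h i⟩)

theorem mem_posRoots_of_repr_pos (hΔ : IsSimpleSystem Φ Δ) {α : V} (hα : α ∈ Φ) {i : Fin n}
    (hi : 0 < Δ.repr α i) : α ∈ posRoots Φ Δ := by
  rcases hΔ.nonneg_or_nonpos α hα with h | h
  · exact mem_posRoots.2 ⟨hα, h⟩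
  · exact absurd hi (not_lt.2 (h i))

theorem simple_mem_posRoots (hΔ : IsSimpleSystem Φ Δ) (i : Fin n) : Δ i ∈ posRoots Φ Δ :=
  mem_posRoots_of_repr_pos hΔ (hΔ.mem i) (i := i) (by simp)

theorem repr_refl_simple_of_ne (x : V) {i j : Fin n} (hij : j ≠ i) :
    Δ.repr (refl (Δ i) x) j = Δ.repr x j := by
  rw [refl_apply]
  simp [Finsupp.single_eq_of_ne hij]

/-- By reducedness a positive root other than `Δ i` has a positive coefficient at some j ≠ i. The
reflection leaves it unchanged, and one positive coefficient makes a root positive. -/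
theorem refl_simple_mem_posRoots (hΦ : IsRootSystem Φ) (hΔ : IsSimpleSystem Φ Δ) (i : Fin n)
    {β : V} (hβ : β ∈ posRoots Φ Δ) (hne : β ≠ Δ i) : refl (Δ i) β ∈ posRoots Φ Δ := by
  obtain ⟨hβΦ, hβ0⟩ := mem_posRoots.1 hβ
  have hmem := hΦ.refl_mem _ (hΔ.mem i) _ hβΦ
  by_cases h : ∃ j, j ≠ i ∧ 0 < Δ.repr β j
  · obtain ⟨j, hj, hpos⟩ := h
    exact mem_posRoots_of_repr_pos hΔ hmem (i := j) (by rwa [repr_refl_simple_of_ne _ hj])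
  · exfalso
    push Not at h
    have heq : β = (Δ.repr β i) • Δ i := by
      refine Δ.repr.injective (Finsupp.ext fun j => ?_)
      by_cases hj : j = i
      · subst hj; simp
      · have : Δ.repr β j = 0 := le_antisymm (h j hj) (hβ0 j)
        simp [this, Finsupp.single_eq_of_ne hj]
    have h2 := (hΦ.reduced _ (hΔ.mem i) (Δ.repr β i)).1 (heq ▸ hβΦ)
    rcases h2 with h2 | h2
    · rw [h2, one_smul] at heq
      exact hne heq
    · have := hβ0 i
      rw [h2] at this
      linarith

theorem norm_sq_simple_pos (i : Fin n) : 0 < ‖Δ i‖ ^ 2 := by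
  have := norm_pos_iff.2 (Δ.ne_zero i)
  positivity

/-- The root s_j(Δ i) has coefficient 1 at i, so it is positive; its coefficient at j is a negative
multiple of the inner product. -/
theorem inner_simple_nonpos (hΦ : IsRootSystem Φ) (hΔ : IsSimpleSystem Φ Δ) {i j : Fin n}
    (hij : i ≠ j) : ⟪Δ i, Δ j⟫_ℝ ≤ 0 := by
  have hmem := hΦ.refl_mem _ (hΔ.mem j) _ (hΔ.mem i)
  have hpos := mem_posRoots_of_repr_pos hΔ hmem (i := i) (by
    rw [repr_refl_simple_of_ne _ hij]; simp)
  have h := (mem_posRoots.1 hpos).2 j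
  rw [refl_apply] at h
  simp only [map_sub, map_smul, Module.Basis.repr_self, Finsupp.coe_sub, Pi.sub_apply,
    Finsupp.coe_smul, Pi.smul_apply, smul_eq_mul, Finsupp.single_eq_same, mul_one,
    Finsupp.single_eq_of_ne hij.symm] at h
  have h2 : 2 * ⟪Δ i, Δ j⟫_ℝ / ‖Δ j‖ ^ 2 ≤ 0 := by linarith
  by_contra hc
  push Not at hc
  have := div_pos (mul_pos two_pos hc) (norm_sq_simple_pos (Δ := Δ) j)
  linarith

theorem refl_mem_weylGroup {α : V} (hα : α ∈ Φ) : refl α ∈ weylGroup Φ :=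
  Subgroup.subset_closure ⟨α, hα, rfl⟩

theorem weylGroup_apply_mem (hΦ : IsRootSystem Φ) {σ : V ≃ₗᵢ[ℝ] V} (hσ : σ ∈ weylGroup Φ) :
    ∀ α ∈ Φ, σ α ∈ Φ := by
  have key : ∀ τ : V ≃ₗᵢ[ℝ] V, (∀ α ∈ Φ, τ α ∈ Φ) → ∀ α ∈ Φ, τ⁻¹ α ∈ Φ := by
    intro τ hτ α hα
    have hinj : Set.InjOn τ (Φ : Set V) := τ.injective.injOn
    have hsurj := Finset.surjOn_of_injOn_of_card_le τ hτ hinj le_rfl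
    obtain ⟨β, hβ, rfl⟩ := hsurj hα
    rw [inv_apply_apply]
    exact hβ
  induction hσ using Subgroup.closure_induction with
  | mem x hx =>
    obtain ⟨α, hα, rfl⟩ := hx
    exact hΦ.refl_mem α hα
  | one => exact fun α hα => hα
  | mul x y _ _ hx hy => exact fun α hα => hx _ (hy α hα)
  | inv x _ hx => exact key x hx

theorem finite_weylGroup (hΦ : IsRootSystem Φ) (hΔ : IsSimpleSystem Φ Δ) :
    (weylGroup Φ : Set (V ≃ₗᵢ[ℝ] V)).Finite := by
  have hfin : (Set.univ.pi fun _ : Fin n => (Φ : Set V)).Finite :=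
    Set.Finite.pi fun _ => Φ.finite_toSet
  refine Set.Finite.of_finite_image (f := fun σ => fun i => σ (Δ i)) (hfin.subset ?_) ?_
  · rintro _ ⟨σ, hσ, rfl⟩ i -
    exact weylGroup_apply_mem hΦ hσ _ (hΔ.mem i)
  · intro σ _ τ _ h
    have := Δ.ext (f₁ := (σ.toLinearEquiv : V →ₗ[ℝ] V)) (f₂ := (τ.toLinearEquiv : V →ₗ[ℝ] V))
      fun i => congrFun h i
    ext x
    exact LinearMap.congr_fun this x

/-! #### Words in the simple reflections -/

/-- The product of the simple reflections of a word. -/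
def wordProd (Δ : Module.Basis (Fin n) ℝ V) (l : List (Fin n)) : V ≃ₗᵢ[ℝ] V :=
  (l.map fun i => refl (Δ i)).prod

theorem wordProd_cons (i : Fin n) (l : List (Fin n)) :
    wordProd Δ (i :: l) = refl (Δ i) * wordProd Δ l := by simp [wordProd]

theorem wordProd_append (l m : List (Fin n)) :
    wordProd Δ (l ++ m) = wordProd Δ l * wordProd Δ m := by simp [wordProd]

theorem wordProd_singleton (i : Fin n) : wordProd Δ [i] = refl (Δ i) := by simp [wordProd]

theorem wordProd_reverse (l : List (Fin n)) : wordProd Δ l.reverse = (wordProd Δ l)⁻¹ := by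
  induction l with
  | nil => simp [wordProd]
  | cons i l ih =>
    rw [List.reverse_cons, wordProd_append, wordProd_singleton, ih, wordProd_cons, mul_inv_rev,
      refl_inv]

/-- The exchange condition. -/
theorem exists_wordProd_eq_mul_refl (hΦ : IsRootSystem Φ) (hΔ : IsSimpleSystem Φ Δ) (k : Fin n)
    (l : List (Fin n)) (h : wordProd Δ l (Δ k) ∉ posRoots Φ Δ) :
    ∃ m : List (Fin n), m.length < l.length ∧ wordProd Δ l * refl (Δ k) = wordProd Δ m := by
  induction l with
  | nil => exact absurd (simple_mem_posRoots hΔ k) (by simpa [wordProd] using h)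
  | cons j l ih =>
    rw [wordProd_cons, isometry_mul_apply] at h
    by_cases hl : wordProd Δ l (Δ k) ∈ posRoots Φ Δ
    · have heq : wordProd Δ l (Δ k) = Δ j := by
        by_contra hne
        exact h (refl_simple_mem_posRoots hΦ hΔ j hl hne)
      refine ⟨l, by simp, ?_⟩
      rw [wordProd_cons, ← heq, refl_map, inv_mul_cancel_right, mul_assoc, refl_mul_self, mul_one]
    · obtain ⟨m, hm, hmeq⟩ := ih hl
      refine ⟨j :: m, by simpa using hm, ?_⟩
      rw [wordProd_cons, wordProd_cons, mul_assoc, hmeq]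

/-! #### Half sums of positive roots of parabolic subsystems -/

open Classical in
/-- Half the sum of the positive roots in the span of the simple roots with indices in `I`. -/
def halfSum (Φ : Finset V) (Δ : Module.Basis (Fin n) ℝ V) (I : Finset (Fin n)) : V :=
  (1 / 2 : ℝ) • ∑ β ∈ posRoots Φ Δ with ∀ j, j ∉ I → Δ.repr β j = 0, β

/-- The coefficients of the half sum `halfSum Φ Δ I`. -/
def coef (Φ : Finset V) (Δ : Module.Basis (Fin n) ℝ V) (I : Finset (Fin n)) (i : Fin n) : ℝ :=
  Δ.repr (halfSum Φ Δ I) i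

open Classical in
theorem coef_eq (I : Finset (Fin n)) (i : Fin n) : coef Φ Δ I i =
    1 / 2 * ∑ β ∈ posRoots Φ Δ with ∀ j, j ∉ I → Δ.repr β j = 0, Δ.repr β i := by
  simp [coef, halfSum]

theorem halfSum_univ : halfSum Φ Δ Finset.univ = delta Φ Δ := by
  simp [halfSum, delta]

theorem coef_eq_zero {I : Finset (Fin n)} {i : Fin n} (hi : i ∉ I) : coef Φ Δ I i = 0 := by
  classical
  rw [coef_eq, Finset.sum_eq_zero, mul_zero]
  intro β hβ
  exact (Finset.mem_filter.1 hβ).2 i hi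

theorem coef_nonneg (I : Finset (Fin n)) (i : Fin n) : 0 ≤ coef Φ Δ I i := by
  classical
  rw [coef_eq]
  refine mul_nonneg (by norm_num) (Finset.sum_nonneg fun β hβ => ?_)
  exact (mem_posRoots.1 (Finset.mem_filter.1 hβ).1).2 i

theorem coef_mono {I J : Finset (Fin n)} (h : I ⊆ J) (i : Fin n) :
    coef Φ Δ I i ≤ coef Φ Δ J i := by
  classical
  rw [coef_eq, coef_eq]
  refine mul_le_mul_of_nonneg_left (Finset.sum_le_sum_of_subset_of_nonneg ?_ ?_) (by norm_num)
  · intro β hβ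
    rw [Finset.mem_filter] at hβ ⊢
    exact ⟨hβ.1, fun j hj => hβ.2 j fun hjI => hj (h hjI)⟩
  · intro β hβ _
    exact (mem_posRoots.1 (Finset.mem_filter.1 hβ).1).2 i

theorem half_le_coef (hΔ : IsSimpleSystem Φ Δ) {I : Finset (Fin n)} {i : Fin n} (hi : i ∈ I) :
    1 / 2 ≤ coef Φ Δ I i := by
  classical
  rw [coef_eq]
  have h1 : Δ i ∈ {β ∈ posRoots Φ Δ | ∀ j, j ∉ I → Δ.repr β j = 0} := by
    rw [Finset.mem_filter]
    refine ⟨simple_mem_posRoots hΔ i, fun j hj => ?_⟩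
    have : j ≠ i := fun h => hj (h ▸ hi)
    simp [Finsupp.single_eq_of_ne this]
  have h2 := Finset.single_le_sum (f := fun β => Δ.repr β i)
    (fun β hβ => (mem_posRoots.1 (Finset.mem_filter.1 hβ).1).2 i) h1
  simp only [Module.Basis.repr_self, Finsupp.single_eq_same] at h2
  linarith

theorem coef_pos (hΔ : IsSimpleSystem Φ Δ) {I : Finset (Fin n)} {i : Fin n} (hi : i ∈ I) :
    0 < coef Φ Δ I i := lt_of_lt_of_le (by norm_num) (half_le_coef hΔ hi)

theorem halfSum_eq_sum (I : Finset (Fin n)) :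
    halfSum Φ Δ I = ∑ i ∈ I, coef Φ Δ I i • Δ i := by
  conv_lhs => rw [← Δ.sum_repr (halfSum Φ Δ I)]
  refine (Finset.sum_subset (Finset.subset_univ I) fun i _ hi => ?_).symm
  rw [show Δ.repr (halfSum Φ Δ I) i = 0 from coef_eq_zero hi, zero_smul]

theorem inner_halfSum (x : V) (I : Finset (Fin n)) :
    ⟪x, halfSum Φ Δ I⟫_ℝ = ∑ i ∈ I, coef Φ Δ I i * ⟪x, Δ i⟫_ℝ := by
  rw [halfSum_eq_sum, inner_sum]
  exact Finset.sum_congr rfl fun i _ => by rw [inner_smul_right]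

theorem inner_delta (x : V) :
    ⟪x, delta Φ Δ⟫_ℝ = ∑ i, coef Φ Δ Finset.univ i * ⟪x, Δ i⟫_ℝ := by
  rw [← halfSum_univ, inner_halfSum]

/-- The difference is half the sum of the positive roots outside the span of `I`; the reflection in
`Δ i` permutes these and so fixes their sum. -/
theorem inner_delta_sub_halfSum (hΦ : IsRootSystem Φ) (hΔ : IsSimpleSystem Φ Δ)
    {I : Finset (Fin n)} {i : Fin n} (hi : i ∈ I) :
    ⟪delta Φ Δ - halfSum Φ Δ I, Δ i⟫_ℝ = 0 := by
  classical
  set s : Finset V := {β ∈ posRoots Φ Δ | ¬ ∀ j, j ∉ I → Δ.repr β j = 0} with hs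
  have hsub : delta Φ Δ - halfSum Φ Δ I = (1 / 2 : ℝ) • ∑ β ∈ s, β := by
    rw [delta, halfSum, ← smul_sub, ← Finset.sum_filter_add_sum_filter_not (posRoots Φ Δ)
      (fun β => ∀ j, j ∉ I → Δ.repr β j = 0), add_sub_cancel_left]
  have hmaps : ∀ β ∈ s, refl (Δ i) β ∈ s := by
    intro β hβ
    rw [hs, Finset.mem_filter] at hβ ⊢
    have hne : ∀ j, j ∉ I → j ≠ i := fun j hj h => hj (h ▸ hi)
    refine ⟨refl_simple_mem_posRoots hΦ hΔ i hβ.1 ?_, fun h => hβ.2 fun j hj => ?_⟩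
    · rintro rfl
      exact hβ.2 fun j hj => by simp [Finsupp.single_eq_of_ne (hne j hj)]
    · rw [← h j hj, repr_refl_simple_of_ne _ (hne j hj)]
  have hfix : refl (Δ i) (delta Φ Δ - halfSum Φ Δ I) = delta Φ Δ - halfSum Φ Δ I := by
    rw [hsub, map_smul, map_sum]
    congr 1
    exact Finset.sum_nbij' (refl (Δ i)) (refl (Δ i)) hmaps hmaps
      (fun _ _ => refl_refl_apply _ _) (fun _ _ => refl_refl_apply _ _) fun _ _ => rfl
  have h := inner_refl (Δ i) (delta Φ Δ - halfSum Φ Δ I) (Δ i)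
  rw [hfix, refl_self, inner_neg_right] at h
  linarith

theorem inner_delta_simple_pos (hΦ : IsRootSystem Φ) (hΔ : IsSimpleSystem Φ Δ) (i : Fin n) :
    0 < ⟪delta Φ Δ, Δ i⟫_ℝ := by
  have h := inner_delta_sub_halfSum hΦ hΔ (Finset.mem_singleton_self i)
  rw [inner_sub_left, halfSum_eq_sum, Finset.sum_singleton, inner_smul_left,
    real_inner_self_eq_norm_sq] at h
  have h1 := mul_pos (coef_pos (Φ := Φ) hΔ (Finset.mem_singleton_self i))
    (norm_sq_simple_pos (Δ := Δ) i)
  simp only [conj_trivial] at h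
  linarith

/-! #### The Weyl group is generated by the simple reflections -/

/-- Take a positive root γ in the orbit with (δ, γ) minimal. Some (γ, Δ i) is positive, and
reflecting in `Δ i` would lower (δ, γ) while keeping γ positive, unless γ is `Δ i`. -/
theorem exists_wordProd_simple (hΦ : IsRootSystem Φ) (hΔ : IsSimpleSystem Φ Δ) {β : V}
    (hβ : β ∈ posRoots Φ Δ) : ∃ (l : List (Fin n)) (i : Fin n), β = wordProd Δ l (Δ i) := by
  classical
  obtain ⟨γ, hγ, hmin⟩ := Finset.exists_min_image
    {γ ∈ posRoots Φ Δ | ∃ l : List (Fin n), γ = wordProd Δ l β} (fun γ => ⟪delta Φ Δ, γ⟫_ℝ)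
    ⟨β, Finset.mem_filter.2 ⟨hβ, [], by simp [wordProd]⟩⟩
  obtain ⟨hγp, l, hl⟩ := Finset.mem_filter.1 hγ
  obtain ⟨hγΦ, hγ0⟩ := mem_posRoots.1 hγp
  have hex : ∃ i, 0 < ⟪γ, Δ i⟫_ℝ := by
    by_contra hc
    push Not at hc
    have h1 : 0 < ⟪γ, γ⟫_ℝ := real_inner_self_pos.2 (hΦ.ne_zero _ hγΦ)
    have h2 : ⟪γ, γ⟫_ℝ ≤ 0 := by
      conv_lhs => rw [← Δ.sum_repr γ, inner_sum]
      refine Finset.sum_nonpos fun i _ => ?_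
      rw [inner_smul_right, Δ.sum_repr γ]
      exact mul_nonpos_of_nonneg_of_nonpos (hγ0 i) (hc i)
    linarith
  obtain ⟨i, hi⟩ := hex
  have heq : γ = Δ i := by
    by_contra hne
    have hmem := refl_simple_mem_posRoots hΦ hΔ i hγp hne
    have h1 := hmin (refl (Δ i) γ) (Finset.mem_filter.2 ⟨hmem, i :: l, by
      rw [wordProd_cons, isometry_mul_apply, hl]⟩)
    rw [refl_apply, inner_sub_right, inner_smul_right] at h1
    have h2 := mul_pos (div_pos (mul_pos two_pos hi) (norm_sq_simple_pos (Δ := Δ) i))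
      (inner_delta_simple_pos hΦ hΔ i)
    linarith
  refine ⟨l.reverse, i, ?_⟩
  rw [wordProd_reverse, ← heq, hl, inv_apply_apply]

theorem exists_wordProd_eq (hΦ : IsRootSystem Φ) (hΔ : IsSimpleSystem Φ Δ) {σ : V ≃ₗᵢ[ℝ] V}
    (hσ : σ ∈ weylGroup Φ) : ∃ l : List (Fin n), σ = wordProd Δ l := by
  have hpos : ∀ β ∈ posRoots Φ Δ, ∃ l : List (Fin n), refl β = wordProd Δ l := by
    intro β hβ
    obtain ⟨l, i, rfl⟩ := exists_wordProd_simple hΦ hΔ hβ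
    refine ⟨l ++ [i] ++ l.reverse, ?_⟩
    rw [refl_map, wordProd_append, wordProd_append, wordProd_singleton, wordProd_reverse]
  induction hσ using Subgroup.closure_induction with
  | mem x hx =>
    obtain ⟨α, hα, rfl⟩ := hx
    rcases mem_posRoots_or_neg hΦ hΔ hα with h | h
    · exact hpos α h
    · rw [← refl_neg]
      exact hpos _ h
  | one => exact ⟨[], by simp [wordProd]⟩
  | mul x y _ _ hx hy =>
    obtain ⟨l, rfl⟩ := hx
    obtain ⟨m, rfl⟩ := hy
    exact ⟨l ++ m, (wordProd_append l m).symm⟩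
  | inv x _ hx =>
    obtain ⟨l, rfl⟩ := hx
    exact ⟨l.reverse, (wordProd_reverse l).symm⟩

/-! #### Dominant vectors -/

/-- A dominant vector is minus its translates by `W` a nonnegative combination of simple roots. -/
theorem repr_sub_apply_nonneg (hΦ : IsRootSystem Φ) (hΔ : IsSimpleSystem Φ Δ) {x : V}
    (hx : ∀ i, 0 ≤ ⟪x, Δ i⟫_ℝ) {σ : V ≃ₗᵢ[ℝ] V} (hσ : σ ∈ weylGroup Φ) (j : Fin n) :
    0 ≤ Δ.repr (x - σ x) j := by
  obtain ⟨l, rfl⟩ := exists_wordProd_eq hΦ hΔ hσ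
  clear hσ
  induction hN : l.length using Nat.strong_induction_on generalizing l with
  | _ N ih =>
    rcases List.eq_nil_or_concat l with rfl | ⟨m, k, rfl⟩
    · simp [wordProd]
    · rw [List.concat_eq_append, List.length_append, List.length_singleton] at hN
      rw [List.concat_eq_append, wordProd_append, wordProd_singleton]
      -- If the last letter sends `Δ k` to a positive root, it contributes a nonnegative multiple of
      -- that root; otherwise the exchange condition shortens the word.
      by_cases hk : wordProd Δ m (Δ k) ∈ posRoots Φ Δ
      · have h1 := ih m.length (by omega) m rfl
        have h2 := (mem_posRoots.1 hk).2 j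
        have h3 : 0 ≤ 2 * ⟪x, Δ k⟫_ℝ / ‖Δ k‖ ^ 2 :=
          div_nonneg (mul_nonneg two_pos.le (hx k)) (sq_nonneg _)
        have h4 : x - (wordProd Δ m * refl (Δ k)) x = (x - wordProd Δ m x) +
            (2 * ⟪x, Δ k⟫_ℝ / ‖Δ k‖ ^ 2) • wordProd Δ m (Δ k) := by
          rw [isometry_mul_apply, refl_apply, map_sub, map_smul]
          abel
        rw [h4, map_add, map_smul]
        exact add_nonneg h1 (mul_nonneg h3 h2)
      · obtain ⟨m', hm', heq⟩ := exists_wordProd_eq_mul_refl hΦ hΔ k m hk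
        rw [heq]
        exact ih m'.length (by omega) m' rfl

theorem inner_apply_le (hΦ : IsRootSystem Φ) (hΔ : IsSimpleSystem Φ Δ) {x y : V}
    (hx : ∀ i, 0 ≤ ⟪x, Δ i⟫_ℝ) (hy : ∀ i, 0 ≤ ⟪y, Δ i⟫_ℝ) {σ : V ≃ₗᵢ[ℝ] V}
    (hσ : σ ∈ weylGroup Φ) : ⟪y, σ x⟫_ℝ ≤ ⟪y, x⟫_ℝ := by
  rw [← sub_nonneg, ← inner_sub_right, ← Δ.sum_repr (x - σ x), inner_sum]
  refine Finset.sum_nonneg fun i _ => ?_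
  rw [inner_smul_right]
  exact mul_nonneg (repr_sub_apply_nonneg hΦ hΔ hx hσ i) (hy i)

theorem repr_sub_apply_eq_zero (hΦ : IsRootSystem Φ) (hΔ : IsSimpleSystem Φ Δ) {x y : V}
    (hx : ∀ i, 0 ≤ ⟪x, Δ i⟫_ℝ) (hy : ∀ i, 0 ≤ ⟪y, Δ i⟫_ℝ) {σ : V ≃ₗᵢ[ℝ] V}
    (hσ : σ ∈ weylGroup Φ) (h : ⟪y, σ x⟫_ℝ = ⟪y, x⟫_ℝ) {i : Fin n} (hi : 0 < ⟪y, Δ i⟫_ℝ) :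
    Δ.repr (x - σ x) i = 0 := by
  have h0 : ⟪y, x - σ x⟫_ℝ = 0 := by rw [inner_sub_right, h, sub_self]
  rw [← Δ.sum_repr (x - σ x), inner_sum] at h0
  have h1 := (Finset.sum_eq_zero_iff_of_nonneg fun i _ => by
    rw [inner_smul_right]
    exact mul_nonneg (repr_sub_apply_nonneg hΦ hΔ hx hσ i) (hy i)).1 h0 i (Finset.mem_univ i)
  rw [inner_smul_right] at h1
  exact (mul_eq_zero.1 h1).resolve_right hi.ne'

/-- Choose σ in the finite group with (σ x, δ) maximal: a negative (σ x, Δ i) could be reflected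
away with an increase. -/
theorem exists_dominant_apply (hΦ : IsRootSystem Φ) (hΔ : IsSimpleSystem Φ Δ) (x : V) :
    ∃ σ ∈ weylGroup Φ, ∀ i, 0 ≤ ⟪σ x, Δ i⟫_ℝ := by
  obtain ⟨σ, hσ, hmax⟩ := (finite_weylGroup hΦ hΔ).exists_maximalFor
    (fun σ => ⟪σ x, delta Φ Δ⟫_ℝ) _ ⟨1, one_mem _⟩
  refine ⟨σ, hσ, fun i => ?_⟩
  by_contra hc
  push Not at hc
  have h1 : ⟪(refl (Δ i) * σ) x, delta Φ Δ⟫_ℝ =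
      ⟪σ x, delta Φ Δ⟫_ℝ - 2 * ⟪σ x, Δ i⟫_ℝ / ‖Δ i‖ ^ 2 * ⟪delta Φ Δ, Δ i⟫_ℝ := by
    rw [isometry_mul_apply, refl_apply, inner_sub_left, inner_smul_left,
      real_inner_comm (delta Φ Δ) (Δ i)]
    rfl
  have h2 : 2 * ⟪σ x, Δ i⟫_ℝ / ‖Δ i‖ ^ 2 * ⟪delta Φ Δ, Δ i⟫_ℝ < 0 :=
    mul_neg_of_neg_of_pos (div_neg_of_neg_of_pos (by linarith) (norm_sq_simple_pos i))
      (inner_delta_simple_pos hΦ hΔ i)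
  have h3 := hmax (mul_mem (refl_mem_weylGroup (hΔ.mem i)) hσ) (by simp only [h1]; linarith)
  simp only [h1] at h3
  linarith

/-! #### Spans of simple roots -/

/-- The span of the simple roots with indices in `I`. -/
def simpleSpan (Δ : Module.Basis (Fin n) ℝ V) (I : Finset (Fin n)) : Submodule ℝ V :=
  Submodule.span ℝ (Δ '' I)

theorem mem_simpleSpan {I : Finset (Fin n)} {x : V} :
    x ∈ simpleSpan Δ I ↔ ∀ j, j ∉ I → Δ.repr x j = 0 := by
  rw [simpleSpan, Module.Basis.mem_span_image]
  constructor
  · intro h j hj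
    by_contra hc
    exact hj (h (by simpa using hc))
  · intro h j hj
    by_contra hc
    exact (by simpa using hj : Δ.repr x j ≠ 0) (h j hc)

theorem simple_mem_simpleSpan {I : Finset (Fin n)} {i : Fin n} :
    Δ i ∈ simpleSpan Δ I ↔ i ∈ I := by
  rw [mem_simpleSpan]
  constructor
  · intro h
    by_contra hc
    simpa using h i hc
  · intro h j hj
    simp [Finsupp.single_eq_of_ne (fun e => hj (e ▸ h) : j ≠ i)]

theorem simpleSpan_le_iff {I : Finset (Fin n)} {A : Submodule ℝ V} :
    simpleSpan Δ I ≤ A ↔ ∀ i ∈ I, Δ i ∈ A := by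
  rw [simpleSpan, Submodule.span_le, Set.image_subset_iff]
  rfl

theorem simpleSpan_le_simpleSpan {I J : Finset (Fin n)} :
    simpleSpan Δ I ≤ simpleSpan Δ J ↔ I ⊆ J := by
  rw [simpleSpan_le_iff]
  exact forall₂_congr fun i _ => simple_mem_simpleSpan

theorem simpleSpan_injective : Function.Injective (simpleSpan Δ) := fun _ _ h =>
  (simpleSpan_le_simpleSpan.1 h.le).antisymm (simpleSpan_le_simpleSpan.1 h.ge)

theorem simpleSpan_univ : simpleSpan Δ Finset.univ = ⊤ := by
  rw [simpleSpan, Finset.coe_univ, Set.image_univ, Δ.span_eq]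

theorem finrank_simpleSpan (I : Finset (Fin n)) : Module.finrank ℝ (simpleSpan Δ I) = I.card := by
  classical
  have h : LinearIndependent ℝ fun i : I => Δ i := Δ.linearIndependent.comp _ Subtype.val_injective
  have := finrank_span_eq_card h
  rw [Fintype.card_coe] at this
  rw [← this, simpleSpan, show Δ '' I = Set.range fun i : I => Δ i by ext; simp]

theorem exists_eq_simpleSpan {A : Submodule ℝ V} (h : ∃ s : Set V, s ⊆ Set.range Δ ∧
    A = Submodule.span ℝ s) : ∃ I, A = simpleSpan Δ I := by
  classical
  obtain ⟨s, hs, rfl⟩ := h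
  refine ⟨({i | Δ i ∈ s} : Finset (Fin n)), ?_⟩
  rw [simpleSpan]
  congr 1
  ext x
  constructor
  · intro hx
    obtain ⟨i, rfl⟩ := hs hx
    exact ⟨i, by simpa using hx, rfl⟩
  · rintro ⟨i, hi, rfl⟩
    simpa using hi

theorem piVec_simpleSpan (hΦ : IsRootSystem Φ) (hΔ : IsSimpleSystem Φ Δ) (I : Finset (Fin n)) :
    piVec Φ Δ (simpleSpan Δ I) = halfSum Φ Δ I := by
  refine Submodule.eq_starProjection_of_mem_of_inner_eq_zero
    (mem_simpleSpan.2 fun j hj => coef_eq_zero hj) fun w hw => ?_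
  have hle : simpleSpan Δ I ≤ (ℝ ∙ (delta Φ Δ - halfSum Φ Δ I))ᗮ :=
    simpleSpan_le_iff.2 fun i hi => by
      rw [Submodule.mem_orthogonal_singleton_iff_inner_right]
      exact inner_delta_sub_halfSum hΦ hΔ hi
  exact Submodule.mem_orthogonal_singleton_iff_inner_right.1 (hle hw)

theorem mem_fund_rootSubspaces (hΔ : IsSimpleSystem Φ Δ) {I : Finset (Fin n)} (hI : I.Nonempty) :
    simpleSpan Δ I ∈ fund Δ (rootSubspaces Φ) := by
  refine ⟨⟨Δ '' I, ?_, (Finset.coe_nonempty.2 hI).image Δ, rfl⟩, Δ '' I,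
    Set.image_subset_range _ _, rfl⟩
  rintro _ ⟨i, _, rfl⟩
  exact hΔ.mem i

/-- Each span of roots is conjugate to a span of simple roots. -/
theorem exists_map_eq_simpleSpan (hΦ : IsRootSystem Φ) (hΔ : IsSimpleSystem Φ Δ)
    {C : Submodule ℝ V} (hC : C ∈ rootSubspaces Φ) :
    ∃ σ ∈ weylGroup Φ, ∃ I, C.map (σ.toLinearEquiv : V →ₗ[ℝ] V) = simpleSpan Δ I := by
  classical
  obtain ⟨s, hs, _, rfl⟩ := hC
  set C := Submodule.span ℝ s with hCdef
  -- A generic vector of the orthogonal complement is orthogonal to no root outside `C`, because a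
  -- real vector space is not a finite union of proper subspaces.
  have hgen : ∃ x ∈ Cᗮ, ∀ β ∈ Φ, β ∉ C → ⟪x, β⟫_ℝ ≠ 0 := by
    set T : Finset (Submodule ℝ Cᗮ) :=
      ({β ∈ Φ | β ∉ C}).image fun β => ((ℝ ∙ β)ᗮ).comap Cᗮ.subtype with hT
    have htop : ⊤ ∉ T := by
      intro h
      obtain ⟨β, hβ, heq⟩ := Finset.mem_image.1 h
      refine (Finset.mem_filter.1 hβ).2 ?_
      rw [← Submodule.orthogonal_orthogonal C]
      intro u hu
      have : (⟨u, hu⟩ : Cᗮ) ∈ ((ℝ ∙ β)ᗮ).comap Cᗮ.subtype := heq ▸ Submodule.mem_top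
      exact Submodule.mem_orthogonal_singleton_iff_inner_left.1 this
    have hne := Subspace.biUnion_ne_univ_of_top_notMem htop
    obtain ⟨x, hx⟩ := (Set.ne_univ_iff_exists_notMem _).1 hne
    refine ⟨x, x.2, fun β hβ hβC h0 => hx ?_⟩
    refine Set.mem_biUnion (Finset.mem_image.2 ⟨β, Finset.mem_filter.2 ⟨hβ, hβC⟩, rfl⟩) ?_
    exact Submodule.mem_orthogonal_singleton_iff_inner_left.2 h0
  obtain ⟨x, hxC, hx⟩ := hgen
  obtain ⟨σ, hσ, hdom⟩ := exists_dominant_apply hΦ hΔ x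
  refine ⟨σ, hσ, ({i | ⟪σ x, Δ i⟫_ℝ = 0} : Finset (Fin n)), le_antisymm ?_ ?_⟩
  · rw [hCdef, Submodule.map_span, Submodule.span_le]
    rintro _ ⟨β, hβ, rfl⟩
    have h0 : ⟪σ x, σ β⟫_ℝ = 0 := by
      rw [σ.inner_map_map, real_inner_comm]
      exact hxC β (Submodule.subset_span hβ)
    -- Against the dominant `σ x` the terms of γ are all nonnegative, so an orthogonal positive root
    -- involves only orthogonal simple roots.
    have key : ∀ γ ∈ posRoots Φ Δ, ⟪σ x, γ⟫_ℝ = 0 →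
        γ ∈ simpleSpan Δ ({i | ⟪σ x, Δ i⟫_ℝ = 0} : Finset (Fin n)) := by
      intro γ hγ hγ0
      have hnn := (mem_posRoots.1 hγ).2
      rw [← Δ.sum_repr γ, inner_sum] at hγ0
      rw [mem_simpleSpan]
      intro j hj
      have := (Finset.sum_eq_zero_iff_of_nonneg fun i _ => by
        rw [inner_smul_right]
        exact mul_nonneg (hnn i) (hdom i)).1 hγ0 j (Finset.mem_univ j)
      rw [inner_smul_right] at this
      exact (mul_eq_zero.1 this).resolve_right (by simpa using hj)
    rcases mem_posRoots_or_neg hΦ hΔ (weylGroup_apply_mem hΦ hσ β (hs hβ)) with h | h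
    · exact key _ h h0
    · exact (Submodule.neg_mem_iff _).1 (key _ h ((inner_neg_right _ _).trans (neg_eq_zero.2 h0)))
  · rw [simpleSpan_le_iff]
    intro i hi
    have h0 : ⟪x, σ⁻¹ (Δ i)⟫_ℝ = 0 := by
      rw [← inner_map_inv]
      simpa using hi
    refine ⟨σ⁻¹ (Δ i), ?_, apply_inv_apply σ _⟩
    by_contra hc
    exact hx _ (weylGroup_apply_mem hΦ (inv_mem hσ) _ (hΔ.mem i)) hc h0

end Roots

/-! ### Building families of finite sets and their nested sets -/

section Combinatorics

/-- Building families: families of non-empty subsets of a finite set that contain the singletons,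
the whole set and the unions of any two intersecting members. -/
structure IsBuildingFamily {ι : Type*} [Fintype ι] [DecidableEq ι] (B : Set (Finset ι)) :
    Prop where
  nonempty : ∀ I ∈ B, I.Nonempty
  singleton_mem : ∀ i, {i} ∈ B
  univ_mem : Finset.univ ∈ B
  union_mem : ∀ I ∈ B, ∀ J ∈ B, ∀ i, i ∈ I → i ∈ J → I ∪ J ∈ B

variable {ι : Type*} [Fintype ι] [DecidableEq ι] {B : Set (Finset ι)}

open Classical in
/-- The maximal members of `B` that are contained in `I`. -/
def components (B : Set (Finset ι)) (I : Finset ι) : Finset (Finset ι) :=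
  {A | Maximal (fun X => X ∈ B ∧ X ⊆ I) A}

theorem mem_components {I A : Finset ι} :
    A ∈ components B I ↔ Maximal (fun X => X ∈ B ∧ X ⊆ I) A := by simp [components]

theorem mem_of_mem_components {I A : Finset ι} (h : A ∈ components B I) : A ∈ B :=
  (mem_components.1 h).prop.1

theorem subset_of_mem_components {I A : Finset ι} (h : A ∈ components B I) : A ⊆ I :=
  (mem_components.1 h).prop.2

theorem exists_components_superset {I X : Finset ι} (hX : X ∈ B) (hXI : X ⊆ I) :
    ∃ A ∈ components B I, X ⊆ A := by
  obtain ⟨A, hXA, hA⟩ := (Set.toFinite {X : Finset ι | X ∈ B ∧ X ⊆ I}).exists_le_maximal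
    (a := X) ⟨hX, hXI⟩
  exact ⟨A, mem_components.2 hA, hXA⟩

theorem IsBuildingFamily.subset_component (hB : IsBuildingFamily B) {I X A : Finset ι}
    (hX : X ∈ B) (hXI : X ⊆ I) (hA : A ∈ components B I) {i : ι} (hiX : i ∈ X) (hiA : i ∈ A) :
    X ⊆ A := by
  have h := (mem_components.1 hA).2 (y := A ∪ X)
    ⟨hB.union_mem A (mem_of_mem_components hA) X hX i hiA hiX,
      Finset.union_subset (subset_of_mem_components hA) hXI⟩ Finset.subset_union_left
  exact Finset.subset_union_right.trans h

theorem IsBuildingFamily.eq_of_mem_components (hB : IsBuildingFamily B) {I A C : Finset ι}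
    (hA : A ∈ components B I) (hC : C ∈ components B I) {i : ι} (hiA : i ∈ A) (hiC : i ∈ C) :
    A = C :=
  (hB.subset_component (mem_of_mem_components hA) (subset_of_mem_components hA) hC hiA hiC).antisymm
    (hB.subset_component (mem_of_mem_components hC) (subset_of_mem_components hC) hA hiC hiA)

theorem IsBuildingFamily.exists_mem_component (hB : IsBuildingFamily B) {I : Finset ι} {i : ι}
    (hi : i ∈ I) : ∃ A ∈ components B I, i ∈ A := by
  obtain ⟨A, hA, h⟩ := exists_components_superset (hB.singleton_mem i)
    (Finset.singleton_subset_iff.2 hi)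
  exact ⟨A, hA, Finset.singleton_subset_iff.1 h⟩

theorem IsBuildingFamily.components_empty (hB : IsBuildingFamily B) : components B ∅ = ∅ := by
  refine Finset.eq_empty_of_forall_notMem fun A hA => ?_
  obtain ⟨i, hi⟩ := hB.nonempty A (mem_of_mem_components hA)
  exact Finset.notMem_empty _ (subset_of_mem_components hA hi)

theorem components_of_mem {I : Finset ι} (hI : I ∈ B) : components B I = {I} := by
  ext A
  rw [Finset.mem_singleton]
  constructor
  · intro hA
    exact (subset_of_mem_components hA).antisymm
      ((mem_components.1 hA).2 ⟨hI, subset_rfl⟩ (subset_of_mem_components hA))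
  · rintro rfl
    exact mem_components.2 ⟨⟨hI, subset_rfl⟩, fun X hX _ => hX.2⟩

theorem IsBuildingFamily.biUnion_components (hB : IsBuildingFamily B) (I : Finset ι) :
    (components B I).biUnion id = I := by
  ext i
  rw [Finset.mem_biUnion]
  constructor
  · rintro ⟨A, hA, hi⟩
    exact subset_of_mem_components hA hi
  · exact hB.exists_mem_component

theorem IsBuildingFamily.components_injective (hB : IsBuildingFamily B) :
    Function.Injective (components B) := fun I J h => by
  rw [← hB.biUnion_components I, h, hB.biUnion_components]

theorem IsBuildingFamily.sum_components (hB : IsBuildingFamily B) {M : Type*} [AddCommMonoid M]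
    (I : Finset ι) (f : ι → M) : ∑ A ∈ components B I, ∑ i ∈ A, f i = ∑ i ∈ I, f i := by
  conv_rhs => rw [← hB.biUnion_components I]
  rw [Finset.sum_biUnion]
  · rfl
  · intro A hA C hC hne
    exact Finset.disjoint_left.2 fun i hiA hiC => hne (hB.eq_of_mem_components hA hC hiA hiC)

/-- Uses a + b ≤ a b for integers at least 2. The weights 2^|C| let estimates for separate
components be added without losing the factor 2 in the definition of suitable lists. -/
theorem sum_two_pow_le {κ : Type*} (s : Finset κ) (f : κ → ℕ) (hf : ∀ k ∈ s, 1 ≤ f k) :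
    ∑ k ∈ s, 2 ^ f k ≤ 2 ^ ∑ k ∈ s, f k := by
  classical
  induction s using Finset.induction_on with
  | empty => simp
  | insert a s ha ih =>
    rw [Finset.sum_insert ha, Finset.sum_insert ha, pow_add]
    rcases s.eq_empty_or_nonempty with rfl | hs
    · simp
    · have h1 := ih fun k hk => hf k (Finset.mem_insert_of_mem hk)
      obtain ⟨k, hk⟩ := hs
      have h2 : 1 ≤ ∑ k ∈ s, f k := (hf k (Finset.mem_insert_of_mem hk)).trans
        (Finset.single_le_sum (fun _ _ => Nat.zero_le _) hk)
      have h3 : 2 ^ 1 ≤ 2 ^ f a := Nat.pow_le_pow_right two_pos (hf a (Finset.mem_insert_self _ _))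
      have h4 : 2 ^ 1 ≤ 2 ^ ∑ k ∈ s, f k := Nat.pow_le_pow_right two_pos h2
      have h5 := Nat.add_le_mul (by simpa using h3) (by simpa using h4)
      omega

theorem IsBuildingFamily.sum_two_pow_card_components_le (hB : IsBuildingFamily B) (I : Finset ι) :
    ∑ A ∈ components B I, 2 ^ A.card ≤ 2 ^ I.card := by
  refine (sum_two_pow_le _ _ fun A hA =>
    Finset.card_pos.2 (hB.nonempty A (mem_of_mem_components hA))).trans_eq ?_
  have := hB.sum_components I fun _ => 1
  simp only [Finset.sum_const, smul_eq_mul, mul_one] at this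
  rw [this]

/-- Nested subsets of a family of finite sets. -/
def Nested (B : Set (Finset ι)) (S : Finset (Finset ι)) : Prop :=
  (S : Set (Finset ι)) ⊆ B ∧ ∀ T ⊆ S, T.Nontrivial →
    IsAntichain (· ⊆ ·) (T : Set (Finset ι)) → T.sup id ∉ B

variable {S : Finset (Finset ι)}

theorem Nested.union_notMem (hS : Nested B S) {A C : Finset ι} (hA : A ∈ S) (hC : C ∈ S)
    (hAC : ¬ A ⊆ C) (hCA : ¬ C ⊆ A) : A ∪ C ∉ B := by
  have hne : A ≠ C := fun h => hAC h.subset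
  have h := hS.2 {A, C} (by
    intro X hX
    rcases Finset.mem_insert.1 hX with rfl | hX
    · exact hA
    · rwa [Finset.mem_singleton.1 hX])
    ⟨A, by simp, C, by simp, hne⟩ (by
      intro X hX Y hY hXY
      simp only [Finset.coe_insert, Finset.coe_singleton, Set.mem_insert_iff,
        Set.mem_singleton_iff] at hX hY
      rcases hX with rfl | rfl <;> rcases hY with rfl | rfl
      · exact absurd rfl hXY
      · exact hAC
      · exact hCA
      · exact absurd rfl hXY)
  simpa [Finset.sup_insert] using h

theorem Nested.subset_or_subset (hB : IsBuildingFamily B) (hS : Nested B S) {A C : Finset ι}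
    (hA : A ∈ S) (hC : C ∈ S) {i : ι} (hiA : i ∈ A) (hiC : i ∈ C) : A ⊆ C ∨ C ⊆ A := by
  by_contra h
  push Not at h
  exact hS.union_notMem hA hC h.1 h.2 (hB.union_mem A (hS.1 hA) C (hS.1 hC) i hiA hiC)

/-- `i` lies in `A` and in no smaller member of `S`. -/
def IsOwn (S : Finset (Finset ι)) (A : Finset ι) (i : ι) : Prop :=
  i ∈ A ∧ ∀ C ∈ S, C ⊂ A → i ∉ C

theorem exists_mem_maximal_ssubset {A C : Finset ι} (hC : C ∈ S) (hCA : C ⊂ A) :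
    ∃ X, Maximal (fun X => X ∈ S ∧ X ⊂ A) X ∧ C ⊆ X := by
  obtain ⟨X, hCX, hX⟩ := (Set.toFinite {X : Finset ι | X ∈ S ∧ X ⊂ A}).exists_le_maximal
    (a := C) ⟨hC, hCA⟩
  exact ⟨X, hX, hCX⟩

/-- A member of `B` that is a union of maximal proper parts of `A` in `S` is one of them. -/
theorem Nested.mem_of_cover (hB : IsBuildingFamily B) (hS : Nested B S) {A K : Finset ι}
    (hK : K ∈ B)
    (hcov : ∀ k ∈ K, ∃ X, Maximal (fun X => X ∈ S ∧ X ⊂ A) X ∧ k ∈ X ∧ X ⊆ K) :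
    K ∈ S ∧ K ⊂ A := by
  classical
  set T : Finset (Finset ι) := {X ∈ S | Maximal (fun X => X ∈ S ∧ X ⊂ A) X ∧ X ⊆ K} with hT
  have hsup : T.sup id = K := by
    refine le_antisymm (Finset.sup_le fun X hX => (Finset.mem_filter.1 hX).2.2) fun k hk => ?_
    obtain ⟨X, hX, hkX, hXK⟩ := hcov k hk
    have hXT : X ∈ T := Finset.mem_filter.2 ⟨hX.prop.1, hX, hXK⟩
    exact Finset.le_sup (f := id) hXT hkX
  have hanti : IsAntichain (· ⊆ ·) (T : Set (Finset ι)) := by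
    intro X hX Y hY hne hXY
    have h1 := (Finset.mem_filter.1 hX).2.1
    have h2 := (Finset.mem_filter.1 hY).2.1
    exact hne (h1.eq_of_le h2.prop hXY)
  -- Two or more parts would be an antichain with union in `B`, against nestedness; hence `K` is a
  -- single part.
  have hnt : ¬ T.Nontrivial := fun h => hS.2 T (Finset.filter_subset _ _) h hanti (hsup ▸ hK)
  obtain ⟨k, hk⟩ := hB.nonempty K hK
  obtain ⟨X, hX, hkX, hXK⟩ := hcov k hk
  have hXT : X ∈ T := Finset.mem_filter.2 ⟨hX.prop.1, hX, hXK⟩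
  have hTX : T = {X} := by
    refine Finset.eq_singleton_iff_unique_mem.2 ⟨hXT, fun Y hY => ?_⟩
    by_contra hne
    exact hnt ⟨Y, hY, X, hXT, hne⟩
  rw [hTX, Finset.sup_singleton, id] at hsup
  exact hsup ▸ hX.prop

theorem Nested.exists_isOwn (hB : IsBuildingFamily B) (hS : Nested B S) {A : Finset ι}
    (hA : A ∈ S) : ∃ i, IsOwn S A i := by
  by_contra hc
  unfold IsOwn at hc
  push Not at hc
  refine (hS.mem_of_cover hB (A := A) (hS.1 hA) fun k hk => ?_).2.ne rfl
  obtain ⟨C, hC, hCA, hkC⟩ := hc k hk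
  obtain ⟨X, hX, hCX⟩ := exists_mem_maximal_ssubset hC hCA
  exact ⟨X, hX, hCX hkC, hX.prop.2.subset⟩

/-! ### Maximal nested sets -/

theorem univ_mem_of_maximal (hB : IsBuildingFamily B) (hS : Maximal (Nested B) S) :
    Finset.univ ∈ S := by
  refine hS.2 (y := insert Finset.univ S) ⟨?_, fun T hT hnt hanti => ?_⟩
    (Finset.subset_insert _ _) (Finset.mem_insert_self _ _)
  · rw [Finset.coe_insert]
    exact Set.insert_subset hB.univ_mem hS.prop.1
  · refine hS.prop.2 T (fun X hX => (Finset.mem_insert.1 (hT hX)).resolve_left ?_) hnt hanti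
    rintro rfl
    obtain ⟨Y, hY, hne⟩ := hnt.exists_ne Finset.univ
    exact hanti hY hX hne (Finset.subset_univ Y)

/-- Given two own elements i ≠ j, let E be the component of i in the union of {i} and the smaller
members. It omits j and is not in `S`, yet it can be added to `S`, against maximality. -/
theorem isOwn_unique (hB : IsBuildingFamily B) (hS : Maximal (Nested B) S) {A : Finset ι}
    (hA : A ∈ S) {i j : ι} (hi : IsOwn S A i) (hj : IsOwn S A j) : i = j := by
  classical
  by_contra hij
  set D : Finset ι := insert i (({C ∈ S | C ⊂ A} : Finset (Finset ι)).sup id) with hD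
  have hCD : ∀ C ∈ S, C ⊂ A → C ⊆ D := fun C hC hCA =>
    (Finset.le_sup (f := id) (Finset.mem_filter.2 ⟨hC, hCA⟩ :
      C ∈ ({C ∈ S | C ⊂ A} : Finset (Finset ι)))).trans (Finset.subset_insert _ _)
  have hDA : D ⊆ A := by
    refine Finset.insert_subset hi.1 ?_
    exact Finset.sup_le (f := id) fun C hC => (Finset.mem_filter.1 hC).2.subset
  have hjD : j ∉ D := by
    rw [hD, Finset.mem_insert, Finset.mem_sup, not_or]
    refine ⟨fun h => hij h.symm, ?_⟩
    rintro ⟨C, hC, hjC⟩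
    obtain ⟨hCS, hCA⟩ := Finset.mem_filter.1 hC
    exact hj.2 C hCS hCA hjC
  obtain ⟨E, hE, hiE⟩ := hB.exists_mem_component (Finset.mem_insert_self i _ : i ∈ D)
  have hED := subset_of_mem_components hE
  have hEA : E ⊂ A := Finset.ssubset_iff_subset_ne.2 ⟨hED.trans hDA, fun h => hjD (hED (h ▸ hj.1))⟩
  have hES : E ∉ S := fun h => hi.2 E h hEA hiE
  refine hES (hS.2 (y := insert E S) ⟨?_, fun T hT hnt hanti hsup => ?_⟩
    (Finset.subset_insert _ _) (Finset.mem_insert_self _ _))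
  · rw [Finset.coe_insert]
    exact Set.insert_subset (mem_of_mem_components hE) hS.prop.1
  · by_cases hET : E ∈ T
    · have hmemS : ∀ F ∈ T, F ≠ E → F ∈ S := fun F hF hne =>
        (Finset.mem_insert.1 (hT hF)).resolve_left hne
      have hiT : i ∈ T.sup id := Finset.le_sup (f := id) hET hiE
      -- If the antichain stays strictly inside `A`, its union lies in `D` and contains i, so it is
      -- absorbed by the component `E` and the other sets are comparable to `E`.
      by_cases hall : ∀ F ∈ T, F ⊂ A
      · have hsub : T.sup id ⊆ D := Finset.sup_le fun F hF => by
          by_cases hFE : F = E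
          · rw [hFE]; exact hED
          · exact hCD F (hmemS F hF hFE) (hall F hF)
        have h1 := hB.subset_component hsup hsub hE hiT hiE
        obtain ⟨F, hF, hne⟩ := hnt.exists_ne E
        exact hanti hF hET hne ((Finset.le_sup (f := id) hF).trans h1)
      · push Not at hall
        obtain ⟨F, hF, hFA⟩ := hall
        have hFE : F ≠ E := fun h => hFA (h ▸ hEA)
        have hFA' : ¬ F ⊆ A := by
          intro h
          rcases h.eq_or_ssubset with rfl | h
          · exact hanti hET hF hFE.symm hEA.subset
          · exact hFA h
        -- Replacing all sets inside `A` by `A` gives an antichain in `S`; its union is `A` joined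
        -- with the old union, which meets `A` in i and so remains in `B`.
        set T' : Finset (Finset ι) := insert A {F ∈ T | ¬ F ⊆ A} with hT'
        refine hS.prop.2 T' ?_ ?_ ?_ ?_
        · refine Finset.insert_subset hA fun X hX => ?_
          obtain ⟨hXT, hXA⟩ := Finset.mem_filter.1 hX
          exact hmemS X hXT fun h => hXA (h ▸ hEA.subset)
        · exact ⟨A, Finset.mem_insert_self _ _, F,
            Finset.mem_insert_of_mem (Finset.mem_filter.2 ⟨hF, hFA'⟩), fun h => hFA' h.ge⟩
        · intro X hX Y hY hne hXY
          rcases Finset.mem_insert.1 hX with rfl | hX <;>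
            rcases Finset.mem_insert.1 hY with rfl | hY
          · exact hne rfl
          · obtain ⟨hYT, hYA⟩ := Finset.mem_filter.1 hY
            exact hanti hET hYT (fun h => hYA (h ▸ hEA.subset)) (hEA.subset.trans hXY)
          · exact (Finset.mem_filter.1 hX).2 hXY
          · exact hanti (Finset.mem_filter.1 hX).1 (Finset.mem_filter.1 hY).1 hne hXY
        · have heq : T'.sup id = A ∪ T.sup id := by
            rw [hT', Finset.sup_insert]
            refine le_antisymm (sup_le_sup_left (Finset.sup_mono (Finset.filter_subset _ _)) _)
              (sup_le le_sup_left (Finset.sup_le fun X hX => ?_))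
            by_cases hXA : X ⊆ A
            · exact hXA.trans (le_sup_left (a := A))
            · exact (Finset.le_sup (f := id)
                (Finset.mem_filter.2 ⟨hX, hXA⟩ : X ∈ ({F ∈ T | ¬ F ⊆ A} : Finset _))).trans
                le_sup_right
          rw [heq]
          exact hB.union_mem A (hS.prop.1 hA) _ hsup i hi.1 hiT
    · refine hS.prop.2 T (fun X hX => (Finset.mem_insert.1 (hT hX)).resolve_left ?_) hnt hanti hsup
      rintro rfl
      exact hET hX

/-- Every element other than i is non-own, hence lies in a maximal smaller member; this member
avoids i, so a component it meets contains it, and `Nested.mem_of_cover` applies. -/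
theorem components_erase_subset (hB : IsBuildingFamily B) (hS : Maximal (Nested B) S)
    {A : Finset ι} (hA : A ∈ S) {i : ι} (hi : IsOwn S A i) : components B (A.erase i) ⊆ S := by
  intro K hK
  have hKA := subset_of_mem_components hK
  refine (hS.prop.mem_of_cover hB (A := A) (mem_of_mem_components hK) fun k hk => ?_).1
  have hkA := Finset.mem_erase.1 (hKA hk)
  have hown : ¬ IsOwn S A k := fun h => hkA.1 (isOwn_unique hB hS hA h hi)
  unfold IsOwn at hown
  push Not at hown
  obtain ⟨C, hC, hCA, hkC⟩ := hown hkA.2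
  obtain ⟨X, hX, hCX⟩ := exists_mem_maximal_ssubset hC hCA
  refine ⟨X, hX, hCX hkC, hB.subset_component (hS.prop.1 hX.prop.1) ?_ hK (hCX hkC) hk⟩
  intro x hx
  exact Finset.mem_erase.2 ⟨fun h => hi.2 X hX.prop.1 hX.prop.2 (h ▸ hx), hX.prop.2.subset hx⟩

theorem exists_minimal_superset (hB : IsBuildingFamily B) (hS : Maximal (Nested B) S)
    (C : Finset ι) : ∃ A, Minimal (fun X => X ∈ S ∧ C ⊆ X) A := by
  obtain ⟨A, -, hA⟩ := (Set.toFinite {X : Finset ι | X ∈ S ∧ C ⊆ X}).exists_le_minimal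
    (a := Finset.univ) ⟨univ_mem_of_maximal hB hS, Finset.subset_univ C⟩
  exact ⟨A, hA⟩

theorem exists_isOwn_mem (hB : IsBuildingFamily B) (hS : Maximal (Nested B) S) (i : ι) :
    ∃ A ∈ S, IsOwn S A i := by
  obtain ⟨A, hA⟩ := exists_minimal_superset hB hS {i}
  refine ⟨A, hA.prop.1, Finset.singleton_subset_iff.1 hA.prop.2, fun C hC hCA hiC => ?_⟩
  exact hCA.not_subset (hA.2 ⟨hC, Finset.singleton_subset_iff.2 hiC⟩ hCA.subset)

/-- Sending a member to its own element is a bijection onto the index set. -/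
theorem card_eq_of_maximal (hB : IsBuildingFamily B) (hS : Maximal (Nested B) S) :
    S.card = Fintype.card ι := by
  choose f hf using fun A : S => hS.prop.exists_isOwn hB A.2
  rw [← Fintype.card_coe]
  refine Fintype.card_of_bijective (f := f) ⟨?_, fun i => ?_⟩
  · intro A C hAC
    have h1 := hf A
    have h2 := hf C
    rw [← hAC] at h2
    refine Subtype.ext ?_
    by_contra hne
    rcases hS.prop.subset_or_subset hB A.2 C.2 h1.1 h2.1 with h | h
    · exact h2.2 A A.2 (Finset.ssubset_iff_subset_ne.2 ⟨h, hne⟩) h1.1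
    · exact h1.2 C C.2 (Finset.ssubset_iff_subset_ne.2 ⟨h, Ne.symm hne⟩) h2.1
  · obtain ⟨A, hA, hi⟩ := exists_isOwn_mem hB hS i
    exact ⟨⟨A, hA⟩, isOwn_unique hB hS hA (hf ⟨A, hA⟩) hi⟩

theorem Nested.components_union (hB : IsBuildingFamily B) (hS : Nested B S) {A C : Finset ι}
    (hA : A ∈ S) (hC : C ∈ S) (hAC : ¬ A ⊆ C) (hCA : ¬ C ⊆ A) :
    components B (A ∪ C) = {A, C} := by
  have hun := hS.union_notMem hA hC hAC hCA
  have key : ∀ X Y : Finset ι, X ∈ S → Y ∈ S → X ∪ Y ∉ B → X ∈ components B (X ∪ Y) := by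
    intro X Y hX hY hXY
    refine mem_components.2 ⟨⟨hS.1 hX, Finset.subset_union_left⟩, fun Z hZ hXZ z hz => ?_⟩
    rcases Finset.mem_union.1 (hZ.2 hz) with h | h
    · exact h
    · exfalso
      have := hB.union_mem Z hZ.1 Y (hS.1 hY) z hz h
      refine hXY ?_
      rwa [show Z ∪ Y = X ∪ Y from (Finset.union_subset hZ.2 Finset.subset_union_right).antisymm
        (Finset.union_subset_union_left hXZ)] at this
  have h1 := key A C hA hC hun
  have h2 : C ∈ components B (A ∪ C) := by
    rw [Finset.union_comm] at hun ⊢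
    exact key C A hC hA hun
  ext X
  rw [Finset.mem_insert, Finset.mem_singleton]
  constructor
  · intro hX
    obtain ⟨x, hx⟩ := hB.nonempty X (mem_of_mem_components hX)
    rcases Finset.mem_union.1 (subset_of_mem_components hX hx) with h | h
    · exact Or.inl (hB.eq_of_mem_components hX h1 hx h)
    · exact Or.inr (hB.eq_of_mem_components hX h2 hx h)
  · rintro (rfl | rfl)
    · exact h1
    · exact h2

/-- A union of several components that lay in `B` would contradict their maximality. This later
yields maximal nested sets that are not chains. -/
theorem nested_components (I : Finset ι) : Nested B (components B I) := by
  refine ⟨fun A hA => mem_of_mem_components hA, fun T hT hnt hanti hsup => ?_⟩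
  have hsub : T.sup id ⊆ I := Finset.sup_le fun A hA => subset_of_mem_components (hT hA)
  obtain ⟨A, hA, C, hC, hne⟩ := hnt
  have h : ∀ X ∈ T, X = T.sup id := fun X hX =>
    (mem_components.1 (hT hX)).eq_of_le ⟨hsup, hsub⟩ (Finset.le_sup (f := id) hX)
  exact hne ((h A hA).trans (h C hC).symm)

theorem Nested.exists_maximal (hS : Nested B S) : ∃ M, S ⊆ M ∧ Maximal (Nested B) M := by
  obtain ⟨M, hSM, hM⟩ := (Set.toFinite {X : Finset (Finset ι) | Nested B X}).exists_le_maximal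
    (a := S) hS
  exact ⟨M, hSM, hM⟩

/-! #### Solutions of the equations of a maximal nested set -/

/-- Coefficients `c` and a list `e` whose growth dominates the ratios of the coefficients. -/
structure IsDominated (B : Set (Finset ι)) (c : Finset ι → ι → ℝ) (e : ℕ → ℝ) : Prop where
  coef_pos : ∀ A ∈ B, ∀ i ∈ A, 0 < c A i
  pos : ∀ A ∈ B, 0 < e A.card
  lt : ∀ A ∈ B, ∀ C ∈ B, C ⊂ A → ∀ i ∈ C,
    c A i * (2 ^ A.card * e C.card) < c C i * (2 ^ C.card * e A.card)

variable {c : Finset ι → ι → ℝ} {e : ℕ → ℝ} {y : ι → ℝ}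

/-- The system is triangular: by induction on size, only the own term of A survives in the equation
of A. -/
theorem eq_zero_of_forall_sum_eq_zero (hB : IsBuildingFamily B) (hS : Maximal (Nested B) S)
    (hc : ∀ A ∈ B, ∀ i ∈ A, 0 < c A i) (hy : ∀ A ∈ S, ∑ i ∈ A, c A i * y i = 0) (i : ι) :
    y i = 0 := by
  obtain ⟨A, hA, hi⟩ := exists_isOwn_mem hB hS i
  induction hN : A.card using Nat.strong_induction_on generalizing A i with
  | _ N ih =>
    have h0 := hy A hA
    have hz : ∀ k ∈ A, k ≠ i → c A k * y k = 0 := by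
      intro k hk hki
      obtain ⟨C, hC, hkC⟩ := exists_isOwn_mem hB hS k
      have hCA : C ⊂ A := by
        have hne : C ≠ A := by
          rintro rfl
          exact hki (isOwn_unique hB hS hA hkC hi)
        rcases hS.prop.subset_or_subset hB hC hA hkC.1 hk with h | h
        · exact Finset.ssubset_iff_subset_ne.2 ⟨h, hne⟩
        · exact absurd hk (hkC.2 A hA (Finset.ssubset_iff_subset_ne.2 ⟨h, hne.symm⟩))
      rw [ih C.card (hN ▸ Finset.card_lt_card hCA) k C hC hkC rfl, mul_zero]
    rw [Finset.sum_eq_single_of_mem i hi.1 hz] at h0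
    exact (mul_eq_zero.1 h0).resolve_left (hc A (hS.prop.1 hA) i hi.1).ne'

/-- The part of `∑ i ∈ I, c A i * y i` on a union of smaller members of `B` is small. -/
theorem IsDominated.sum_components_le (hB : IsBuildingFamily B) (h : IsDominated B c e)
    {A I : Finset ι} (hA : A ∈ B) (hIA : I ⊂ A) (hy : ∀ i ∈ I, 0 ≤ y i)
    (hsum : ∀ C ∈ components B I, ∑ i ∈ C, c C i * y i = e C.card) :
    ∑ i ∈ I, c A i * y i ≤ e A.card / 2 := by
  have h1 : ∀ C ∈ components B I, 2 ^ A.card * ∑ i ∈ C, c A i * y i ≤ 2 ^ C.card * e A.card := by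
    intro C hC
    have hCB := mem_of_mem_components hC
    have hCI := subset_of_mem_components hC
    have h2 : ∑ i ∈ C, c A i * (2 ^ A.card * e C.card) * y i ≤
        ∑ i ∈ C, c C i * (2 ^ C.card * e A.card) * y i :=
      Finset.sum_le_sum fun i hi => mul_le_mul_of_nonneg_right
        (h.lt A hA C hCB (hCI.trans_ssubset hIA) i hi).le (hy i (hCI hi))
    have h3 : ∑ i ∈ C, c A i * (2 ^ A.card * e C.card) * y i =
        e C.card * (2 ^ A.card * ∑ i ∈ C, c A i * y i) := by
      rw [Finset.mul_sum, Finset.mul_sum]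
      exact Finset.sum_congr rfl fun i _ => by ring
    have h4 : ∑ i ∈ C, c C i * (2 ^ C.card * e A.card) * y i =
        e C.card * (2 ^ C.card * e A.card) := by
      rw [← hsum C hC, Finset.sum_mul]
      exact Finset.sum_congr rfl fun i _ => by ring
    rw [h3, h4] at h2
    exact le_of_mul_le_mul_left h2 (h.pos C hCB)
  have h5 := Finset.sum_le_sum h1
  rw [← Finset.mul_sum, ← Finset.sum_mul, hB.sum_components] at h5
  -- Strictness of `I ⊂ A` gains the one factor 2 that becomes the 1/2 of the conclusion.
  have h6 : (∑ C ∈ components B I, (2 : ℝ) ^ C.card) * 2 ≤ 2 ^ A.card := by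
    have h7 := hB.sum_two_pow_card_components_le I
    have h8 : 2 ^ (I.card + 1) ≤ 2 ^ A.card :=
      Nat.pow_le_pow_right two_pos (Finset.card_lt_card hIA)
    rw [pow_succ] at h8
    have h9 : (∑ C ∈ components B I, 2 ^ C.card) * 2 ≤ 2 ^ A.card := by omega
    exact_mod_cast h9
  have h10 := mul_le_mul_of_nonneg_right h6 (h.pos A hA).le
  have h11 : (0 : ℝ) < 2 ^ A.card := by positivity
  refine le_of_mul_le_mul_left (h5.trans ?_) h11
  linarith

/-- Inductively the coordinates away from the own element are positive and contribute at most half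
of e_|A| to the equation of A; the own term supplies the rest. -/
theorem IsDominated.pos_and_half_le (hB : IsBuildingFamily B) (h : IsDominated B c e)
    (hS : Maximal (Nested B) S) (hy : ∀ A ∈ S, ∑ i ∈ A, c A i * y i = e A.card)
    {A : Finset ι} (hA : A ∈ S) : (∀ i ∈ A, 0 < y i) ∧
      ∀ i, IsOwn S A i → e A.card / 2 ≤ c A i * y i := by
  induction hN : A.card using Nat.strong_induction_on generalizing A with
  | _ N ih =>
    have hAB := hS.prop.1 hA
    obtain ⟨i, hi⟩ := hS.prop.exists_isOwn hB hA
    have hsub := components_erase_subset hB hS hA hi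
    have hpos : ∀ k ∈ A.erase i, 0 < y k := by
      intro k hk
      obtain ⟨C, hC, hkC⟩ := hB.exists_mem_component hk
      have hlt := Finset.card_lt_card ((subset_of_mem_components hC).trans_ssubset
        (Finset.erase_ssubset hi.1))
      exact (ih C.card (hN ▸ hlt) (hsub hC) rfl).1 k hkC
    have hle := h.sum_components_le hB hAB (Finset.erase_ssubset hi.1)
      (fun k hk => (hpos k hk).le) fun C hC => hy C (hsub hC)
    have hs := hy A hA
    rw [← Finset.add_sum_erase _ _ hi.1] at hs
    have hhalf : e A.card / 2 ≤ c A i * y i := by linarith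
    refine ⟨fun k hk => ?_, fun k hk => ?_⟩
    · by_cases hki : k = i
      · subst hki
        have h0 : 0 < c A k * y k := lt_of_lt_of_le (half_pos (h.pos A hAB)) hhalf
        exact (mul_pos_iff_of_pos_left (h.coef_pos A hAB k hi.1)).1 h0
      · exact hpos k (Finset.mem_erase.2 ⟨hki, hk⟩)
    · rw [isOwn_unique hB hS hA hk hi, ← hN]
      exact hhalf

theorem IsDominated.lt_sum (hB : IsBuildingFamily B) (h : IsDominated B c e)
    (hS : Maximal (Nested B) S) (hy : ∀ A ∈ S, ∑ i ∈ A, c A i * y i = e A.card)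
    {C : Finset ι} (hC : C ∈ B) (hCS : C ∉ S) : e C.card < ∑ i ∈ C, c C i * y i := by
  have hpos : ∀ i, 0 < y i := fun i =>
    (h.pos_and_half_le hB hS hy (univ_mem_of_maximal hB hS)).1 i (Finset.mem_univ i)
  obtain ⟨A, hmin⟩ := exists_minimal_superset hB hS C
  obtain ⟨hA, hCA⟩ := hmin.prop
  have hAB := hS.prop.1 hA
  have hCA' : C ⊂ A := Finset.ssubset_iff_subset_ne.2 ⟨hCA, fun e => hCS (e ▸ hA)⟩
  obtain ⟨i, hi⟩ := hS.prop.exists_isOwn hB hA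
  -- Otherwise `C` would fit in a component of `A.erase i`, a member of `S` smaller than the minimal
  -- `A`. The own term of `A` then alone exceeds the bound for `C`.
  have hiC : i ∈ C := by
    by_contra hc
    obtain ⟨K, hK, hCK⟩ := exists_components_superset hC
      (fun k hk => Finset.mem_erase.2 ⟨fun e => hc (e ▸ hk), hCA hk⟩ : C ⊆ A.erase i)
    have hKA := (subset_of_mem_components hK).trans_ssubset (Finset.erase_ssubset hi.1)
    exact hKA.not_subset (hmin.2 ⟨components_erase_subset hB hS hA hi hK, hCK⟩ hKA.subset)
  have h1 := (h.pos_and_half_le hB hS hy hA).2 i hi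
  have h2 := mul_lt_mul_of_pos_right (h.lt A hAB C hC hCA' i hiC) (hpos i)
  have heA := h.pos A hAB
  have heC := h.pos C hC
  have h3 : (2 : ℝ) ^ C.card * 2 ≤ 2 ^ A.card := by
    rw [← pow_succ]
    exact pow_le_pow_right₀ one_le_two (Finset.card_lt_card hCA')
  have h4 : e C.card < c C i * y i := by
    have h5 : e A.card / 2 * (2 ^ A.card * e C.card) < c C i * y i * (2 ^ C.card * e A.card) := by
      have := mul_le_mul_of_nonneg_right h1 (by positivity : 0 ≤ 2 ^ A.card * e C.card)
      linarith
    have h6 : e A.card / 2 * (2 ^ C.card * 2 * e C.card) ≤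
        e A.card / 2 * (2 ^ A.card * e C.card) := by gcongr
    have h7 : (e A.card * 2 ^ C.card) * e C.card < (e A.card * 2 ^ C.card) * (c C i * y i) := by
      linarith
    exact lt_of_mul_lt_mul_left h7 (by positivity)
  refine h4.trans_le (Finset.single_le_sum (f := fun i => c C i * y i) (fun k hk => ?_) hiC)
  exact (mul_pos (h.coef_pos C hC k hk) (hpos k)).le

/-- The values of a list with dominating growth on disjoint parts of `univ`. -/
theorem IsDominated.sum_components_lt (hB : IsBuildingFamily B) (h : IsDominated B c e)
    (hmono : ∀ A C : Finset ι, C ⊆ A → ∀ i, c C i ≤ c A i) {A I : Finset ι} (hA : A ∈ B)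
    (hIA : I ⊂ A) : ∑ C ∈ components B I, e C.card < e A.card := by
  have h1 : ∀ C ∈ components B I, 2 ^ A.card * e C.card ≤ 2 ^ C.card * e A.card := by
    intro C hC
    have hCB := mem_of_mem_components hC
    have hCA := (subset_of_mem_components hC).trans_ssubset hIA
    obtain ⟨i, hi⟩ := hB.nonempty C hCB
    have h2 := h.lt A hA C hCB hCA i hi
    have h3 := mul_le_mul_of_nonneg_right (hmono A C hCA.subset i)
      (mul_nonneg (by positivity) (h.pos C hCB).le : 0 ≤ 2 ^ A.card * e C.card)
    exact le_of_mul_le_mul_left (h3.trans h2.le) (h.coef_pos C hCB i hi)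
  have h5 := Finset.sum_le_sum h1
  rw [← Finset.mul_sum, ← Finset.sum_mul] at h5
  have h6 : (∑ C ∈ components B I, (2 : ℝ) ^ C.card) < 2 ^ A.card := by
    have h7 := hB.sum_two_pow_card_components_le I
    have h8 : 2 ^ I.card < 2 ^ A.card :=
      Nat.pow_lt_pow_right one_lt_two (Finset.card_lt_card hIA)
    exact_mod_cast h7.trans_lt h8
  have h10 := mul_lt_mul_of_pos_right h6 (h.pos A hA)
  exact lt_of_mul_lt_mul_left (h5.trans_lt h10) (by positivity)

end Combinatorics

/-! ### The building family of a building set -/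

section BuildingSet

variable {V : Type*} [NormedAddCommGroup V] [InnerProductSpace ℝ V] [FiniteDimensional ℝ V]
variable {n : ℕ} {Φ : Finset V} {Δ : Module.Basis (Fin n) ℝ V} {G : Set (Submodule ℝ V)}
  {ε : ℕ → ℝ}

/-- The sets of simple roots whose spans are in `G`. -/
def fundFamily (Δ : Module.Basis (Fin n) ℝ V) (G : Set (Submodule ℝ V)) : Set (Finset (Fin n)) :=
  {I | simpleSpan Δ I ∈ G}

theorem mem_fundFamily {I : Finset (Fin n)} : I ∈ fundFamily Δ G ↔ simpleSpan Δ I ∈ G := Iff.rfl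

theorem simpleSpan_mem_fund {I : Finset (Fin n)} :
    simpleSpan Δ I ∈ fund Δ G ↔ I ∈ fundFamily Δ G :=
  ⟨fun h => h.1, fun h => ⟨h, Δ '' I, Set.image_subset_range _ _, rfl⟩⟩

theorem exists_of_mem_fund {A : Submodule ℝ V} (hA : A ∈ fund Δ G) :
    ∃ I ∈ fundFamily Δ G, A = simpleSpan Δ I := by
  obtain ⟨I, rfl⟩ := exists_eq_simpleSpan hA.2
  exact ⟨I, hA.1, rfl⟩

theorem finite_fund : (fund Δ G).Finite := by
  refine (Set.finite_range (simpleSpan Δ)).subset fun A hA => ?_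
  obtain ⟨I, -, rfl⟩ := exists_of_mem_fund hA
  exact ⟨I, rfl⟩

theorem finite_rootSubspaces : (rootSubspaces Φ).Finite := by
  refine (Φ.finite_toSet.finite_subsets.image (Submodule.span ℝ)).subset ?_
  rintro C ⟨s, hs, -, rfl⟩
  exact ⟨s, hs, rfl⟩

theorem mem_decomposition {A C : Submodule ℝ V} :
    A ∈ decomposition G C ↔ Maximal (fun X => X ∈ G ∧ X ≤ C) A := Iff.rfl

theorem IsBuildingSet.exists_mem_decomposition (hG : IsBuildingSet Φ G) {X C : Submodule ℝ V}
    (hX : X ∈ G) (hXC : X ≤ C) : ∃ D ∈ decomposition G C, X ≤ D := by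
  obtain ⟨D, hXD, hD⟩ := (((finite_rootSubspaces (Φ := Φ)).subset hG.subset).subset
    (fun Y hY => hY.1 : {Y | Y ∈ G ∧ Y ≤ C} ⊆ G)).exists_le_maximal (a := X) ⟨hX, hXC⟩
  exact ⟨D, hD, hXD⟩

theorem IsBuildingSet.eq_of_mem_decomposition (hG : IsBuildingSet Φ G) {C : Submodule ℝ V}
    (hC : C ∈ rootSubspaces Φ) {X Y : Submodule ℝ V} (hX : X ∈ decomposition G C)
    (hY : Y ∈ decomposition G C) {x : V} (hx : x ≠ 0) (hxX : x ∈ X) (hxY : x ∈ Y) : X = Y := by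
  by_contra hne
  have := (hG.sSupIndep_decomposition C hC).pairwiseDisjoint hX hY hne
  exact hx (Submodule.disjoint_def.1 this x hxX hxY)

theorem IsBuildingSet.nonempty_of_mem (hΦ : IsRootSystem Φ) (hG : IsBuildingSet Φ G)
    {I : Finset (Fin n)} (hI : I ∈ fundFamily Δ G) : I.Nonempty := by
  by_contra h
  rw [Finset.not_nonempty_iff_eq_empty] at h
  subst h
  obtain ⟨s, hs, ⟨α, hα⟩, heq⟩ := hG.subset hI
  have h1 : α ∈ simpleSpan Δ (∅ : Finset (Fin n)) := heq ▸ Submodule.subset_span hα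
  rw [simpleSpan, Finset.coe_empty, Set.image_empty, Submodule.span_empty, Submodule.mem_bot] at h1
  exact hΦ.ne_zero α (hs hα) h1

theorem IsBuildingSet.singleton_mem (hΔ : IsSimpleSystem Φ Δ) (hG : IsBuildingSet Φ G)
    (i : Fin n) : {i} ∈ fundFamily Δ G := by
  rw [mem_fundFamily, simpleSpan, Finset.coe_singleton, Set.image_singleton]
  exact hG.line_mem _ (hΔ.mem i)

theorem simpleSpan_mem_rootSubspaces (hΔ : IsSimpleSystem Φ Δ) {I : Finset (Fin n)}
    (hI : I.Nonempty) : simpleSpan Δ I ∈ rootSubspaces Φ := (mem_fund_rootSubspaces hΔ hI).1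

theorem IsBuildingSet.isBuildingFamily (hΦ : IsRootSystem Φ) (hΔ : IsSimpleSystem Φ Δ)
    (hG : IsBuildingSet Φ G) (hV : ⊤ ∈ G) : IsBuildingFamily (fundFamily Δ G) where
  nonempty _ hI := hG.nonempty_of_mem hΦ hI
  singleton_mem := hG.singleton_mem hΔ
  univ_mem := by rwa [mem_fundFamily, simpleSpan_univ]
  union_mem := by
    intro I hI J hJ i hiI hiJ
    have hC := simpleSpan_mem_rootSubspaces hΔ
      (⟨i, Finset.mem_union_left _ hiI⟩ : (I ∪ J).Nonempty)
    obtain ⟨X, hX, hIX⟩ := hG.exists_mem_decomposition hI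
      (simpleSpan_le_simpleSpan.2 (Finset.subset_union_left : I ⊆ I ∪ J))
    obtain ⟨Y, hY, hJY⟩ := hG.exists_mem_decomposition hJ
      (simpleSpan_le_simpleSpan.2 (Finset.subset_union_right : J ⊆ I ∪ J))
    have hXY := hG.eq_of_mem_decomposition hC hX hY (Δ.ne_zero i)
      (hIX (simple_mem_simpleSpan.2 hiI)) (hJY (simple_mem_simpleSpan.2 hiJ))
    subst hXY
    have hle : simpleSpan Δ (I ∪ J) ≤ X := by
      rw [simpleSpan_le_iff]
      intro k hk
      rcases Finset.mem_union.1 hk with h | h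
      · exact hIX (simple_mem_simpleSpan.2 h)
      · exact hJY (simple_mem_simpleSpan.2 h)
    rw [mem_fundFamily, hle.antisymm (mem_decomposition.1 hX).prop.2]
    exact (mem_decomposition.1 hX).prop.1

/-- Three roots of the plane, `Δ i`, `Δ j` and γ = Δ j - k Δ i with k ≠ 0, must be distributed among
independent summands. A summand containing two of them contains all, and they cannot lie in three
different ones. -/
theorem IsBuildingSet.pair_mem (hΦ : IsRootSystem Φ) (hΔ : IsSimpleSystem Φ Δ)
    (hG : IsBuildingSet Φ G) {i j : Fin n} (hij : i ≠ j) (h : ⟪Δ i, Δ j⟫_ℝ ≠ 0) :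
    {i, j} ∈ fundFamily Δ G := by
  have hC := simpleSpan_mem_rootSubspaces hΔ (⟨i, by simp⟩ : ({i, j} : Finset (Fin n)).Nonempty)
  set C := simpleSpan Δ ({i, j} : Finset (Fin n)) with hCdef
  have hiC : Δ i ∈ C := simple_mem_simpleSpan.2 (by simp)
  have hjC : Δ j ∈ C := simple_mem_simpleSpan.2 (by simp)
  set k : ℝ := 2 * ⟪Δ j, Δ i⟫_ℝ / ‖Δ i‖ ^ 2 with hk
  have hk0 : k ≠ 0 := by
    rw [hk, real_inner_comm]
    exact div_ne_zero (mul_ne_zero two_ne_zero h) (norm_sq_simple_pos i).ne'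
  set γ := refl (Δ i) (Δ j) with hγ
  have hγeq : γ = Δ j - k • Δ i := refl_apply _ _
  have hγΦ : γ ∈ Φ := hΦ.refl_mem _ (hΔ.mem i) _ (hΔ.mem j)
  have hγ0 := hΦ.ne_zero γ hγΦ
  have hγC : γ ∈ C := hγeq ▸ C.sub_mem hjC (C.smul_mem k hiC)
  have hex : ∀ β ∈ Φ, β ∈ C → ∃ D ∈ decomposition G C, β ∈ D := fun β hβ hβC => by
    obtain ⟨D, hD, hle⟩ := hG.exists_mem_decomposition (hG.line_mem β hβ)
      ((Submodule.span_singleton_le_iff_mem β C).2 hβC)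
    exact ⟨D, hD, hle (Submodule.mem_span_singleton_self β)⟩
  obtain ⟨X, hX, hγX⟩ := hex γ hγΦ hγC
  obtain ⟨Y, hY, hiY⟩ := hex _ (hΔ.mem i) hiC
  obtain ⟨Z, hZ, hjZ⟩ := hex _ (hΔ.mem j) hjC
  have heq : ∀ {D E}, D ∈ decomposition G C → E ∈ decomposition G C → ∀ {x : V}, x ≠ 0 →
      x ∈ D → x ∈ E → D = E := fun hD hE _ hx => hG.eq_of_mem_decomposition hC hD hE hx
  have hYZ : Y = Z := by
    by_cases hXY : X = Y
    · subst hXY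
      have hjX : Δ j ∈ X := by
        rw [show Δ j = γ + k • Δ i by rw [hγeq, sub_add_cancel]]
        exact X.add_mem hγX (X.smul_mem k hiY)
      exact heq hX hZ (Δ.ne_zero j) hjX hjZ
    by_cases hXZ : X = Z
    · subst hXZ
      have hiX : Δ i ∈ X := by
        rw [← X.smul_mem_iff hk0, show k • Δ i = Δ j - γ by rw [hγeq, sub_sub_cancel]]
        exact X.sub_mem hjZ hγX
      exact heq hY hX (Δ.ne_zero i) hiY hiX
    exfalso
    have hd := hG.sSupIndep_decomposition C hC hX
    refine hγ0 (Submodule.disjoint_def.1 hd γ hγX ?_)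
    have hYs : Y ≤ sSup (decomposition G C \ {X}) := le_sSup ⟨hY, fun h => hXY h.symm⟩
    have hZs : Z ≤ sSup (decomposition G C \ {X}) := le_sSup ⟨hZ, fun h => hXZ h.symm⟩
    rw [hγeq]
    exact Submodule.sub_mem _ (hZs hjZ) (Submodule.smul_mem _ k (hYs hiY))
  subst hYZ
  have hle : C ≤ Y := by
    rw [hCdef, simpleSpan_le_iff]
    intro l hl
    rcases Finset.mem_insert.1 hl with rfl | hl
    · exact hiY
    · rwa [Finset.mem_singleton.1 hl]
  rw [mem_fundFamily, ← hCdef, hle.antisymm (mem_decomposition.1 hY).prop.2]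
  exact (mem_decomposition.1 hY).prop.1

theorem IsBuildingSet.insert_mem (hΦ : IsRootSystem Φ) (hΔ : IsSimpleSystem Φ Δ)
    (hG : IsBuildingSet Φ G) (hV : ⊤ ∈ G) {I : Finset (Fin n)} (hI : I ∈ fundFamily Δ G)
    {i j : Fin n} (hi : i ∈ I) (h : ⟪Δ i, Δ j⟫_ℝ ≠ 0) : insert j I ∈ fundFamily Δ G := by
  by_cases hij : i = j
  · subst hij
    rwa [Finset.insert_eq_of_mem hi]
  · have h1 := (hG.isBuildingFamily hΦ hΔ hV).union_mem _ (hG.pair_mem hΦ hΔ hij h) I hI i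
      (by simp) hi
    rwa [show ({i, j} ∪ I : Finset (Fin n)) = insert j I by ext x; simp; grind] at h1

/-- The part of ρ_A on `C` and ρ_C have the same inner products with the simple roots of `C`, so
their difference is orthogonal to itself. -/
theorem coef_eq_of_orthogonal (hΦ : IsRootSystem Φ) (hΔ : IsSimpleSystem Φ Δ)
    {A C : Finset (Fin n)} (hCA : C ⊆ A)
    (horth : ∀ j ∈ A, j ∉ C → ∀ i ∈ C, ⟪Δ i, Δ j⟫_ℝ = 0) {i : Fin n} (hi : i ∈ C) :
    coef Φ Δ A i = coef Φ Δ C i := by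
  have hu : ∀ k ∈ C, ⟪∑ j ∈ C, (coef Φ Δ A j - coef Φ Δ C j) • Δ j, Δ k⟫_ℝ = 0 := by
    intro k hk
    have h1 := inner_delta_sub_halfSum hΦ hΔ (hCA hk)
    have h2 := inner_delta_sub_halfSum hΦ hΔ hk
    rw [inner_sub_left] at h1 h2
    have h3 : ⟪halfSum Φ Δ A, Δ k⟫_ℝ = ⟪∑ j ∈ C, coef Φ Δ A j • Δ j, Δ k⟫_ℝ := by
      rw [halfSum_eq_sum, sum_inner, sum_inner]
      refine (Finset.sum_subset hCA fun j hj hjC => ?_).symm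
      rw [inner_smul_left, real_inner_comm, horth j hj hjC k hk, mul_zero]
    have h4 : ∑ j ∈ C, (coef Φ Δ A j - coef Φ Δ C j) • Δ j =
        ∑ j ∈ C, coef Φ Δ A j • Δ j - halfSum Φ Δ C := by
      rw [halfSum_eq_sum, ← Finset.sum_sub_distrib]
      exact Finset.sum_congr rfl fun j _ => sub_smul _ _ _
    rw [h4, inner_sub_left, ← h3]
    linarith
  have h0 : ∑ j ∈ C, (coef Φ Δ A j - coef Φ Δ C j) • Δ j = 0 := by
    rw [← inner_self_eq_zero (𝕜 := ℝ), inner_sum]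
    refine Finset.sum_eq_zero fun k hk => ?_
    rw [inner_smul_right, hu k hk, mul_zero]
  have h1 := (linearIndependent_iff'.1 Δ.linearIndependent) C _ h0 i hi
  exact sub_eq_zero.1 h1

/-! #### Suitable lists -/

theorem coef_le_maxCoeff (hΦ : IsRootSystem Φ) (hΔ : IsSimpleSystem Φ Δ) {I : Finset (Fin n)}
    {i : Fin n} (hi : i ∈ I) : coef Φ Δ I i ≤ maxCoeff Φ Δ (simpleSpan Δ I) := by
  rw [maxCoeff, piVec_simpleSpan hΦ hΔ]
  exact le_ciSup (f := fun j : {j // Δ j ∈ simpleSpan Δ I} => Δ.repr (halfSum Φ Δ I) j)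
    (Set.finite_range _).bddAbove ⟨i, simple_mem_simpleSpan.2 hi⟩

theorem minCoeff_le_coef (hΦ : IsRootSystem Φ) (hΔ : IsSimpleSystem Φ Δ) {I : Finset (Fin n)}
    {i : Fin n} (hi : i ∈ I) : minCoeff Φ Δ (simpleSpan Δ I) ≤ coef Φ Δ I i := by
  rw [minCoeff, piVec_simpleSpan hΦ hΔ]
  exact ciInf_le (f := fun j : {j // Δ j ∈ simpleSpan Δ I} => Δ.repr (halfSum Φ Δ I) j)
    (Set.finite_range _).bddBelow ⟨i, simple_mem_simpleSpan.2 hi⟩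

theorem minCoeff_pos (hΦ : IsRootSystem Φ) (hΔ : IsSimpleSystem Φ Δ) {I : Finset (Fin n)}
    (hI : I.Nonempty) : 0 < minCoeff Φ Δ (simpleSpan Δ I) := by
  rw [minCoeff, piVec_simpleSpan hΦ hΔ]
  obtain ⟨i, hi⟩ := hI
  have : Nonempty {j // Δ j ∈ simpleSpan Δ I} := ⟨⟨i, simple_mem_simpleSpan.2 hi⟩⟩
  refine lt_of_lt_of_le (by norm_num : (0 : ℝ) < 1 / 2) (le_ciInf fun j => ?_)
  exact half_le_coef hΔ (simple_mem_simpleSpan.1 j.2)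

theorem finite_ratios (i j : ℕ) : (ratios Φ Δ G i j).Finite := by
  refine ((finite_fund (Δ := Δ) (G := G)).image2
    (fun A B => maxCoeff Φ Δ A / minCoeff Φ Δ B) (finite_fund (Δ := Δ) (G := G))).subset ?_
  rintro r ⟨A, hA, B, hB, -, -, -, rfl⟩
  exact ⟨A, hA, B, hB, rfl⟩

theorem coef_le_ratio_mul (hΦ : IsRootSystem Φ) (hΔ : IsSimpleSystem Φ Δ)
    {A C : Finset (Fin n)} (hCA : C ⊆ A) {i : Fin n} (hi : i ∈ C) :
    coef Φ Δ A i ≤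
      maxCoeff Φ Δ (simpleSpan Δ A) / minCoeff Φ Δ (simpleSpan Δ C) * coef Φ Δ C i := by
  have h1 := coef_le_maxCoeff hΦ hΔ (hCA hi)
  have h2 := minCoeff_le_coef hΦ hΔ hi
  have h3 := minCoeff_pos hΦ hΔ ⟨i, hi⟩
  have h4 := (coef_pos (Φ := Φ) hΔ (hCA hi)).trans_le h1
  rw [div_mul_eq_mul_div, le_div_iff₀ h3]
  exact mul_le_mul h1 h2 h3.le h4.le

theorem coef_le_R_mul (hΦ : IsRootSystem Φ) (hΔ : IsSimpleSystem Φ Δ)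
    {A C : Finset (Fin n)} (hA : A ∈ fundFamily Δ G) (hC : C ∈ fundFamily Δ G) (hCA : C ⊂ A)
    {i : Fin n} (hi : i ∈ C) : coef Φ Δ A i ≤ R Φ Δ G A.card C.card * coef Φ Δ C i := by
  have hmem : maxCoeff Φ Δ (simpleSpan Δ A) / minCoeff Φ Δ (simpleSpan Δ C) ∈
      ratios Φ Δ G A.card C.card :=
    ⟨_, simpleSpan_mem_fund.2 hA, _, simpleSpan_mem_fund.2 hC,
      lt_of_le_not_ge (simpleSpan_le_simpleSpan.2 hCA.subset)
        fun h => hCA.not_subset (simpleSpan_le_simpleSpan.1 h),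
      finrank_simpleSpan A, finrank_simpleSpan C, rfl⟩
  refine (coef_le_ratio_mul hΦ hΔ hCA.subset hi).trans
    (mul_le_mul_of_nonneg_right ?_ (coef_nonneg C i))
  rw [R, if_pos ⟨_, hmem⟩]
  exact le_csSup (finite_ratios _ _).bddAbove hmem

/-- Coefficients of half sums grow with the set, so each ratio is at least 1, as is the default
value; suitable lists therefore at least double at each step. -/
theorem one_le_R (hΦ : IsRootSystem Φ) (hΔ : IsSimpleSystem Φ Δ) (hG : IsBuildingSet Φ G)
    (i j : ℕ) : 1 ≤ R Φ Δ G i j := by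
  rw [R]
  split_ifs with h
  · obtain ⟨r, hr⟩ := h
    refine le_trans ?_ (le_csSup (finite_ratios _ _).bddAbove hr)
    obtain ⟨A, hA, C, hC, hCA, -, -, rfl⟩ := hr
    obtain ⟨I, hI, rfl⟩ := exists_of_mem_fund hA
    obtain ⟨J, hJ, rfl⟩ := exists_of_mem_fund hC
    have hJI := simpleSpan_le_simpleSpan.1 hCA.le
    obtain ⟨k, hk⟩ := hG.nonempty_of_mem hΦ hJ
    have h1 := (coef_mono (Φ := Φ) (Δ := Δ) hJI k).trans (coef_le_ratio_mul hΦ hΔ hJI hk)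
    exact le_of_mul_le_mul_right (by rwa [one_mul]) (coef_pos (Φ := Φ) hΔ hk)
  · exact le_rfl

theorem IsSuitable.two_mul_lt (hΦ : IsRootSystem Φ) (hΔ : IsSimpleSystem Φ Δ)
    (hG : IsBuildingSet Φ G) (hε : IsSuitable Φ Δ G ε) {k : ℕ} (hk : 1 ≤ k) (hkn : k + 1 ≤ n) :
    2 * ε k < ε (k + 1) := by
  have h1 := hε.suitable k hk hkn
  have h2 := mul_le_mul_of_nonneg_right (one_le_R hΦ hΔ hG (k + 1) k)
    (hε.pos k hk (by omega)).le
  linarith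

theorem IsSuitable.two_pow_mul_lt (hΦ : IsRootSystem Φ) (hΔ : IsSimpleSystem Φ Δ)
    (hG : IsBuildingSet Φ G) (hε : IsSuitable Φ Δ G ε) {k m : ℕ} (hk : 1 ≤ k) (hkm : k < m)
    (hmn : m ≤ n) : 2 ^ m * ε k < 2 ^ k * ε m := by
  induction m, hkm using Nat.le_induction with
  | base =>
    have h1 := hε.two_mul_lt hΦ hΔ hG hk hmn
    have h2 : (0 : ℝ) < 2 ^ k := by positivity
    rw [Nat.succ_eq_add_one, pow_succ, mul_assoc]
    exact mul_lt_mul_of_pos_left h1 h2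
  | succ m hm ih =>
    have h1 := ih (by omega)
    have h2 := hε.two_mul_lt hΦ hΔ hG (hk.trans (Nat.le_of_succ_le hm)) hmn
    have h3 : (0 : ℝ) < 2 ^ k := by positivity
    have h4 := mul_lt_mul_of_pos_left h2 h3
    rw [pow_succ]
    linarith

theorem IsSuitable.step (hΦ : IsRootSystem Φ) (hΔ : IsSimpleSystem Φ Δ)
    (hε : IsSuitable Φ Δ G ε) {A C : Finset (Fin n)}
    (hA : A ∈ fundFamily Δ G) (hC : C ∈ fundFamily Δ G) (hCA : C ⊂ A)
    (hcard : A.card = C.card + 1) {i : Fin n} (hi : i ∈ C) :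
    coef Φ Δ A i * (2 ^ A.card * ε C.card) < coef Φ Δ C i * (2 ^ C.card * ε A.card) := by
  have h1 := coef_le_R_mul hΦ hΔ hA hC hCA hi
  have hn : A.card ≤ n := by simpa using Finset.card_le_univ A
  have hC1 : 1 ≤ C.card := Finset.card_pos.2 ⟨i, hi⟩
  have hpos := hε.pos C.card hC1 (by omega)
  have h2 := hε.suitable C.card hC1 (by omega)
  rw [hcard] at h1 ⊢
  have h3 := mul_le_mul_of_nonneg_right h1
    (mul_nonneg (by positivity) hpos.le : 0 ≤ (2 : ℝ) ^ (C.card + 1) * ε C.card)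
  have h4 := mul_lt_mul_of_pos_left h2
    (mul_pos (coef_pos (Φ := Φ) hΔ hi) (by positivity : (0 : ℝ) < 2 ^ C.card))
  rw [pow_succ] at h3 ⊢
  linarith

theorem IsSuitable.isDominated (hΦ : IsRootSystem Φ) (hΔ : IsSimpleSystem Φ Δ)
    (hG : IsBuildingSet Φ G) (hV : ⊤ ∈ G) (hε : IsSuitable Φ Δ G ε) :
    IsDominated (fundFamily Δ G) (coef Φ Δ) ε := by
  have hpos : ∀ A ∈ fundFamily Δ G, 0 < ε A.card := fun A hA =>
    hε.pos _ (Finset.card_pos.2 (hG.nonempty_of_mem hΦ hA)) (by simpa using Finset.card_le_univ A)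
  refine ⟨fun A _ i hi => coef_pos hΔ hi, hpos, fun A hA C hC hCA => ?_⟩
  induction hN : A.card - C.card using Nat.strong_induction_on generalizing C with
  | _ N ih =>
    intro i hi
    have hlt := Finset.card_lt_card hCA
    -- Suitability compares consecutive dimensions only. An adjacent simple root enlarges `C` within
    -- the family by one dimension; without one, `C` is orthogonal to the rest of `A`, the
    -- coefficients agree, and doubling suffices.
    by_cases hadj : ∃ j ∈ A, j ∉ C ∧ ∃ k ∈ C, ⟪Δ k, Δ j⟫_ℝ ≠ 0
    · obtain ⟨j, hjA, hjC, k, hk, hkj⟩ := hadj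
      have hJ := hG.insert_mem hΦ hΔ hV hC hk hkj
      have hcard := Finset.card_insert_of_notMem hjC
      have h1 := hε.step hΦ hΔ hJ hC (Finset.ssubset_insert hjC) hcard hi
      rcases (Finset.insert_subset hjA hCA.subset).eq_or_ssubset with h | h
      · rwa [h] at h1
      · have h2 := ih (A.card - (insert j C).card) (by omega) _ hJ h rfl i
          (Finset.mem_insert_of_mem hi)
        have hJ0 := hpos _ hJ
        have hC0 := hpos _ hC
        have hA0 := hpos _ hA
        have h3 := mul_lt_mul_of_pos_right h2 hC0
        have h4 := mul_lt_mul_of_pos_right h1 hA0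
        have h5 : (2 : ℝ) ^ (insert j C).card * (coef Φ Δ (insert j C) i * (ε A.card * ε C.card)) <
            coef Φ Δ C i * (2 ^ C.card * ε A.card) * ε (insert j C).card := by
          linarith
        refine lt_of_mul_lt_mul_right (lt_trans ?_ h5) hJ0.le
        linarith
    · push Not at hadj
      rw [coef_eq_of_orthogonal hΦ hΔ hCA.subset hadj hi]
      refine mul_lt_mul_of_pos_left ?_ (coef_pos hΔ hi)
      exact hε.two_pow_mul_lt hΦ hΔ hG (Finset.card_pos.2 ⟨i, hi⟩) hlt
        (by simpa using Finset.card_le_univ A)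

end BuildingSet

/-! ### Counting the unions of parts of a maximal nested set -/

section Count

variable {ι : Type*} [Fintype ι] [DecidableEq ι] {B : Set (Finset ι)} {S : Finset (Finset ι)}

/-- The proper subsets whose components lie in `S`. -/
def activeSets (B : Set (Finset ι)) (S : Finset (Finset ι)) : Finset (Finset ι) :=
  {I | I ≠ Finset.univ ∧ components B I ⊆ S}

theorem mem_activeSets {I : Finset ι} :
    I ∈ activeSets B S ↔ I ≠ Finset.univ ∧ components B I ⊆ S := by simp [activeSets]

theorem insert_empty_erase_univ_subset (hB : IsBuildingFamily B) (hS : Maximal (Nested B) S) :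
    insert ∅ (S.erase Finset.univ) ⊆ activeSets B S := by
  intro I hI
  rw [mem_activeSets]
  rcases Finset.mem_insert.1 hI with rfl | hI
  · exact ⟨fun h => (hB.nonempty _ hB.univ_mem).ne_empty h.symm, by simp [hB.components_empty]⟩
  · rw [Finset.mem_erase] at hI
    rw [components_of_mem (hS.prop.1 hI.2)]
    exact ⟨hI.1, Finset.singleton_subset_iff.2 hI.2⟩

theorem card_insert_empty_erase_univ (hB : IsBuildingFamily B) (hS : Maximal (Nested B) S) :
    (insert ∅ (S.erase Finset.univ)).card = Fintype.card ι := by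
  have h0 : ∅ ∉ S.erase Finset.univ := fun h =>
    (hB.nonempty _ (hS.prop.1 (Finset.mem_of_mem_erase h))).ne_empty rfl
  have h1 := univ_mem_of_maximal hB hS
  rw [Finset.card_insert_of_notMem h0, Finset.card_erase_add_one h1, card_eq_of_maximal hB hS]

/-- The empty set and the members of `S` other than the whole set already give the right number. The
union of two incomparable members is a further active set, while in a chain an active set has at
most one component. -/
theorem card_activeSets_eq_iff (hB : IsBuildingFamily B) (hS : Maximal (Nested B) S) :
    (activeSets B S).card = Fintype.card ι ↔ ∀ A ∈ S, ∀ C ∈ S, A ⊆ C ∨ C ⊆ A := by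
  rw [← card_insert_empty_erase_univ hB hS]
  constructor
  · intro h A hA C hC
    by_contra hcon
    push Not at hcon
    have heq := Finset.eq_of_subset_of_card_le (insert_empty_erase_univ_subset hB hS) h.le
    have hun := hS.prop.union_notMem hA hC hcon.1 hcon.2
    have hmem : A ∪ C ∈ activeSets B S := by
      rw [mem_activeSets, hS.prop.components_union hB hA hC hcon.1 hcon.2]
      exact ⟨fun h => hun (h ▸ hB.univ_mem), Finset.insert_subset hA
        (Finset.singleton_subset_iff.2 hC)⟩
    rw [← heq, Finset.mem_insert] at hmem
    rcases hmem with h | h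
    · obtain ⟨i, hi⟩ := hB.nonempty A (hS.prop.1 hA)
      exact Finset.notMem_empty i (h ▸ Finset.mem_union_left C hi)
    · exact hun (hS.prop.1 (Finset.mem_of_mem_erase h))
  · intro h
    congr 1
    refine (Finset.Subset.antisymm (insert_empty_erase_univ_subset hB hS) fun I hI => ?_).symm
    obtain ⟨hIu, hIS⟩ := mem_activeSets.1 hI
    rcases I.eq_empty_or_nonempty with rfl | ⟨i, hi⟩
    · exact Finset.mem_insert_self _ _
    · obtain ⟨A, hA, -⟩ := hB.exists_mem_component hi
      have hAI : components B I = {A} := by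
        refine Finset.eq_singleton_iff_unique_mem.2 ⟨hA, fun C hC => ?_⟩
        rcases h A (hIS hA) C (hIS hC) with hAC | hCA
        · exact ((mem_components.1 hA).eq_of_le (mem_components.1 hC).prop hAC).symm
        · exact (mem_components.1 hC).eq_of_le (mem_components.1 hA).prop hCA
      have : I = A := hB.components_injective (hAI.trans
        (components_of_mem (mem_of_mem_components hA)).symm)
      rw [Finset.mem_insert, Finset.mem_erase]
      exact Or.inr ⟨hIu, this ▸ hIS hA⟩

end Count

/-! ### The permutonestohedron as a polyhedron -/

section Permutonestohedron

variable {V : Type*} [NormedAddCommGroup V] [InnerProductSpace ℝ V] [FiniteDimensional ℝ V]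
variable {n : ℕ} {Φ : Finset V} {Δ : Module.Basis (Fin n) ℝ V} {G : Set (Submodule ℝ V)}
  {ε : ℕ → ℝ}

theorem sSup_image_simpleSpan (T : Finset (Finset (Fin n))) :
    sSup (simpleSpan Δ '' T) = simpleSpan Δ (T.sup id) := by
  refine le_antisymm (sSup_le ?_) (simpleSpan_le_iff.2 fun i hi => ?_)
  · rintro _ ⟨I, hI, rfl⟩
    exact simpleSpan_le_simpleSpan.2 (Finset.le_sup (f := id) hI)
  · obtain ⟨I, hI, hiI⟩ := Finset.mem_sup.1 hi
    exact (le_sSup (Set.mem_image_of_mem (simpleSpan Δ) hI) :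
      simpleSpan Δ I ≤ sSup (simpleSpan Δ '' T)) (simple_mem_simpleSpan.2 hiI)

theorem isNested_image_iff {S : Finset (Finset (Fin n))} :
    IsNested (fund Δ G) (simpleSpan Δ '' S) ↔ Nested (fundFamily Δ G) S := by
  classical
  constructor
  · rintro ⟨h1, h2⟩
    refine ⟨fun A hA => (h1 (Set.mem_image_of_mem _ hA)).1, fun T hT hnt hanti hsup => ?_⟩
    refine h2 (simpleSpan Δ '' T) (Set.image_mono hT) ?_ ?_ ?_
    · exact (Finset.nontrivial_coe.2 hnt).image simpleSpan_injective
    · rintro _ ⟨A, hA, rfl⟩ _ ⟨C, hC, rfl⟩ hne hle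
      exact hanti hA hC (fun h => hne (h ▸ rfl)) (simpleSpan_le_simpleSpan.1 hle)
    · rw [sSup_image_simpleSpan]
      exact simpleSpan_mem_fund.2 hsup
  · rintro ⟨h1, h2⟩
    refine ⟨?_, fun T hT hnt hanti hsup => ?_⟩
    · rintro _ ⟨A, hA, rfl⟩
      exact simpleSpan_mem_fund.2 (h1 hA)
    · set T' : Finset (Finset (Fin n)) := {A ∈ S | simpleSpan Δ A ∈ T} with hT'
      have hTT' : T = simpleSpan Δ '' T' := by
        ext X
        constructor
        · intro hX
          obtain ⟨A, hA, rfl⟩ := hT hX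
          exact ⟨A, by simpa [hT'] using ⟨hA, hX⟩, rfl⟩
        · rintro ⟨A, hA, rfl⟩
          exact (by simpa [hT'] using hA : A ∈ S ∧ simpleSpan Δ A ∈ T).2
      refine h2 T' (Finset.filter_subset _ _) ?_ ?_ ?_
      · rw [← Finset.nontrivial_coe]
        exact Set.nontrivial_of_image _ _ (hTT' ▸ hnt)
      · intro A hA C hC hne hle
        have hm : ∀ {X}, X ∈ (T' : Set (Finset (Fin n))) → simpleSpan Δ X ∈ T := fun hX =>
          hTT' ▸ Set.mem_image_of_mem _ hX
        exact hanti (hm hA) (hm hC) (fun h => hne (simpleSpan_injective h))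
          (simpleSpan_le_simpleSpan.2 hle)
      · rw [hTT', sSup_image_simpleSpan] at hsup
        exact hsup.1

theorem exists_finset_of_subset_fund {S : Set (Submodule ℝ V)} (hS : S ⊆ fund Δ G) :
    ∃ T : Finset (Finset (Fin n)), S = simpleSpan Δ '' T := by
  classical
  refine ⟨({I | simpleSpan Δ I ∈ S} : Finset _), Set.ext fun A => ⟨fun hA => ?_, ?_⟩⟩
  · obtain ⟨I, -, rfl⟩ := exists_of_mem_fund (hS hA)
    exact ⟨I, by simpa using hA, rfl⟩
  · rintro ⟨I, hI, rfl⟩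
    simpa using hI

theorem isMaximalNested_image_iff {S : Finset (Finset (Fin n))} :
    IsMaximalNested (fund Δ G) (simpleSpan Δ '' S) ↔ Maximal (Nested (fundFamily Δ G)) S := by
  have hle : ∀ {S T : Finset (Finset (Fin n))},
      simpleSpan Δ '' (S : Set (Finset (Fin n))) ≤ simpleSpan Δ '' T ↔ S ≤ T := fun {S T} => by
    exact (Set.image_subset_image_iff simpleSpan_injective).trans Finset.coe_subset
  constructor
  · intro h
    exact ⟨isNested_image_iff.1 h.prop, fun T hT hST =>
      hle.1 (h.2 (isNested_image_iff.2 hT) (hle.2 hST))⟩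
  · intro h
    refine ⟨isNested_image_iff.2 h.prop, fun T hT hST => ?_⟩
    obtain ⟨T, rfl⟩ := exists_finset_of_subset_fund hT.1
    exact hle.2 (h.2 (isNested_image_iff.1 hT) (hle.1 hST))

theorem decomposition_fund (I : Finset (Fin n)) :
    decomposition (fund Δ G) (simpleSpan Δ I) =
      simpleSpan Δ '' (components (fundFamily Δ G) I) := by
  ext A
  rw [mem_decomposition]
  constructor
  · intro hA
    obtain ⟨J, hJ, rfl⟩ := exists_of_mem_fund hA.prop.1
    refine ⟨J, mem_components.2 ⟨⟨hJ, simpleSpan_le_simpleSpan.1 hA.prop.2⟩, fun K hK hJK => ?_⟩,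
      rfl⟩
    exact simpleSpan_le_simpleSpan.1 (hA.2 ⟨simpleSpan_mem_fund.2 hK.1,
      simpleSpan_le_simpleSpan.2 hK.2⟩ (simpleSpan_le_simpleSpan.2 hJK))
  · rintro ⟨J, hJ, rfl⟩
    have hJ' := mem_components.1 hJ
    refine ⟨⟨simpleSpan_mem_fund.2 hJ'.prop.1, simpleSpan_le_simpleSpan.2 hJ'.prop.2⟩,
      fun X hX hJX => ?_⟩
    obtain ⟨K, hK, rfl⟩ := exists_of_mem_fund hX.1
    exact simpleSpan_le_simpleSpan.2 (hJ'.2 ⟨hK, simpleSpan_le_simpleSpan.1 hX.2⟩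
      (simpleSpan_le_simpleSpan.1 hJX))

/-- The normal vector of the inequality of `P` attached to `I`. -/
def normalVec (Φ : Finset V) (Δ : Module.Basis (Fin n) ℝ V) (G : Set (Submodule ℝ V))
    (I : Finset (Fin n)) : V :=
  delta Φ Δ - ∑ A ∈ components (fundFamily Δ G) I, halfSum Φ Δ A

/-- The bound of the inequality of `P` attached to `I`. -/
def bound (Δ : Module.Basis (Fin n) ℝ V) (G : Set (Submodule ℝ V)) (ε : ℕ → ℝ)
    (I : Finset (Fin n)) : ℝ :=
  ε n - ∑ A ∈ components (fundFamily Δ G) I, ε A.card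

/-- The inequalities of the permutonestohedron. -/
def inequalities (Φ : Finset V) (Δ : Module.Basis (Fin n) ℝ V) (G : Set (Submodule ℝ V))
    (ε : ℕ → ℝ) : Set (V × ℝ) :=
  {p | ∃ σ ∈ weylGroup Φ, ∃ I : Finset (Fin n), I ≠ Finset.univ ∧
    p = (σ (normalVec Φ Δ G I), bound Δ G ε I)}

theorem normalVec_of_mem {A : Finset (Fin n)} (hA : A ∈ fundFamily Δ G) :
    normalVec Φ Δ G A = delta Φ Δ - halfSum Φ Δ A := by
  rw [normalVec, components_of_mem hA, Finset.sum_singleton]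

theorem bound_of_mem {A : Finset (Fin n)} (hA : A ∈ fundFamily Δ G) :
    bound Δ G ε A = ε n - ε A.card := by
  rw [bound, components_of_mem hA, Finset.sum_singleton]

theorem inner_normalVec (x : V) (I : Finset (Fin n)) : ⟪x, normalVec Φ Δ G I⟫_ℝ =
    ⟪x, delta Φ Δ⟫_ℝ - ∑ A ∈ components (fundFamily Δ G) I, ⟪x, halfSum Φ Δ A⟫_ℝ := by
  rw [normalVec, inner_sub_right, inner_sum]

theorem finite_inequalities (hΦ : IsRootSystem Φ) (hΔ : IsSimpleSystem Φ Δ) :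
    (inequalities Φ Δ G ε).Finite := by
  refine ((finite_weylGroup hΦ hΔ).image2 (fun σ I => (σ (normalVec Φ Δ G I), bound Δ G ε I))
    (Set.toFinite (Set.univ : Set (Finset (Fin n))))).subset ?_
  rintro p ⟨σ, hσ, I, -, rfl⟩
  exact ⟨σ, hσ, I, Set.mem_univ _, rfl⟩

theorem halfSpaceBar_simpleSpan (hΦ : IsRootSystem Φ) (hΔ : IsSimpleSystem Φ Δ)
    (I : Finset (Fin n)) : halfSpaceBar Φ Δ G ε (simpleSpan Δ I) =
      {x | ⟪x, normalVec Φ Δ G I⟫_ℝ ≤ bound Δ G ε I} := by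
  rw [halfSpaceBar, decomposition_fund, finsum_mem_image simpleSpan_injective.injOn,
    finsum_mem_image simpleSpan_injective.injOn, finsum_mem_coe_finset, finsum_mem_coe_finset,
    normalVec, bound]
  simp only [piVec_simpleSpan hΦ hΔ, finrank_simpleSpan]

theorem deltaVec_simpleSpan (hΦ : IsRootSystem Φ) (hΔ : IsSimpleSystem Φ Δ)
    {A : Finset (Fin n)} (hA : A ∈ fundFamily Δ G) (hne : A ≠ Finset.univ) :
    deltaVec Φ Δ (simpleSpan Δ A) = normalVec Φ Δ G A := by
  have htop : simpleSpan Δ A ≠ ⊤ := fun h =>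
    hne (simpleSpan_injective (h.trans simpleSpan_univ.symm))
  rw [deltaVec, if_neg htop, normalVec_of_mem hA, ← piVec_simpleSpan hΦ hΔ, piVec,
    Submodule.starProjection_orthogonal_val]

theorem level_simpleSpan {A : Finset (Fin n)} (hA : A ∈ fundFamily Δ G)
    (hne : A ≠ Finset.univ) : level (n := n) ε (simpleSpan Δ A) = bound Δ G ε A := by
  have htop : simpleSpan Δ A ≠ ⊤ := fun h =>
    hne (simpleSpan_injective (h.trans simpleSpan_univ.symm))
  rw [level, if_neg htop, bound_of_mem hA, finrank_simpleSpan]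

theorem IsBuildingFamily.normalVec_empty (hB : IsBuildingFamily (fundFamily Δ G)) :
    normalVec Φ Δ G ∅ = delta Φ Δ := by
  rw [normalVec, hB.components_empty, Finset.sum_empty, sub_zero]

theorem IsBuildingFamily.bound_empty (hB : IsBuildingFamily (fundFamily Δ G)) :
    bound Δ G ε ∅ = ε n := by
  rw [bound, hB.components_empty, Finset.sum_empty, sub_zero]

theorem halfSpace_simpleSpan (hΦ : IsRootSystem Φ) (hΔ : IsSimpleSystem Φ Δ)
    {A : Finset (Fin n)} (hA : A ∈ fundFamily Δ G) (hne : A ≠ Finset.univ) :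
    halfSpace Φ Δ ε (simpleSpan Δ A) = {x | ⟪x, normalVec Φ Δ G A⟫_ℝ ≤ bound Δ G ε A} := by
  rw [halfSpace, deltaVec_simpleSpan hΦ hΔ hA hne, level_simpleSpan hA hne]

theorem halfSpace_top : halfSpace Φ Δ ε ⊤ = {x | ⟪x, delta Φ Δ⟫_ℝ ≤ ε n} := by
  rw [halfSpace, deltaVec, if_pos rfl, level, if_pos rfl]

theorem hyperplane_top : hyperplane Φ Δ ε ⊤ = {x | ⟪x, delta Φ Δ⟫_ℝ = ε n} := by
  rw [hyperplane, deltaVec, if_pos rfl, level, if_pos rfl]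

theorem hyperplane_simpleSpan (hΦ : IsRootSystem Φ) (hΔ : IsSimpleSystem Φ Δ)
    {A : Finset (Fin n)} (hA : A ∈ fundFamily Δ G) (hne : A ≠ Finset.univ) :
    hyperplane Φ Δ ε (simpleSpan Δ A) = {x | ⟪x, normalVec Φ Δ G A⟫_ℝ = bound Δ G ε A} := by
  rw [hyperplane, deltaVec_simpleSpan hΦ hΔ hA hne, level_simpleSpan hA hne]

theorem mem_image_setOf_inner_le (σ : V ≃ₗᵢ[ℝ] V) (d x : V) (c : ℝ) :
    x ∈ σ '' {y | ⟪y, d⟫_ℝ ≤ c} ↔ ⟪x, σ d⟫_ℝ ≤ c := by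
  constructor
  · rintro ⟨y, hy, rfl⟩
    rw [σ.inner_map_map]
    exact hy
  · intro h
    refine ⟨σ⁻¹ x, ?_, apply_inv_apply σ x⟩
    change ⟪σ⁻¹ x, d⟫_ℝ ≤ c
    rwa [← σ.inner_map_map, apply_inv_apply]

/-- The index ∅ plays the role of V: its inequality is the one of HS_V, which is why `inequalities`
omits the full set but keeps the empty one. -/
theorem permutonestohedron_eq (hΦ : IsRootSystem Φ) (hΔ : IsSimpleSystem Φ Δ)
    (hG : IsBuildingSet Φ G) (hV : ⊤ ∈ G) :
    permutonestohedron Φ Δ G ε = polyhedron (inequalities Φ Δ G ε) := by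
  have hB := hG.isBuildingFamily hΦ hΔ hV
  ext x
  simp only [permutonestohedron, Set.mem_iInter, Set.mem_inter_iff]
  constructor
  · rintro h _ ⟨σ, hσ, I, hI, rfl⟩
    rw [← mem_image_setOf_inner_le]
    rcases I.eq_empty_or_nonempty with rfl | hne
    · rw [hB.normalVec_empty, hB.bound_empty, ← halfSpace_top]
      refine (h σ hσ).1 ⊤ ?_
      rw [← simpleSpan_univ (Δ := Δ)]
      exact simpleSpan_mem_fund.2 hB.univ_mem
    · by_cases hIG : I ∈ fundFamily Δ G
      · rw [← halfSpace_simpleSpan hΦ hΔ hIG hI]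
        exact (h σ hσ).1 _ (simpleSpan_mem_fund.2 hIG)
      · rw [← halfSpaceBar_simpleSpan hΦ hΔ]
        exact (h σ hσ).2 _ ⟨mem_fund_rootSubspaces hΔ hne, fun h => hIG h.1⟩
  · intro h σ hσ
    refine ⟨fun A hA => ?_, fun A hA => ?_⟩
    · obtain ⟨I, hI, rfl⟩ := exists_of_mem_fund hA
      by_cases hIu : I = Finset.univ
      · rw [hIu, simpleSpan_univ, halfSpace_top, mem_image_setOf_inner_le, ← hB.normalVec_empty,
          ← hB.bound_empty (ε := ε)]
        exact h _ ⟨σ, hσ, ∅, fun h => (hB.nonempty _ hB.univ_mem).ne_empty h.symm, rfl⟩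
      · rw [halfSpace_simpleSpan hΦ hΔ hI hIu, mem_image_setOf_inner_le]
        exact h _ ⟨σ, hσ, I, hIu, rfl⟩
    · obtain ⟨I, rfl⟩ := exists_eq_simpleSpan hA.1.2
      have hIG : I ∉ fundFamily Δ G := fun h => hA.2 (simpleSpan_mem_fund.2 h)
      rw [halfSpaceBar_simpleSpan hΦ hΔ, mem_image_setOf_inner_le]
      exact h _ ⟨σ, hσ, I, fun h => hIG (h ▸ hB.univ_mem), rfl⟩

/-! #### The normal vectors are dominant -/

theorem inner_halfSum_simple_nonpos (hΦ : IsRootSystem Φ) (hΔ : IsSimpleSystem Φ Δ)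
    {A : Finset (Fin n)} {i : Fin n} (hi : i ∉ A) : ⟪halfSum Φ Δ A, Δ i⟫_ℝ ≤ 0 := by
  rw [halfSum_eq_sum, sum_inner]
  refine Finset.sum_nonpos fun j hj => ?_
  rw [inner_smul_left]
  exact mul_nonpos_of_nonneg_of_nonpos (coef_nonneg A j)
    (inner_simple_nonpos hΦ hΔ fun h => hi (h ▸ hj))

theorem inner_normalVec_simple_pos (hΦ : IsRootSystem Φ) (hΔ : IsSimpleSystem Φ Δ)
    {I : Finset (Fin n)} {i : Fin n} (hi : i ∉ I) : 0 < ⟪normalVec Φ Δ G I, Δ i⟫_ℝ := by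
  rw [normalVec, inner_sub_left, sum_inner]
  have h1 := inner_delta_simple_pos hΦ hΔ i
  have h2 : ∑ A ∈ components (fundFamily Δ G) I, ⟪halfSum Φ Δ A, Δ i⟫_ℝ ≤ 0 :=
    Finset.sum_nonpos fun A hA =>
      inner_halfSum_simple_nonpos hΦ hΔ fun h => hi (subset_of_mem_components hA h)
  linarith

/-- The component containing i cancels δ. Another component not orthogonal to `Δ i` could be
enlarged by i inside `I`, and would then meet the first component. -/
theorem inner_normalVec_simple_eq_zero (hΦ : IsRootSystem Φ) (hΔ : IsSimpleSystem Φ Δ)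
    (hG : IsBuildingSet Φ G) (hV : ⊤ ∈ G) {I : Finset (Fin n)} {i : Fin n} (hi : i ∈ I) :
    ⟪normalVec Φ Δ G I, Δ i⟫_ℝ = 0 := by
  have hB := hG.isBuildingFamily hΦ hΔ hV
  obtain ⟨A, hA, hiA⟩ := hB.exists_mem_component hi
  have h1 := inner_delta_sub_halfSum hΦ hΔ hiA
  rw [inner_sub_left] at h1
  rw [normalVec, inner_sub_left, sum_inner, Finset.sum_eq_single_of_mem A hA, h1]
  intro C hC hCA
  rw [halfSum_eq_sum, sum_inner]
  refine Finset.sum_eq_zero fun j hj => ?_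
  rw [inner_smul_left]
  refine mul_eq_zero_of_right _ ?_
  by_contra h
  have h2 := hG.insert_mem hΦ hΔ hV (mem_of_mem_components hC) hj h
  have h3 := hB.subset_component h2 (Finset.insert_subset hi (subset_of_mem_components hC)) hA
    (Finset.mem_insert_self i C) hiA
  exact hCA (hB.eq_of_mem_components hC hA hj (h3 (Finset.mem_insert_of_mem hj)))

theorem inner_normalVec_simple_nonneg (hΦ : IsRootSystem Φ) (hΔ : IsSimpleSystem Φ Δ)
    (hG : IsBuildingSet Φ G) (hV : ⊤ ∈ G) (I : Finset (Fin n)) (i : Fin n) :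
    0 ≤ ⟪normalVec Φ Δ G I, Δ i⟫_ℝ := by
  by_cases hi : i ∈ I
  · exact (inner_normalVec_simple_eq_zero hΦ hΔ hG hV hi).ge
  · exact (inner_normalVec_simple_pos hΦ hΔ hi).le

/-- `I` is recovered as the set of simple roots orthogonal to its normal vector. -/
theorem normalVec_injective (hΦ : IsRootSystem Φ) (hΔ : IsSimpleSystem Φ Δ)
    (hG : IsBuildingSet Φ G) (hV : ⊤ ∈ G) : Function.Injective (normalVec Φ Δ G) := by
  intro I J h
  ext i
  by_contra hc
  by_cases hi : i ∈ I
  · have hj : i ∉ J := fun hj => hc ⟨fun _ => hj, fun _ => hi⟩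
    have h1 := inner_normalVec_simple_pos (G := G) hΦ hΔ hj
    rw [← h, inner_normalVec_simple_eq_zero hΦ hΔ hG hV hi] at h1
    exact lt_irrefl _ h1
  · have hj : i ∈ J := by
      by_contra hj
      exact hc ⟨fun h => absurd h hi, fun h => absurd h hj⟩
    have h1 := inner_normalVec_simple_pos (G := G) hΦ hΔ hi
    rw [h, inner_normalVec_simple_eq_zero hΦ hΔ hG hV hj] at h1
    exact lt_irrefl _ h1

/-- The inequalities that are equalities at a strictly dominant point are those of the
fundamental chamber. -/
theorem active_eq_image_of_pos (hΦ : IsRootSystem Φ) (hΔ : IsSimpleSystem Φ Δ)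
    (hG : IsBuildingSet Φ G) (hV : ⊤ ∈ G) {v : V} (hv : v ∈ polyhedron (inequalities Φ Δ G ε))
    (hpos : ∀ i, 0 < ⟪v, Δ i⟫_ℝ) : active (inequalities Φ Δ G ε) v =
      (fun I => (normalVec Φ Δ G I, bound Δ G ε I)) ''
        {I | I ≠ Finset.univ ∧ ⟪v, normalVec Φ Δ G I⟫_ℝ = bound Δ G ε I} := by
  ext p
  constructor
  · rintro ⟨⟨σ, hσ, I, hI, rfl⟩, heq⟩
    have hdom := inner_normalVec_simple_nonneg hΦ hΔ hG hV I
    have h1 := hv _ ⟨1, one_mem _, I, hI, rfl⟩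
    have h2 := inner_apply_le hΦ hΔ hdom (fun i => (hpos i).le) hσ
    have h3 : ⟪v, normalVec Φ Δ G I⟫_ℝ = bound Δ G ε I :=
      le_antisymm h1 (heq.ge.trans h2)
    -- Equality in the dominance estimate kills every coefficient of the difference, since `v` pairs
    -- strictly positively with all simple roots.
    have h4 : normalVec Φ Δ G I - σ (normalVec Φ Δ G I) = 0 := by
      refine Δ.repr.injective (Finsupp.ext fun i => ?_)
      rw [repr_sub_apply_eq_zero hΦ hΔ hdom (fun i => (hpos i).le) hσ (heq.trans h3.symm) (hpos i)]
      simp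
    exact ⟨I, ⟨hI, h3⟩, by rw [← sub_eq_zero.1 h4]⟩
  · rintro ⟨I, ⟨hI, h⟩, rfl⟩
    exact ⟨⟨1, one_mem _, I, hI, rfl⟩, h⟩

theorem zero_lt_bound (hΦ : IsRootSystem Φ) (hΔ : IsSimpleSystem Φ Δ)
    (hG : IsBuildingSet Φ G) (hV : ⊤ ∈ G) (hε : IsSuitable Φ Δ G ε) {I : Finset (Fin n)}
    (hI : I ≠ Finset.univ) : 0 < bound Δ G ε I := by
  have hB := hG.isBuildingFamily hΦ hΔ hV
  have h := (hε.isDominated hΦ hΔ hG hV).sum_components_lt hB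
    (fun A C hCA i => coef_mono hCA i) hB.univ_mem
    (Finset.ssubset_univ_iff.2 hI)
  rw [Finset.card_univ, Fintype.card_fin] at h
  exact sub_pos.2 h

theorem inner_zero_lt (hΦ : IsRootSystem Φ) (hΔ : IsSimpleSystem Φ Δ)
    (hG : IsBuildingSet Φ G) (hV : ⊤ ∈ G) (hε : IsSuitable Φ Δ G ε) :
    ∀ p ∈ inequalities Φ Δ G ε, ⟪(0 : V), p.1⟫_ℝ < p.2 := by
  rintro _ ⟨σ, -, I, hI, rfl⟩
  rw [inner_zero_left]
  exact zero_lt_bound hΦ hΔ hG hV hε hI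

theorem finrank_eq (Δ : Module.Basis (Fin n) ℝ V) : Module.finrank ℝ V = n := by
  rw [Module.finrank_eq_card_basis Δ, Fintype.card_fin]

theorem eq_zero_of_forall_inner_simple (u : V) (h : ∀ i, ⟪u, Δ i⟫_ℝ = 0) : u = 0 :=
  InnerProductSpace.ext_inner_right_basis Δ fun i => by rw [h i, inner_zero_left]

/-- For the dominant translate, (σ x, δ) ≤ ε_n and the coefficients of δ are at least 1/2, so each
coordinate is at most 2 ε_n; σ preserves the norm. -/
theorem isBounded_permutonestohedron (hΦ : IsRootSystem Φ) (hΔ : IsSimpleSystem Φ Δ)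
    (hG : IsBuildingSet Φ G) (hV : ⊤ ∈ G) :
    Bornology.IsBounded (polyhedron (inequalities Φ Δ G ε)) := by
  have hB := hG.isBuildingFamily hΦ hΔ hV
  let f : V →ₗ[ℝ] (Fin n → ℝ) := LinearMap.pi fun i => (innerSL ℝ (Δ i) : V →ₗ[ℝ] ℝ)
  have hf : ∀ x i, f x i = ⟪x, Δ i⟫_ℝ := fun x i => real_inner_comm _ _
  have hinj : LinearMap.ker f = ⊥ := by
    rw [LinearMap.ker_eq_bot']
    exact fun u hu => eq_zero_of_forall_inner_simple u fun i => by rw [← hf, hu]; rfl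
  obtain ⟨K, hK, hanti⟩ := f.exists_antilipschitzWith hinj
  rw [isBounded_iff_forall_norm_le]
  refine ⟨K * (2 * ε n), fun x hx => ?_⟩
  obtain ⟨σ, hσ, hdom⟩ := exists_dominant_apply hΦ hΔ x
  have hle : ⟪σ x, delta Φ Δ⟫_ℝ ≤ ε n := by
    have := hx _ ⟨σ⁻¹, inv_mem hσ, ∅, fun h => (hB.nonempty _ hB.univ_mem).ne_empty h.symm, rfl⟩
    rwa [← inner_map_inv, hB.normalVec_empty, hB.bound_empty] at this
  rw [inner_delta] at hle
  have hterm : ∀ i, ⟪σ x, Δ i⟫_ℝ ≤ 2 * ε n := by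
    intro i
    have h1 := Finset.single_le_sum (f := fun i => coef Φ Δ Finset.univ i * ⟪σ x, Δ i⟫_ℝ)
      (fun j _ => mul_nonneg (coef_nonneg _ j) (hdom j)) (Finset.mem_univ i)
    have h2 := mul_le_mul_of_nonneg_right (half_le_coef (Φ := Φ) hΔ (Finset.mem_univ i)) (hdom i)
    linarith
  have h0 : 0 ≤ 2 * ε n := by
    obtain ⟨i, -⟩ := hB.nonempty _ hB.univ_mem
    exact (hdom i).trans (hterm i)
  have h1 : ‖f (σ x)‖ ≤ 2 * ε n := by
    rw [pi_norm_le_iff_of_nonneg h0]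
    intro i
    rw [hf, Real.norm_of_nonneg (hdom i)]
    exact hterm i
  have h2 := hanti.le_mul_dist (σ x) 0
  rw [map_zero, dist_zero_right, dist_zero_right, σ.norm_map] at h2
  exact h2.trans (mul_le_mul_of_nonneg_left h1 K.2)

end Permutonestohedron

section Vertices

variable {V : Type*} [NormedAddCommGroup V] [InnerProductSpace ℝ V] [FiniteDimensional ℝ V]
variable {n : ℕ} {Φ : Finset V} {Δ : Module.Basis (Fin n) ℝ V} {G : Set (Submodule ℝ V)}
  {ε : ℕ → ℝ} {S : Finset (Finset (Fin n))} {v : V}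

/-! #### The vertices of the nestohedron -/

theorem inner_simple_pos_of_le (hΦ : IsRootSystem Φ) (hΔ : IsSimpleSystem Φ Δ)
    (hG : IsBuildingSet Φ G) (hV : ⊤ ∈ G) (hε : IsSuitable Φ Δ G ε) {x : V}
    (hx : ∀ A ∈ fundFamily Δ G, ε A.card ≤ ⟪x, halfSum Φ Δ A⟫_ℝ) (i : Fin n) :
    0 < ⟪x, Δ i⟫_ℝ := by
  have hmem := hG.singleton_mem hΔ i
  have h1 := ((hε.isDominated hΦ hΔ hG hV).pos _ hmem).trans_le (hx _ hmem)
  rw [inner_halfSum, Finset.sum_singleton] at h1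
  exact (mul_pos_iff_of_pos_left (coef_pos (Φ := Φ) hΔ (Finset.mem_singleton_self i))).1 h1

/-- These conditions describe the nestohedron. Its points are strictly dominant, so the inequalities
for the translates follow from the fundamental ones, and those follow by adding over components. -/
theorem mem_polyhedron_of_le (hΦ : IsRootSystem Φ) (hΔ : IsSimpleSystem Φ Δ)
    (hG : IsBuildingSet Φ G) (hV : ⊤ ∈ G) (hε : IsSuitable Φ Δ G ε) {x : V}
    (hδ : ⟪x, delta Φ Δ⟫_ℝ = ε n)
    (hx : ∀ A ∈ fundFamily Δ G, ε A.card ≤ ⟪x, halfSum Φ Δ A⟫_ℝ) :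
    x ∈ polyhedron (inequalities Φ Δ G ε) := by
  have hpos := inner_simple_pos_of_le hΦ hΔ hG hV hε hx
  rintro _ ⟨σ, hσ, I, -, rfl⟩
  refine (inner_apply_le hΦ hΔ (inner_normalVec_simple_nonneg hΦ hΔ hG hV I)
    (fun i => (hpos i).le) hσ).trans ?_
  rw [inner_normalVec, hδ, bound]
  exact sub_le_sub_left (Finset.sum_le_sum fun A hA => hx A (mem_of_mem_components hA)) _

/-- The right-hand sides are arbitrary because the same system also produces the directions in
`exists_direction`. -/
theorem exists_vertex (hΦ : IsRootSystem Φ) (hΔ : IsSimpleSystem Φ Δ)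
    (hG : IsBuildingSet Φ G) (hV : ⊤ ∈ G) (hS : Maximal (Nested (fundFamily Δ G)) S)
    (z : S → ℝ) : ∃ v : V, ∀ A : S, ⟪v, halfSum Φ Δ A⟫_ℝ = z A := by
  have hB := hG.isBuildingFamily hΦ hΔ hV
  refine exists_forall_inner_eq (fun A : S => halfSum Φ Δ (A : Finset (Fin n))) ?_ ?_ z
  · rw [Fintype.card_coe, card_eq_of_maximal hB hS, Fintype.card_fin, finrank_eq Δ]
  · intro u hu
    refine eq_zero_of_forall_inner_simple (Δ := Δ) u (eq_zero_of_forall_sum_eq_zero hB hS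
      (c := coef Φ Δ) (fun A _ i hi => coef_pos hΔ hi) fun A hA => ?_)
    rw [← inner_halfSum]
    exact hu ⟨A, hA⟩

theorem eq_zero_of_forall_inner_halfSum (hΦ : IsRootSystem Φ) (hΔ : IsSimpleSystem Φ Δ)
    (hG : IsBuildingSet Φ G) (hV : ⊤ ∈ G) (hS : Maximal (Nested (fundFamily Δ G)) S) (u : V)
    (hu : ∀ A ∈ S, ⟪u, halfSum Φ Δ A⟫_ℝ = 0) : u = 0 := by
  have hB := hG.isBuildingFamily hΦ hΔ hV
  refine eq_zero_of_forall_inner_simple (Δ := Δ) u (eq_zero_of_forall_sum_eq_zero hB hS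
    (c := coef Φ Δ) (fun A _ i hi => coef_pos hΔ hi) fun A hA => ?_)
  rw [← inner_halfSum]
  exact hu A hA

theorem lt_inner_halfSum (hΦ : IsRootSystem Φ) (hΔ : IsSimpleSystem Φ Δ)
    (hG : IsBuildingSet Φ G) (hV : ⊤ ∈ G) (hε : IsSuitable Φ Δ G ε)
    (hS : Maximal (Nested (fundFamily Δ G)) S)
    (hv : ∀ A ∈ S, ⟪v, halfSum Φ Δ A⟫_ℝ = ε A.card) {C : Finset (Fin n)}
    (hC : C ∈ fundFamily Δ G) (hCS : C ∉ S) : ε C.card < ⟪v, halfSum Φ Δ C⟫_ℝ := by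
  rw [inner_halfSum]
  refine (hε.isDominated hΦ hΔ hG hV).lt_sum (hG.isBuildingFamily hΦ hΔ hV) hS
    (fun A hA => ?_) hC hCS
  rw [← inner_halfSum]
  exact hv A hA

theorem le_inner_halfSum (hΦ : IsRootSystem Φ) (hΔ : IsSimpleSystem Φ Δ)
    (hG : IsBuildingSet Φ G) (hV : ⊤ ∈ G) (hε : IsSuitable Φ Δ G ε)
    (hS : Maximal (Nested (fundFamily Δ G)) S)
    (hv : ∀ A ∈ S, ⟪v, halfSum Φ Δ A⟫_ℝ = ε A.card) (C : Finset (Fin n))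
    (hC : C ∈ fundFamily Δ G) : ε C.card ≤ ⟪v, halfSum Φ Δ C⟫_ℝ := by
  by_cases hCS : C ∈ S
  · exact (hv C hCS).ge
  · exact (lt_inner_halfSum hΦ hΔ hG hV hε hS hv hC hCS).le

theorem inner_delta_of_vertex (hΦ : IsRootSystem Φ) (hΔ : IsSimpleSystem Φ Δ)
    (hG : IsBuildingSet Φ G) (hV : ⊤ ∈ G) (hS : Maximal (Nested (fundFamily Δ G)) S)
    (hv : ∀ A ∈ S, ⟪v, halfSum Φ Δ A⟫_ℝ = ε A.card) : ⟪v, delta Φ Δ⟫_ℝ = ε n := by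
  rw [← halfSum_univ, hv _ (univ_mem_of_maximal (hG.isBuildingFamily hΦ hΔ hV) hS),
    Finset.card_univ, Fintype.card_fin]

/-- For an active `I` the bounds of its components add up to an equality, so each is an equality,
which happens only for members of `S`. -/
theorem active_vertex (hΦ : IsRootSystem Φ) (hΔ : IsSimpleSystem Φ Δ)
    (hG : IsBuildingSet Φ G) (hV : ⊤ ∈ G) (hε : IsSuitable Φ Δ G ε)
    (hS : Maximal (Nested (fundFamily Δ G)) S)
    (hv : ∀ A ∈ S, ⟪v, halfSum Φ Δ A⟫_ℝ = ε A.card) : active (inequalities Φ Δ G ε) v =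
      (fun I => (normalVec Φ Δ G I, bound Δ G ε I)) '' (activeSets (fundFamily Δ G) S) := by
  have hδ := inner_delta_of_vertex hΦ hΔ hG hV hS hv
  have hle := le_inner_halfSum hΦ hΔ hG hV hε hS hv
  rw [active_eq_image_of_pos hΦ hΔ hG hV (mem_polyhedron_of_le hΦ hΔ hG hV hε hδ hle)
    (inner_simple_pos_of_le hΦ hΔ hG hV hε hle)]
  congr 1
  ext I
  change (I ≠ Finset.univ ∧ _) ↔ I ∈ activeSets (fundFamily Δ G) S
  rw [mem_activeSets, inner_normalVec, hδ, bound]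
  refine and_congr_right fun _ => ?_
  rw [sub_right_inj, eq_comm, Finset.sum_eq_sum_iff_of_le fun A hA =>
    hle A (mem_of_mem_components hA)]
  constructor
  · intro h A hA
    by_contra hAS
    exact (lt_inner_halfSum hΦ hΔ hG hV hε hS hv (mem_of_mem_components hA) hAS).ne (h A hA)
  · intro h A hA
    exact (hv A (h hA)).symm

theorem vertex_mem_extremePoints (hΦ : IsRootSystem Φ) (hΔ : IsSimpleSystem Φ Δ)
    (hG : IsBuildingSet Φ G) (hV : ⊤ ∈ G) (hε : IsSuitable Φ Δ G ε)
    (hS : Maximal (Nested (fundFamily Δ G)) S)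
    (hv : ∀ A ∈ S, ⟪v, halfSum Φ Δ A⟫_ℝ = ε A.card) :
    v ∈ (polyhedron (inequalities Φ Δ G ε)).extremePoints ℝ := by
  have hB := hG.isBuildingFamily hΦ hΔ hV
  refine mem_extremePoints_polyhedron (mem_polyhedron_of_le hΦ hΔ hG hV hε
    (inner_delta_of_vertex hΦ hΔ hG hV hS hv) (le_inner_halfSum hΦ hΔ hG hV hε hS hv))
    fun u hu => eq_zero_of_forall_inner_halfSum hΦ hΔ hG hV hS u fun A hA => ?_
  rw [active_vertex hΦ hΔ hG hV hε hS hv] at hu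
  have h : ∀ I ∈ insert ∅ (S.erase Finset.univ), ⟪u, normalVec Φ Δ G I⟫_ℝ = 0 := fun I hI =>
    hu _ ⟨I, insert_empty_erase_univ_subset hB hS hI, rfl⟩
  have h0 := h ∅ (Finset.mem_insert_self _ _)
  rw [hB.normalVec_empty] at h0
  by_cases hAu : A = Finset.univ
  · rw [hAu, halfSum_univ, h0]
  · have h1 := h A (Finset.mem_insert_of_mem (Finset.mem_erase.2 ⟨hAu, hA⟩))
    rw [normalVec_of_mem (hS.prop.1 hA), inner_sub_right, h0, zero_sub, neg_eq_zero] at h1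
    exact h1

theorem exists_direction (hΦ : IsRootSystem Φ) (hΔ : IsSimpleSystem Φ Δ)
    (hG : IsBuildingSet Φ G) (hV : ⊤ ∈ G) (hS : Maximal (Nested (fundFamily Δ G)) S)
    {I : Finset (Fin n)} (hI : I ∈ activeSets (fundFamily Δ G) S) :
    ∃ u : V, ⟪u, normalVec Φ Δ G I⟫_ℝ = 0 ∧
      ∀ J ∈ activeSets (fundFamily Δ G) S, J ≠ I → ⟪u, normalVec Φ Δ G J⟫_ℝ < 0 := by
  have hB := hG.isBuildingFamily hΦ hΔ hV
  set T := components (fundFamily Δ G) I with hT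
  -- Prescribe -|T| on δ, -1 on members of `T` and 1 on the other proper members of `S`. If `U` is
  -- the component set of `J`, the value on its normal is |U ∩ T| - |T| - |U \ T|, zero only for U =
  -- T.
  obtain ⟨u, hu⟩ := exists_vertex hΦ hΔ hG hV hS fun A : S =>
    if (A : Finset (Fin n)) = Finset.univ then -(T.card : ℝ) else
      if (A : Finset (Fin n)) ∈ T then -1 else 1
  have hδ : ⟪u, delta Φ Δ⟫_ℝ = -(T.card : ℝ) := by
    have := hu ⟨Finset.univ, univ_mem_of_maximal hB hS⟩
    rwa [if_pos rfl, halfSum_univ] at this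
  have hval : ∀ J ∈ activeSets (fundFamily Δ G) S, ⟪u, normalVec Φ Δ G J⟫_ℝ =
      -(T.card : ℝ) - ∑ A ∈ components (fundFamily Δ G) J, if A ∈ T then (-1 : ℝ) else 1 := by
    intro J hJ
    obtain ⟨hJu, hJS⟩ := mem_activeSets.1 hJ
    rw [inner_normalVec, hδ]
    congr 1
    refine Finset.sum_congr rfl fun A hA => ?_
    have hAu : A ≠ Finset.univ := fun h =>
      hJu (Finset.univ_subset_iff.1 (h ▸ subset_of_mem_components hA))
    rw [hu ⟨A, hJS hA⟩, if_neg hAu]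
  have hsum : ∀ U : Finset (Finset (Fin n)), ∑ A ∈ U, (if A ∈ T then (-1 : ℝ) else 1) =
      ((U \ T).card : ℝ) - ((U ∩ T).card : ℝ) := by
    intro U
    rw [Finset.sum_ite, Finset.sum_const, Finset.sum_const, Finset.filter_mem_eq_inter,
      Finset.filter_notMem_eq_sdiff]
    simp only [nsmul_eq_mul, mul_one, mul_neg]
    ring
  refine ⟨u, ?_, fun J hJ hJI => ?_⟩
  · rw [hval I hI, hsum, ← hT, Finset.sdiff_self, Finset.inter_self, Finset.card_empty]
    simp
  · rw [hval J hJ, hsum]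
    set U := components (fundFamily Δ G) J with hU
    have hUT : U ≠ T := fun h => hJI (hB.components_injective h)
    have h1 : (U ∩ T).card ≤ T.card := Finset.card_le_card Finset.inter_subset_right
    have h2 : (U ∩ T).card < T.card ∨ 0 < (U \ T).card := by
      by_contra hc
      push Not at hc
      have h3 : U ∩ T = T := Finset.eq_of_subset_of_card_le Finset.inter_subset_right hc.1
      have h4 : U \ T = ∅ := Finset.card_eq_zero.1 (Nat.le_zero.1 hc.2)
      exact hUT ((Finset.sdiff_eq_empty_iff_subset.1 h4).antisymm (Finset.inter_eq_right.1 h3))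
    have h1' : ((U ∩ T).card : ℝ) ≤ T.card := by exact_mod_cast h1
    have h0' : (0 : ℝ) ≤ (U \ T).card := Nat.cast_nonneg _
    rcases h2 with h2 | h2
    · have h2' : ((U ∩ T).card : ℝ) < T.card := by exact_mod_cast h2
      linarith
    · have h2' : (0 : ℝ) < (U \ T).card := by exact_mod_cast h2
      linarith

theorem encard_facets_vertex (hΦ : IsRootSystem Φ) (hΔ : IsSimpleSystem Φ Δ)
    (hG : IsBuildingSet Φ G) (hV : ⊤ ∈ G) (hε : IsSuitable Φ Δ G ε)
    (hS : Maximal (Nested (fundFamily Δ G)) S)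
    (hv : ∀ A ∈ S, ⟪v, halfSum Φ Δ A⟫_ℝ = ε A.card) :
    {F | IsFacet (polyhedron (inequalities Φ Δ G ε)) F ∧ v ∈ F}.encard =
      (activeSets (fundFamily Δ G) S).card := by
  have hact := active_vertex hΦ hΔ hG hV hε hS hv
  have hinj : Function.Injective fun I => (normalVec Φ Δ G I, bound Δ G ε I) := fun I J h =>
    normalVec_injective hΦ hΔ hG hV (Prod.ext_iff.1 h).1
  rw [encard_facets (finite_inequalities hΦ hΔ) (inner_zero_lt hΦ hΔ hG hV hε)
    (vertex_mem_extremePoints hΦ hΔ hG hV hε hS hv).1, hact, hinj.encard_image,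
    Set.encard_coe_eq_coe_finsetCard]
  rw [hact]
  rintro _ ⟨I, hI, rfl⟩
  obtain ⟨u, hu0, hu⟩ := exists_direction hΦ hΔ hG hV hS hI
  refine ⟨u, hu0, ?_⟩
  rintro _ ⟨J, hJ, rfl⟩ hne
  exact hu J hJ fun h => hne (h ▸ rfl)

/-! ### Intersections of hyperplanes, the nestohedron and minimal elements -/

theorem mem_hyperplane_iff (hΦ : IsRootSystem Φ) (hΔ : IsSimpleSystem Φ Δ) {x : V}
    {A : Finset (Fin n)} (hA : A ∈ fundFamily Δ G) (hδ : ⟪x, delta Φ Δ⟫_ℝ = ε n) :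
    x ∈ hyperplane Φ Δ ε (simpleSpan Δ A) ↔ ⟪x, halfSum Φ Δ A⟫_ℝ = ε A.card := by
  by_cases hAu : A = Finset.univ
  · rw [hAu, simpleSpan_univ, hyperplane_top, halfSum_univ, Finset.card_univ, Fintype.card_fin]
    rfl
  · rw [hyperplane_simpleSpan hΦ hΔ hA hAu]
    change ⟪x, normalVec Φ Δ G A⟫_ℝ = bound Δ G ε A ↔ _
    rw [normalVec_of_mem hA, bound_of_mem hA, inner_sub_right, hδ, sub_right_inj]

theorem biInter_hyperplane (hΦ : IsRootSystem Φ) (hΔ : IsSimpleSystem Φ Δ)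
    (hG : IsBuildingSet Φ G) (hV : ⊤ ∈ G) (hS : Maximal (Nested (fundFamily Δ G)) S)
    (hv : ∀ A ∈ S, ⟪v, halfSum Φ Δ A⟫_ℝ = ε A.card) :
    ⋂ A ∈ simpleSpan Δ '' (S : Set (Finset (Fin n))), hyperplane Φ Δ ε A = {v} := by
  have huniv := univ_mem_of_maximal (hG.isBuildingFamily hΦ hΔ hV) hS
  ext x
  rw [Set.mem_iInter₂, Set.forall_mem_image, Set.mem_singleton_iff]
  constructor
  · intro h
    have hδ : ⟪x, delta Φ Δ⟫_ℝ = ε n := by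
      have := h huniv
      rwa [simpleSpan_univ, hyperplane_top] at this
    refine sub_eq_zero.1 (eq_zero_of_forall_inner_halfSum hΦ hΔ hG hV hS _ fun A hA => ?_)
    rw [inner_sub_left, hv A hA, (mem_hyperplane_iff hΦ hΔ (hS.prop.1 hA) hδ).1 (h hA), sub_self]
  · rintro rfl A hA
    exact (mem_hyperplane_iff hΦ hΔ (hS.prop.1 hA)
      (inner_delta_of_vertex hΦ hΔ hG hV hS hv)).2 (hv A hA)

theorem mem_nestohedron_iff (hΦ : IsRootSystem Φ) (hΔ : IsSimpleSystem Φ Δ) {x : V} :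
    x ∈ nestohedron Φ Δ G ε ↔ ⟪x, delta Φ Δ⟫_ℝ = ε n ∧
      ∀ A ∈ fundFamily Δ G, ε A.card ≤ ⟪x, halfSum Φ Δ A⟫_ℝ := by
  rw [nestohedron, hyperplane_top, Set.mem_inter_iff, Set.mem_iInter₂]
  refine and_congr_right fun hδ => ?_
  change ⟪x, delta Φ Δ⟫_ℝ = ε n at hδ
  have hiff : ∀ A ∈ fundFamily Δ G, A ≠ Finset.univ →
      (x ∈ halfSpace Φ Δ ε (simpleSpan Δ A) ↔ ε A.card ≤ ⟪x, halfSum Φ Δ A⟫_ℝ) := by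
    intro A hA hAu
    rw [halfSpace_simpleSpan hΦ hΔ hA hAu]
    change ⟪x, normalVec Φ Δ G A⟫_ℝ ≤ bound Δ G ε A ↔ _
    rw [normalVec_of_mem hA, bound_of_mem hA, inner_sub_right, hδ, sub_le_sub_iff_left]
  constructor
  · intro h A hA
    by_cases hAu : A = Finset.univ
    · rw [hAu, halfSum_univ, hδ, Finset.card_univ, Fintype.card_fin]
    · refine (hiff A hA hAu).1 (h _ ⟨simpleSpan_mem_fund.2 hA, fun h => hAu ?_⟩)
      exact simpleSpan_injective (h.trans simpleSpan_univ.symm)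
  · rintro h A ⟨hA, hAu⟩
    obtain ⟨I, hI, rfl⟩ := exists_of_mem_fund hA
    exact (hiff I hI fun h => hAu (by rw [h, simpleSpan_univ]; rfl)).2 (h I hI)

theorem vertex_mem_extremePoints_nestohedron (hΦ : IsRootSystem Φ) (hΔ : IsSimpleSystem Φ Δ)
    (hG : IsBuildingSet Φ G) (hV : ⊤ ∈ G) (hε : IsSuitable Φ Δ G ε)
    (hS : Maximal (Nested (fundFamily Δ G)) S)
    (hv : ∀ A ∈ S, ⟪v, halfSum Φ Δ A⟫_ℝ = ε A.card) :
    v ∈ (nestohedron Φ Δ G ε).extremePoints ℝ := by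
  have hsub : nestohedron Φ Δ G ε ⊆ polyhedron (inequalities Φ Δ G ε) := fun x hx =>
    have h := (mem_nestohedron_iff hΦ hΔ).1 hx
    mem_polyhedron_of_le hΦ hΔ hG hV hε h.1 h.2
  exact inter_extremePoints_subset_extremePoints_of_subset hsub
    ⟨(mem_nestohedron_iff hΦ hΔ).2 ⟨inner_delta_of_vertex hΦ hΔ hG hV hS hv,
      le_inner_halfSum hΦ hΔ hG hV hε hS hv⟩, vertex_mem_extremePoints hΦ hΔ hG hV hε hS hv⟩

/-- Two members above a common minimal one share an element, and intersecting members of a nested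
set are comparable. -/
theorem existsUnique_minimal_iff (hΦ : IsRootSystem Φ) (hΔ : IsSimpleSystem Φ Δ)
    (hG : IsBuildingSet Φ G) (hV : ⊤ ∈ G) (hS : Maximal (Nested (fundFamily Δ G)) S) :
    (∃! A, Minimal (fun X => X ∈ simpleSpan Δ '' (S : Set (Finset (Fin n)))) A) ↔
      ∀ A ∈ S, ∀ C ∈ S, A ⊆ C ∨ C ⊆ A := by
  have hB := hG.isBuildingFamily hΦ hΔ hV
  have hmin : ∀ A ∈ S, ∃ C, Minimal (· ∈ S) C ∧ C ⊆ A := fun A hA => by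
    obtain ⟨C, hCA, hC⟩ := S.finite_toSet.exists_le_minimal (a := A) hA
    exact ⟨C, hC, hCA⟩
  have himg : ∀ C, Minimal (· ∈ S) C →
      Minimal (fun X => X ∈ simpleSpan Δ '' (S : Set (Finset (Fin n)))) (simpleSpan Δ C) := by
    refine fun C hC => ⟨⟨C, hC.prop, rfl⟩, ?_⟩
    rintro _ ⟨X, hX, rfl⟩ hle
    exact simpleSpan_le_simpleSpan.2 (hC.2 hX (simpleSpan_le_simpleSpan.1 hle))
  constructor
  · rintro ⟨M, -, huniq⟩ A hA C hC
    obtain ⟨A', hA', hAA⟩ := hmin A hA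
    obtain ⟨C', hC', hCC⟩ := hmin C hC
    have heq : A' = C' :=
      simpleSpan_injective ((huniq _ (himg A' hA')).trans (huniq _ (himg C' hC')).symm)
    obtain ⟨i, hi⟩ := hB.nonempty A' (hS.prop.1 hA'.prop)
    exact hS.prop.subset_or_subset hB hA hC (hAA hi) (hCC (heq ▸ hi))
  · intro h
    obtain ⟨M, hM, -⟩ := hmin _ (univ_mem_of_maximal hB hS)
    refine ⟨simpleSpan Δ M, himg M hM, fun X hX => ?_⟩
    obtain ⟨A, hA, rfl⟩ := hX.prop
    have hMA : M ⊆ A := (h M hM.prop A hA).elim id fun h => hM.2 hA h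
    exact (hX.eq_of_ge ⟨M, hM.prop, rfl⟩ (simpleSpan_le_simpleSpan.2 hMA))

/-! #### The vertices for the maximal building set -/

theorem inner_normalVec_full
    (hfull : ∀ I : Finset (Fin n), I.Nonempty → I ∈ fundFamily Δ G) (hΦ : IsRootSystem Φ)
    (hΔ : IsSimpleSystem Φ Δ)
    (hG : IsBuildingSet Φ G) (hV : ⊤ ∈ G) (x : V) (I : Finset (Fin n)) :
    ⟪x, normalVec Φ Δ G I⟫_ℝ = ⟪x, delta Φ Δ⟫_ℝ - ⟪x, halfSum Φ Δ I⟫_ℝ := by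
  rcases I.eq_empty_or_nonempty with rfl | h
  · rw [(hG.isBuildingFamily hΦ hΔ hV).normalVec_empty, inner_halfSum, Finset.sum_empty, sub_zero]
  · rw [normalVec_of_mem (hfull I h), inner_sub_right]

theorem le_inner_halfSum_full
    (hfull : ∀ I : Finset (Fin n), I.Nonempty → I ∈ fundFamily Δ G) (hΦ : IsRootSystem Φ)
    (hΔ : IsSimpleSystem Φ Δ)
    (hG : IsBuildingSet Φ G) (hV : ⊤ ∈ G) (hv : v ∈ polyhedron (inequalities Φ Δ G ε))
    {I : Finset (Fin n)} (hI : I.Nonempty) :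
    ε I.card - (ε n - ⟪v, delta Φ Δ⟫_ℝ) ≤ ⟪v, halfSum Φ Δ I⟫_ℝ := by
  by_cases hIu : I = Finset.univ
  · rw [hIu, halfSum_univ, Finset.card_univ, Fintype.card_fin]
    linarith
  · have h := hv _ ⟨1, one_mem _, I, hIu, rfl⟩
    change ⟪v, normalVec Φ Δ G I⟫_ℝ ≤ bound Δ G ε I at h
    rw [inner_normalVec_full hfull hΦ hΔ hG hV, bound_of_mem (hfull I hI)] at h
    linarith

theorem inner_delta_le (hΦ : IsRootSystem Φ) (hΔ : IsSimpleSystem Φ Δ)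
    (hG : IsBuildingSet Φ G) (hV : ⊤ ∈ G) (hv : v ∈ polyhedron (inequalities Φ Δ G ε)) :
    ⟪v, delta Φ Δ⟫_ℝ ≤ ε n := by
  have hB := hG.isBuildingFamily hΦ hΔ hV
  have h := hv _ ⟨1, one_mem _, ∅, fun h => (hB.nonempty _ hB.univ_mem).ne_empty h.symm, rfl⟩
  rwa [hB.normalVec_empty, hB.bound_empty] at h

/-- Put s = ε_n - (v, δ) ≥ 0. Activity gives (v, ρ_I) = ε_|I| - s; domination turns this into ε_|I|
· 2∑ ≤ (ε_|I| - s) ε_|J|, which is at most ε_|I| (ε_|J| - s). -/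
theorem two_mul_sum_le
    (hfull : ∀ I : Finset (Fin n), I.Nonempty → I ∈ fundFamily Δ G) (hΦ : IsRootSystem Φ)
    (hΔ : IsSimpleSystem Φ Δ)
    (hG : IsBuildingSet Φ G) (hV : ⊤ ∈ G) (hε : IsSuitable Φ Δ G ε)
    (hv : v ∈ polyhedron (inequalities Φ Δ G ε)) (hdom : ∀ i, 0 ≤ ⟪v, Δ i⟫_ℝ)
    {I J : Finset (Fin n)} (hI : I.Nonempty) (hIJ : I ⊂ J)
    (hact : ⟪v, normalVec Φ Δ G I⟫_ℝ = bound Δ G ε I) :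
    ε n - ⟪v, delta Φ Δ⟫_ℝ < ε J.card ∧
    2 * ∑ k ∈ I, coef Φ Δ J k * ⟪v, Δ k⟫_ℝ ≤ ε J.card - (ε n - ⟪v, delta Φ Δ⟫_ℝ) ∧
    ((∀ i, 0 < ⟪v, Δ i⟫_ℝ) →
      2 * ∑ k ∈ I, coef Φ Δ J k * ⟪v, Δ k⟫_ℝ < ε J.card - (ε n - ⟪v, delta Φ Δ⟫_ℝ)) := by
  have hIG := hfull I hI
  have hJG := hfull J (hI.mono hIJ.subset)
  have hdomin := hε.isDominated hΦ hΔ hG hV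
  have hI0 := hdomin.pos I hIG
  have hJ0 := hdomin.pos J hJG
  have hs : 0 ≤ ε n - ⟪v, delta Φ Δ⟫_ℝ := sub_nonneg.2 (inner_delta_le hΦ hΔ hG hV hv)
  set s := ε n - ⟪v, delta Φ Δ⟫_ℝ with hsdef
  have hlt : 2 * ε I.card < ε J.card := by
    have h1 := hε.two_pow_mul_lt hΦ hΔ hG (Finset.card_pos.2 hI) (Finset.card_lt_card hIJ)
      (by simpa using Finset.card_le_univ J)
    have h2 : (2 : ℝ) ^ I.card * 2 ≤ 2 ^ J.card := by
      rw [← pow_succ]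
      exact pow_le_pow_right₀ one_le_two (Finset.card_lt_card hIJ)
    have h3 := mul_le_mul_of_nonneg_right h2 hI0.le
    refine lt_of_mul_lt_mul_left (a := (2 : ℝ) ^ I.card) ?_ (by positivity)
    linarith
  have hval : ∑ k ∈ I, coef Φ Δ I k * ⟪v, Δ k⟫_ℝ = ε I.card - s := by
    rw [inner_normalVec_full hfull hΦ hΔ hG hV, bound_of_mem hIG] at hact
    rw [← inner_halfSum]
    linarith
  have hnn : 0 ≤ ε I.card - s := hval ▸ Finset.sum_nonneg fun k _ =>
    mul_nonneg (coef_nonneg I k) (hdom k)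
  have hterm : ∀ k ∈ I, coef Φ Δ J k * (2 * ε I.card) < coef Φ Δ I k * ε J.card := by
    intro k hk
    have h1 := hdomin.lt J hJG I hIG hIJ k hk
    have h2 : (2 : ℝ) ^ I.card * 2 ≤ 2 ^ J.card := by
      rw [← pow_succ]
      exact pow_le_pow_right₀ one_le_two (Finset.card_lt_card hIJ)
    have h3 := mul_le_mul_of_nonneg_right h2 (mul_nonneg (coef_nonneg (Φ := Φ) (Δ := Δ) J k) hI0.le)
    refine lt_of_mul_lt_mul_left (a := (2 : ℝ) ^ I.card) ?_ (by positivity)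
    linarith
  have hs1 : ∑ k ∈ I, coef Φ Δ J k * (2 * ε I.card) * ⟪v, Δ k⟫_ℝ =
      ε I.card * (2 * ∑ k ∈ I, coef Φ Δ J k * ⟪v, Δ k⟫_ℝ) := by
    rw [Finset.mul_sum, Finset.mul_sum]
    exact Finset.sum_congr rfl fun k _ => by ring
  have hs2 : ∑ k ∈ I, coef Φ Δ I k * ε J.card * ⟪v, Δ k⟫_ℝ = (ε I.card - s) * ε J.card := by
    rw [← hval, Finset.sum_mul]
    exact Finset.sum_congr rfl fun k _ => by ring
  have hfin : (ε I.card - s) * ε J.card ≤ ε I.card * (ε J.card - s) := by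
    have := mul_nonneg hs (by linarith : 0 ≤ ε J.card - ε I.card)
    linarith
  refine ⟨by linarith, ?_, fun hpos => ?_⟩
  · refine le_of_mul_le_mul_left (le_trans ?_ hfin) hI0
    rw [← hs1, ← hs2]
    exact Finset.sum_le_sum fun k hk => mul_le_mul_of_nonneg_right (hterm k hk).le (hdom k)
  · refine lt_of_mul_lt_mul_left (lt_of_lt_of_le ?_ hfin) hI0.le
    rw [← hs1, ← hs2]
    exact Finset.sum_lt_sum_of_nonempty hI fun k hk => mul_lt_mul_of_pos_right (hterm k hk) (hpos k)

/-- If i ∉ I, adding i to `I` leaves the relevant sum unchanged because y_i = 0. That sum is bounded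
below by ε_|J| - s, where J = I ∪ {i}, but for nonempty `I` above by half of this positive number;
for I = ∅ it is zero. -/
theorem mem_of_inner_eq_zero
    (hfull : ∀ I : Finset (Fin n), I.Nonempty → I ∈ fundFamily Δ G) (hΦ : IsRootSystem Φ)
    (hΔ : IsSimpleSystem Φ Δ)
    (hG : IsBuildingSet Φ G) (hV : ⊤ ∈ G) (hε : IsSuitable Φ Δ G ε)
    (hv : v ∈ polyhedron (inequalities Φ Δ G ε)) (hdom : ∀ i, 0 ≤ ⟪v, Δ i⟫_ℝ)
    {I : Finset (Fin n)} (hact : ⟪v, normalVec Φ Δ G I⟫_ℝ = bound Δ G ε I) {i : Fin n}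
    (hi : ⟪v, Δ i⟫_ℝ = 0) : i ∈ I := by
  by_contra hiI
  have h1 := le_inner_halfSum_full hfull hΦ hΔ hG hV hv (Finset.insert_nonempty i I)
  rw [inner_halfSum, Finset.sum_insert hiI, hi, mul_zero, zero_add] at h1
  have hB := hG.isBuildingFamily hΦ hΔ hV
  rcases I.eq_empty_or_nonempty with rfl | hI
  · rw [hB.normalVec_empty, hB.bound_empty] at hact
    have h2 := (hε.isDominated hΦ hΔ hG hV).pos _ (hfull _ (Finset.insert_nonempty i ∅))
    rw [Finset.sum_empty] at h1
    linarith
  · obtain ⟨h2, h3, -⟩ := two_mul_sum_le hfull hΦ hΔ hG hV hε hv hdom hI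
      (Finset.ssubset_insert hiI) hact
    linarith

/-- On a wall y_i = 0 every active normal would be orthogonal to `Δ i`, so the point could move
along `Δ i`. -/
theorem inner_simple_pos_of_mem_extremePoints
    (hfull : ∀ I : Finset (Fin n), I.Nonempty → I ∈ fundFamily Δ G) (hΦ : IsRootSystem Φ)
    (hΔ : IsSimpleSystem Φ Δ)
    (hG : IsBuildingSet Φ G) (hV : ⊤ ∈ G) (hε : IsSuitable Φ Δ G ε)
    (hv : v ∈ (polyhedron (inequalities Φ Δ G ε)).extremePoints ℝ)
    (hdom : ∀ i, 0 ≤ ⟪v, Δ i⟫_ℝ) (i : Fin n) : 0 < ⟪v, Δ i⟫_ℝ := by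
  refine lt_of_le_of_ne (hdom i) fun h0 => ?_
  refine Δ.ne_zero i (eq_zero_of_mem_extremePoints (finite_inequalities hΦ hΔ) hv (Δ i) ?_)
  rintro _ ⟨⟨σ, hσ, I, hI, rfl⟩, heq⟩
  change ⟪v, σ (normalVec Φ Δ G I)⟫_ℝ = bound Δ G ε I at heq
  change ⟪Δ i, σ (normalVec Φ Δ G I)⟫_ℝ = 0
  have hndom := inner_normalVec_simple_nonneg hΦ hΔ hG hV I
  have h1 := hv.1 _ ⟨1, one_mem _, I, hI, rfl⟩
  have h2 := inner_apply_le hΦ hΔ hndom hdom hσ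
  have h3 : ⟪v, normalVec Φ Δ G I⟫_ℝ = bound Δ G ε I := le_antisymm h1 (heq.ge.trans h2)
  have hmem : ∀ k, ⟪v, Δ k⟫_ℝ = 0 → k ∈ I := fun k hk =>
    mem_of_inner_eq_zero hfull hΦ hΔ hG hV hε hv.1 hdom h3 hk
  set N := normalVec Φ Δ G I with hN
  -- Termwise: on `I` the normal N is orthogonal to the simple root, off `I` the coefficient of N -
  -- σ N vanishes. Since σ is an isometry, this yields σ N = N.
  have hd : ⟪N, N - σ N⟫_ℝ = 0 := by
    rw [← Δ.sum_repr (N - σ N), inner_sum]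
    refine Finset.sum_eq_zero fun k _ => ?_
    rw [inner_smul_right]
    by_cases hk : k ∈ I
    · rw [hN, inner_normalVec_simple_eq_zero hΦ hΔ hG hV hk, mul_zero]
    · have hkpos : 0 < ⟪v, Δ k⟫_ℝ := lt_of_le_of_ne (hdom k) fun h => hk (hmem k h.symm)
      rw [repr_sub_apply_eq_zero hΦ hΔ hndom hdom hσ (heq.trans h3.symm) hkpos, zero_mul]
  have h5 : N - σ N = 0 := by
    rw [← inner_self_eq_zero (𝕜 := ℝ)]
    have h6 := σ.inner_map_map N N
    rw [inner_sub_right] at hd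
    rw [inner_sub_left, inner_sub_right, inner_sub_right, h6, real_inner_comm N (σ N)]
    linarith
  rw [← sub_eq_zero.1 h5, real_inner_comm]
  exact inner_normalVec_simple_eq_zero hΦ hΔ hG hV (hmem i h0.symm)

/-- For incomparable sets, adding the two strict half bounds contradicts the lower bound for the
union; the intersection only contributes a nonnegative term. -/
theorem subset_or_subset_of_active
    (hfull : ∀ I : Finset (Fin n), I.Nonempty → I ∈ fundFamily Δ G) (hΦ : IsRootSystem Φ)
    (hΔ : IsSimpleSystem Φ Δ)
    (hG : IsBuildingSet Φ G) (hV : ⊤ ∈ G) (hε : IsSuitable Φ Δ G ε)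
    (hv : v ∈ polyhedron (inequalities Φ Δ G ε)) (hpos : ∀ i, 0 < ⟪v, Δ i⟫_ℝ)
    {I J : Finset (Fin n)} (hI : ⟪v, normalVec Φ Δ G I⟫_ℝ = bound Δ G ε I)
    (hJ : ⟪v, normalVec Φ Δ G J⟫_ℝ = bound Δ G ε J) : I ⊆ J ∨ J ⊆ I := by
  by_contra hc
  push Not at hc
  have hIne : I.Nonempty := Finset.nonempty_iff_ne_empty.2 fun h => hc.1 (h ▸ Finset.empty_subset _)
  have hJne : J.Nonempty := Finset.nonempty_iff_ne_empty.2 fun h => hc.2 (h ▸ Finset.empty_subset _)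
  have hIU : I ⊂ I ∪ J := Finset.ssubset_iff_subset_ne.2 ⟨Finset.subset_union_left, fun h =>
    hc.2 (h ▸ Finset.subset_union_right)⟩
  have hJU : J ⊂ I ∪ J := Finset.ssubset_iff_subset_ne.2 ⟨Finset.subset_union_right, fun h =>
    hc.1 (h ▸ Finset.subset_union_left)⟩
  have h1 := (two_mul_sum_le hfull hΦ hΔ hG hV hε hv (fun i => (hpos i).le) hIne hIU hI).2.2 hpos
  have h2 := (two_mul_sum_le hfull hΦ hΔ hG hV hε hv (fun i => (hpos i).le) hJne hJU hJ).2.2 hpos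
  have h3 := le_inner_halfSum_full hfull hΦ hΔ hG hV hv (hIne.mono hIU.subset)
  rw [inner_halfSum] at h3
  have h4 := Finset.sum_union_inter (s₁ := I) (s₂ := J)
    (f := fun k => coef Φ Δ (I ∪ J) k * ⟪v, Δ k⟫_ℝ)
  have h5 : 0 ≤ ∑ k ∈ I ∩ J, coef Φ Δ (I ∪ J) k * ⟪v, Δ k⟫_ℝ :=
    Finset.sum_nonneg fun k _ => mul_nonneg (coef_nonneg _ k) (hpos k).le
  linarith

theorem active_of_dominant
    (hfull : ∀ I : Finset (Fin n), I.Nonempty → I ∈ fundFamily Δ G) (hΦ : IsRootSystem Φ)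
    (hΔ : IsSimpleSystem Φ Δ)
    (hG : IsBuildingSet Φ G) (hV : ⊤ ∈ G) (hε : IsSuitable Φ Δ G ε)
    (hv : v ∈ (polyhedron (inequalities Φ Δ G ε)).extremePoints ℝ)
    (hdom : ∀ i, 0 ≤ ⟪v, Δ i⟫_ℝ) :
    (active (inequalities Φ Δ G ε) v).encard = n ∧
      ∀ p ∈ active (inequalities Φ Δ G ε) v, ∃ u : V, ⟪u, p.1⟫_ℝ = 0 ∧
        ∀ q ∈ active (inequalities Φ Δ G ε) v, q ≠ p → ⟪u, q.1⟫_ℝ < 0 := by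
  classical
  have hpos := inner_simple_pos_of_mem_extremePoints hfull hΦ hΔ hG hV hε hv hdom
  set C : Finset (Finset (Fin n)) :=
    {I | I ≠ Finset.univ ∧ ⟪v, normalVec Φ Δ G I⟫_ℝ = bound Δ G ε I} with hC
  have hCmem : ∀ {I}, I ∈ C ↔ I ≠ Finset.univ ∧ ⟪v, normalVec Φ Δ G I⟫_ℝ = bound Δ G ε I := by
    simp [hC]
  have hact : active (inequalities Φ Δ G ε) v =
      (fun I => (normalVec Φ Δ G I, bound Δ G ε I)) '' (C : Set (Finset (Fin n))) := by
    rw [active_eq_image_of_pos hΦ hΔ hG hV hv.1 hpos]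
    congr 1
    ext I
    exact hCmem.symm
  have hinj : Function.Injective fun I => (normalVec Φ Δ G I, bound Δ G ε I) := fun I J h =>
    normalVec_injective hΦ hΔ hG hV (Prod.ext_iff.1 h).1
  -- In a chain of proper subsets the cardinalities are distinct and lie in 0, …, n - 1.
  have hle : C.card ≤ n := by
    refine LE.le.trans_eq ?_ (Finset.card_range n)
    refine Finset.card_le_card_of_injOn Finset.card (fun I hI => ?_) fun I hI J hJ hIJ => ?_
    · have := Finset.card_lt_card (Finset.ssubset_univ_iff.2 (hCmem.1 hI).1)
      simpa using this
    · rcases subset_or_subset_of_active hfull hΦ hΔ hG hV hε hv.1 hpos (hCmem.1 hI).2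
        (hCmem.1 hJ).2 with h | h
      · exact Finset.eq_of_subset_of_card_le h hIJ.ge
      · exact (Finset.eq_of_subset_of_card_le h hIJ.le).symm
  have hzero : ∀ u : V, (∀ I : C, ⟪u, normalVec Φ Δ G (I : Finset (Fin n))⟫_ℝ = 0) → u = 0 := by
    intro u hu
    refine eq_zero_of_mem_extremePoints (finite_inequalities hΦ hΔ) hv u fun p hp => ?_
    rw [hact] at hp
    obtain ⟨I, hI, rfl⟩ := hp
    exact hu ⟨I, hI⟩
  -- Extremality makes the pairing with the active normals injective, so there are at least n of
  -- them; being exactly n, they can be given independent values to produce `u`.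
  have hge : n ≤ C.card := by
    let f : V →ₗ[ℝ] (C → ℝ) := LinearMap.pi fun I : C =>
      (innerSL ℝ (normalVec Φ Δ G (I : Finset (Fin n))) : V →ₗ[ℝ] ℝ)
    have hf : Function.Injective f := by
      rw [injective_iff_map_eq_zero]
      intro u hu
      exact hzero u fun I => (real_inner_comm _ _).trans (congrFun hu I)
    have := LinearMap.finrank_le_finrank_of_injective hf
    rwa [finrank_eq Δ, Module.finrank_fintype_fun_eq_card, Fintype.card_coe] at this
  have hcard : C.card = n := le_antisymm hle hge
  rw [hact]
  refine ⟨by rw [hinj.encard_image, Set.encard_coe_eq_coe_finsetCard, hcard], ?_⟩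
  rintro _ ⟨I, hI, rfl⟩
  obtain ⟨u, hu⟩ := exists_forall_inner_eq (fun J : C => normalVec Φ Δ G (J : Finset (Fin n)))
    (by rw [Fintype.card_coe, hcard, finrank_eq Δ]) hzero
    fun J : C => if (J : Finset (Fin n)) = I then 0 else -1
  refine ⟨u, (hu ⟨I, hI⟩).trans (if_pos rfl), ?_⟩
  rintro _ ⟨J, hJ, rfl⟩ hne
  have hJI : J ≠ I := fun h => hne (h ▸ rfl)
  exact ((hu ⟨J, hJ⟩).trans (if_neg hJI)).trans_lt (by norm_num)

/-! ### Invariance under `W` and arbitrary vertices of the full permutonestohedron -/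

theorem mem_active_apply_iff {σ : V ≃ₗᵢ[ℝ] V} (hσ : σ ∈ weylGroup Φ) {p : V × ℝ} :
    (σ p.1, p.2) ∈ active (inequalities Φ Δ G ε) (σ v) ↔ p ∈ active (inequalities Φ Δ G ε) v := by
  have hK : ∀ {τ : V ≃ₗᵢ[ℝ] V}, τ ∈ weylGroup Φ → ∀ {q : V × ℝ},
      q ∈ inequalities Φ Δ G ε → (τ q.1, q.2) ∈ inequalities Φ Δ G ε := by
    rintro τ hτ _ ⟨ρ, hρ, I, hI, rfl⟩
    exact ⟨τ * ρ, mul_mem hτ hρ, I, hI, rfl⟩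
  refine and_congr ⟨fun h => ?_, hK hσ⟩ ?_
  · have := hK (inv_mem hσ) h
    simpa only [inv_apply_apply] using this
  · rw [σ.inner_map_map]

theorem apply_mem_polyhedron {σ : V ≃ₗᵢ[ℝ] V} (hσ : σ ∈ weylGroup Φ)
    (hv : v ∈ polyhedron (inequalities Φ Δ G ε)) : σ v ∈ polyhedron (inequalities Φ Δ G ε) := by
  rintro _ ⟨τ, hτ, I, hI, rfl⟩
  have := hv _ ⟨σ⁻¹ * τ, mul_mem (inv_mem hσ) hτ, I, hI, rfl⟩
  rwa [isometry_mul_apply, ← inner_map_inv] at this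

theorem apply_mem_extremePoints (hΦ : IsRootSystem Φ) (hΔ : IsSimpleSystem Φ Δ)
    {σ : V ≃ₗᵢ[ℝ] V} (hσ : σ ∈ weylGroup Φ)
    (hv : v ∈ (polyhedron (inequalities Φ Δ G ε)).extremePoints ℝ) :
    σ v ∈ (polyhedron (inequalities Φ Δ G ε)).extremePoints ℝ := by
  refine mem_extremePoints_polyhedron (apply_mem_polyhedron hσ hv.1) fun u hu => ?_
  have h := eq_zero_of_mem_extremePoints (finite_inequalities hΦ hΔ) hv (σ⁻¹ u) fun p hp => by
    rw [inner_map_inv, inv_inv]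
    exact hu _ ((mem_active_apply_iff hσ).2 hp)
  rw [← apply_inv_apply σ u, h, map_zero]

theorem encard_facets_of_full (hΦ : IsRootSystem Φ) (hΔ : IsSimpleSystem Φ Δ)
    (hG : IsBuildingSet Φ G) (hV : ⊤ ∈ G) (hε : IsSuitable Φ Δ G ε)
    (hfull : ∀ I : Finset (Fin n), I.Nonempty → I ∈ fundFamily Δ G)
    (hv : v ∈ (polyhedron (inequalities Φ Δ G ε)).extremePoints ℝ) :
    {F | IsFacet (polyhedron (inequalities Φ Δ G ε)) F ∧ v ∈ F}.encard = n := by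
  obtain ⟨σ, hσ, hdom⟩ := exists_dominant_apply hΦ hΔ v
  obtain ⟨hcard, hdir⟩ := active_of_dominant hfull hΦ hΔ hG hV hε
    (apply_mem_extremePoints hΦ hΔ hσ hv) hdom
  have hinj : Function.Injective fun p : V × ℝ => (σ p.1, p.2) := fun p q h =>
    Prod.ext (σ.injective (Prod.ext_iff.1 h).1) (Prod.ext_iff.1 h).2
  have himg : active (inequalities Φ Δ G ε) (σ v) =
      (fun p : V × ℝ => (σ p.1, p.2)) '' active (inequalities Φ Δ G ε) v := by
    ext p
    constructor
    · intro hp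
      have hp' : (σ (σ⁻¹ p.1), p.2) = p := by rw [apply_inv_apply]
      exact ⟨(σ⁻¹ p.1, p.2), (mem_active_apply_iff hσ).1 (by rwa [hp']), hp'⟩
    · rintro ⟨q, hq, rfl⟩
      exact (mem_active_apply_iff hσ).2 hq
  rw [encard_facets (finite_inequalities hΦ hΔ) (inner_zero_lt hΦ hΔ hG hV hε) hv.1,
    ← hinj.encard_image, ← himg, hcard]
  intro p hp
  obtain ⟨u, hu0, hu⟩ := hdir _ ((mem_active_apply_iff hσ).2 hp)
  refine ⟨σ⁻¹ u, ?_, fun q hq hqp => ?_⟩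
  · rw [inner_map_inv, inv_inv]
    exact hu0
  · rw [inner_map_inv, inv_inv]
    exact hu _ ((mem_active_apply_iff hσ).2 hq) (hinj.ne hqp)

/-- If `G` is not maximal, some maximal nested set is not a chain. -/
theorem exists_maximal_not_chain (hΦ : IsRootSystem Φ) (hΔ : IsSimpleSystem Φ Δ)
    (hG : IsBuildingSet Φ G) (hV : ⊤ ∈ G)
    (hW : ∀ σ ∈ weylGroup Φ, ∀ A ∈ G, A.map (σ.toLinearEquiv : V →ₗ[ℝ] V) ∈ G)
    (hne : G ≠ rootSubspaces Φ) :
    ∃ S, Maximal (Nested (fundFamily Δ G)) S ∧ ¬ ∀ A ∈ S, ∀ C ∈ S, A ⊆ C ∨ C ⊆ A := by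
  have hB := hG.isBuildingFamily hΦ hΔ hV
  obtain ⟨C, hC, hCG⟩ : ∃ C ∈ rootSubspaces Φ, C ∉ G := by
    by_contra h
    push Not at h
    exact hne (hG.subset.antisymm h)
  obtain ⟨σ, hσ, I, hI⟩ := exists_map_eq_simpleSpan hΦ hΔ hC
  have hIG : I ∉ fundFamily Δ G := by
    intro h
    -- Invariance of `G` under `W` brings membership of the fundamental conjugate back to `C`.
    have h1 := hW σ⁻¹ (inv_mem hσ) _ h
    rw [← hI, ← Submodule.map_comp] at h1
    have h2 : ((σ⁻¹ : V ≃ₗᵢ[ℝ] V).toLinearEquiv : V →ₗ[ℝ] V) ∘ₗ (σ.toLinearEquiv : V →ₗ[ℝ] V) =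
        LinearMap.id := LinearMap.ext fun x => inv_apply_apply σ x
    rw [h2, Submodule.map_id] at h1
    exact hCG h1
  have hIne : I.Nonempty := by
    obtain ⟨s, hs, ⟨α, hα⟩, rfl⟩ := hC
    by_contra h
    rw [Finset.not_nonempty_iff_eq_empty] at h
    have h1 : σ α ∈ simpleSpan Δ I :=
      hI ▸ Submodule.mem_map_of_mem (Submodule.subset_span hα)
    rw [h, simpleSpan, Finset.coe_empty, Set.image_empty, Submodule.span_empty,
      Submodule.mem_bot] at h1
    exact hΦ.ne_zero _ (weylGroup_apply_mem hΦ hσ α (hs hα)) h1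
  obtain ⟨S, hsub, hS⟩ := (nested_components (B := fundFamily Δ G) I).exists_maximal
  refine ⟨S, hS, fun hchain => ?_⟩
  obtain ⟨i, hi⟩ := hIne
  obtain ⟨A, hA, hiA⟩ := hB.exists_mem_component hi
  -- Since `I` is not in the family it has at least two components; they are disjoint, hence
  -- incomparable.
  have hAI : A ≠ I := fun h => hIG (h ▸ mem_of_mem_components hA)
  obtain ⟨j, hjI, hjA⟩ := Finset.exists_of_ssubset
    (Finset.ssubset_iff_subset_ne.2 ⟨subset_of_mem_components hA, hAI⟩)
  obtain ⟨D, hD, hjD⟩ := hB.exists_mem_component hjI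
  rcases hchain A (hsub hA) D (hsub hD) with h | h
  · exact hjA ((hB.eq_of_mem_components hA hD hiA (h hiA)) ▸ hjD)
  · exact hjA (h hjD)

end Vertices

end Permutonestohedron

end

/-! ### The main theorem -/

open Permutonestohedron in
theorem mainTheorem5 {V : Type*} [NormedAddCommGroup V] [InnerProductSpace ℝ V]
    [FiniteDimensional ℝ V] {n : ℕ}
    (Φ : Finset V) (hΦ : IsRootSystem Φ)
    (Δ : Module.Basis (Fin n) ℝ V) (hΔ : IsSimpleSystem Φ Δ)
    (G : Set (Submodule ℝ V)) (hG : IsBuildingSet Φ G) (hV : ⊤ ∈ G)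
    (hW : ∀ σ ∈ weylGroup Φ, ∀ A ∈ G, A.map (σ.toLinearEquiv : V →ₗ[ℝ] V) ∈ G)
    (ε : ℕ → ℝ) (hε : IsSuitable Φ Δ G ε) :
    (∀ S : Set (Submodule ℝ V), IsMaximalNested (fund Δ G) S →
      ∃ v : V, (⋂ A ∈ S, hyperplane Φ Δ ε A) = {v} ∧
        v ∈ (nestohedron Φ Δ G ε).extremePoints ℝ ∧
        v ∈ (permutonestohedron Φ Δ G ε).extremePoints ℝ ∧
        ({F | IsFacet (permutonestohedron Φ Δ G ε) F ∧ v ∈ F}.encard = n ↔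
          ∃! A, Minimal (fun X => X ∈ S) A)) ∧
    IsPolytope (permutonestohedron Φ Δ G ε) ∧
    dimension (permutonestohedron Φ Δ G ε) = n ∧
    (IsSimplePolytope (permutonestohedron Φ Δ G ε) ↔ G = rootSubspaces Φ) := by
  have hB := hG.isBuildingFamily hΦ hΔ hV
  have hpoly : IsPolytope (polyhedron (inequalities Φ Δ G ε)) := isPolytope_polyhedron
    (finite_inequalities hΦ hΔ) (isBounded_permutonestohedron hΦ hΔ hG hV)
  have hdim : dimension (polyhedron (inequalities Φ Δ G ε)) = n := by
    rw [dimension_polyhedron (finite_inequalities hΦ hΔ) (inner_zero_lt hΦ hΔ hG hV hε),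
      finrank_eq Δ]
  rw [permutonestohedron_eq hΦ hΔ hG hV]
  have hcount : ∀ {S : Finset (Finset (Fin n))} {v : V}, Maximal (Nested (fundFamily Δ G)) S →
      (∀ A ∈ S, ⟪v, halfSum Φ Δ A⟫_ℝ = ε A.card) →
      ({F | IsFacet (polyhedron (inequalities Φ Δ G ε)) F ∧ v ∈ F}.encard = n ↔
        ∀ A ∈ S, ∀ C ∈ S, A ⊆ C ∨ C ⊆ A) := by
    intro S v hS hv
    rw [encard_facets_vertex hΦ hΔ hG hV hε hS hv, ← card_activeSets_eq_iff hB hS,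
      Fintype.card_fin, Nat.cast_inj]
  refine ⟨fun S hS => ?_, hpoly, hdim, fun hsimple => ?_, fun hfull => ⟨hpoly, fun v hv => ?_⟩⟩
  · obtain ⟨S, rfl⟩ := exists_finset_of_subset_fund hS.prop.1
    have hS' := isMaximalNested_image_iff.1 hS
    obtain ⟨v, hv⟩ := exists_vertex hΦ hΔ hG hV hS' fun A => ε (A : Finset (Fin n)).card
    have hv' : ∀ A ∈ S, ⟪v, halfSum Φ Δ A⟫_ℝ = ε A.card := fun A hA => hv ⟨A, hA⟩
    exact ⟨v, biInter_hyperplane hΦ hΔ hG hV hS' hv',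
      vertex_mem_extremePoints_nestohedron hΦ hΔ hG hV hε hS' hv',
      vertex_mem_extremePoints hΦ hΔ hG hV hε hS' hv',
      (hcount hS' hv').trans (existsUnique_minimal_iff hΦ hΔ hG hV hS').symm⟩
  · by_contra hne
    obtain ⟨S, hS, hchain⟩ := exists_maximal_not_chain hΦ hΔ hG hV hW hne
    obtain ⟨v, hv⟩ := exists_vertex hΦ hΔ hG hV hS fun A => ε (A : Finset (Fin n)).card
    have hv' : ∀ A ∈ S, ⟪v, halfSum Φ Δ A⟫_ℝ = ε A.card := fun A hA => hv ⟨A, hA⟩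
    refine hchain ((hcount hS hv').1 ?_)
    rw [hsimple.2 v (vertex_mem_extremePoints hΦ hΔ hG hV hε hS hv'), hdim]
  · rw [hdim]
    refine encard_facets_of_full hΦ hΔ hG hV hε (fun I hI => ?_) hv
    rw [mem_fundFamily, hfull]
    exact simpleSpan_mem_rootSubspaces hΔ hI
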